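/- Let $G \rightrightarrows M$ be a Lie groupoid ($M$, $G$ finite-dimensional smooth manifolds) with source $s$, target $t$, units $1_x$, and let $E \to M$ be a smooth real vector bundle of finite rank. For a smooth vector bundle $C \to M$, a 2-term representation up to homotopy of $G$ on $E \oplus C[1]$ is a 4-tuple $(\Delta^C, \Delta^E, \partial, \Omega)$ of smooth families of linear maps $\Delta^C_g : C_{s(g)} \to C_{t(g)}$, $\Delta^E_g : E_{s(g)} \to E_{t(g)}$ ($g \in G$), $\partial : C \to E$ (a vector bundle map over $\mathrm{id}_M$), and $\Omega_{g_1,g_2} : E_{s(g_2)} \to C_{t(g_1)}$ (for composable $(g_1,g_2)$, i.e. $s(g_1)=t(g_2)$), such that $\Delta^C_{1_x} = \mathrm{id}$, $\Delta^E_{1_x} = \mathrm{id}$, $\Omega_{g_1,g_2} = 0$ if $g_1$ or $g_2$ is a unit, and for all composable $g_1, g_2, g_3$ $$\Delta^E_{g_1}\partial - \partial\Delta^C_{g_1} = 0,\qquad \Delta^C_{g_1}\Delta^C_{g_2} - \Delta^C_{g_1g_2} + \Omega_{g_1,g_2}\partial = 0,\qquad \Delta^E_{g_1}\Delta^E_{g_2}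 - \Delta^E_{g_1g_2} + \partial\,\Omega_{g_1,g_2} = 0,$$ $$\Delta^C_{g_1}\Omega_{g_2,g_3} - \Omega_{g_1g_2,g_3} + \Omega_{g_1,g_2g_3} - \Omega_{g_1,g_2}\Delta^E_{g_3} = 0.$$ A VB-groupoid over $G$ with side bundle $E$ is a smooth vector bundle $\Gamma \to G$ together with a Lie groupoid structure $\Gamma \rightrightarrows E$ (source $\tilde s$, target $\tilde t$, units $\tilde 1$) such that $\tilde s, \tilde t$ are vector bundle morphisms over $s, t$, the bundle projections form a morphism of Lie groupoids, and the interchange law $(\gamma_1+\gamma_3)(\gamma_2+\gamma_4)=\gamma_1\gamma_2+\gamma_3\gamma_4$ holds whenever $(\gamma_1,\gamma_2)$ and $(\gamma_3,\gamma_4)$ are composable, $\gamma_1,\gamma_3$ lie in one fibre of $\Gamma$, and $\gamma_2,\gamma_4$ lie in one fibre. A horizontal lift is a vector bundle morphism $h: s^*E \to \Gamma$ over $\mathrm{id}_G$ with $\tilde s(h_g(e)) = e$ and $h_{1_x}(e) = \tilde 1_e$. The core is the vector bundle over $M$ with fibre $\ker(\tilde s : \Gamma_{1_x} \to E_x)$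 at $x$; an identification of a vector bundle $C$ with the core is a smooth, fibrewise injective vector bundle morphism $k: C \to \Gamma$ over $x \mapsto 1_x$ whose image is the core. Write $0_g$ for the zero of $\Gamma_g$. Then there is a one-to-one correspondence between 2-term representations up to homotopy and VB-groupoids equipped with horizontal lifts, as follows. (1) For every representation up to homotopy $D=(\Delta^C,\Delta^E,\partial,\Omega)$ on $E\oplus C[1]$, the vector bundle $\Gamma_D = t^*C \oplus s^*E = \{(c,g,e) : c\in C_{t(g)},\ e\in E_{s(g)}\}$ with $$\tilde s(c,g,e) = e,\qquad \tilde t(c,g,e)=\partial c+\Delta^E_g e,$$ $$(c_1,g_1,e_1)\cdot(c_2,g_2,e_2) = (c_1+\Delta^C_{g_1}c_2-\Omega_{g_1,g_2}e_2,\ g_1g_2,\ e_2)\quad\text{when } s(g_1)=t(g_2),\ e_1=\partial c_2+\Delta^E_{g_2}e_2,$$ units $\tilde 1_e=(0,1_x,e)$ for $e\in E_x$ and inverses $(c,g,e)^{-1}=(-\Delta^C_{g^{-1}}c+\Omega_{g^{-1},g}e,\ g^{-1},\ \partial c+\Delta^E_g e)$ is a VB-groupoid; $h_D(g,e) = (0,g,e)$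 is a horizontal lift of it; $c\mapsto(c,1_x,0)$ identifies $C$ with its core; and the components computed from $(\Gamma_D,h_D)$ by the formulas in (2) are those of $D$. (2) Let $\Gamma$ be a VB-groupoid over $G$ with side bundle $E$ and $h$ a horizontal lift. Then there is a smooth vector bundle $C$ identified with its core. For every such identification $k: C\to\Gamma$ (written as an inclusion) the formulas $$\partial c=\tilde t(c),\qquad \Delta^E_g e=\tilde t(h_g(e)),\qquad \Delta^C_g c=h_g(\tilde t(c))\cdot c\cdot 0_{g^{-1}},$$ $$\Omega_{g_1,g_2}e=\bigl(h_{g_1g_2}(e)-h_{g_1}(\Delta^E_{g_2}e)\cdot h_{g_2}(e)\bigr)\cdot 0_{(g_1g_2)^{-1}}$$ define a unique representation up to homotopy $D$ on $E\oplus C[1]$, and $(c,g,e)\mapsto c\cdot 0_g+h_g(e)$ is an isomorphism of VB-groupoids $\Gamma_D\to\Gamma$ over the identities of $G$ and $E$ that takes $h_D$ to $h$. (3) For representations up to homotopy $D$ on $E\oplus C[1]$ and $D'$ on $E\oplus C'[1]$, the isomorphisms of VB-groupoids $\Gamma_D\to\Gamma_{D'}$ over the identities of $G$ and $E$ that take $h_D$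 to $h_{D'}$ are exactly the maps $(c,g,e)\mapsto(\varphi(c),g,e)$, where $\varphi:C\to C'$ is a vector bundle isomorphism over $\mathrm{id}_M$ that carries the components of $D$ to those of $D'$. Consequently $D\mapsto(\Gamma_D,h_D)$ induces a bijection from the set of 2-term representations up to homotopy on $E\oplus C[1]$ ($C$ arbitrary), up to isomorphisms of $C$, onto the set of VB-groupoids over $G$ with side bundle $E$ equipped with a horizontal lift, up to isomorphisms over the identities of $G$ and $E$ that preserve the horizontal lift. -/

import Mathlib

universe u v w₁ w₂ w₃ w₄

open Bundle
open scoped Manifold ContDiff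

noncomputable section

/-! ## Smooth vector bundles -/

/-- A smooth real vector bundle of finite rank over the manifold `B`, in bundled form. -/
structure SmoothVectorBundle {EB : Type w₁} [NormedAddCommGroup EB]
    [NormedSpace ℝ EB] {HB : Type w₂} [TopologicalSpace HB] (IB : ModelWithCorners ℝ EB HB)
    (B : Type w₃) [TopologicalSpace B] [ChartedSpace HB B] where
  /-- the model fibre -/
  Model : Type u
  [normedAddCommGroup : NormedAddCommGroup Model]
  [normedSpace : NormedSpace ℝ Model]
  [finiteDimensional : FiniteDimensional ℝ Model]
  /-- the fibres -/
  Fiber : B → Type v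
  [addCommGroup : ∀ x, AddCommGroup (Fiber x)]
  [module : ∀ x, Module ℝ (Fiber x)]
  [topologicalSpaceTotal : TopologicalSpace (TotalSpace Model Fiber)]
  [topologicalSpaceFiber : ∀ x, TopologicalSpace (Fiber x)]
  [fiberBundle : FiberBundle Model Fiber]
  [vectorBundle : VectorBundle ℝ Model Fiber]
  [contMDiffVectorBundle : ContMDiffVectorBundle ∞ Model Fiber IB]

namespace SmoothVectorBundle

attribute [instance] normedAddCommGroup normedSpace finiteDimensional addCommGroup module
  topologicalSpaceTotal topologicalSpaceFiber fiberBundle vectorBundle contMDiffVectorBundle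

variable {EB : Type*} [NormedAddCommGroup EB] [NormedSpace ℝ EB] {HB : Type*} [TopologicalSpace HB]
  {IB : ModelWithCorners ℝ EB HB} {B : Type*} [TopologicalSpace B] [ChartedSpace HB B]
  {EB' : Type*} [NormedAddCommGroup EB'] [NormedSpace ℝ EB'] {HB' : Type*} [TopologicalSpace HB']
  {IB' : ModelWithCorners ℝ EB' HB'} {B' : Type*} [TopologicalSpace B'] [ChartedSpace HB' B']

/-- The total space of a bundle; it is a manifold with model `IB.prod 𝓘(ℝ, E.Model)`. -/
abbrev Tot (E : SmoothVectorBundle IB B) := TotalSpace E.Model E.Fiber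

/-- The model with corners of the total space. -/
abbrev TotI (E : SmoothVectorBundle IB B) := IB.prod 𝓘(ℝ, E.Model)

/-- The identification of the fibres over two equal points. -/
def tr (E : SmoothVectorBundle IB B) {x y : B} (h : x = y) : E.Fiber x ≃ₗ[ℝ] E.Fiber y :=
  h ▸ LinearEquiv.refl ℝ (E.Fiber x)

theorem mk_tr (E : SmoothVectorBundle IB B) {x y : B} (h : x = y) (v : E.Fiber x) :
    (⟨y, E.tr h v⟩ : E.Tot) = ⟨x, v⟩ := by
  subst h; rfl

/-- The pullback bundle `f^* E`, with fibre `E_{f(b)}` over `b`. -/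
def pullback (E : SmoothVectorBundle IB B) (f : C^∞⟮IB', B'; IB, B⟯) :
    SmoothVectorBundle IB' B' where
  Model := E.Model
  Fiber := (f : B' → B) *ᵖ E.Fiber
  addCommGroup := fun x => inferInstanceAs (AddCommGroup (E.Fiber (f x)))
  module := fun x => inferInstanceAs (Module ℝ (E.Fiber (f x)))

/-- The direct (Whitney) sum of two bundles over the same base. -/
def sum [IsManifold IB ∞ B] (E₁ E₂ : SmoothVectorBundle IB B) : SmoothVectorBundle IB B where
  Model := E₁.Model × E₂.Model
  Fiber := E₁.Fiber ×ᵇ E₂.Fiber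

/-- A family of linear maps `E_b → E'_{f(b)}` is a morphism of vector bundles over `f` if the
induced map of total spaces is smooth. -/
def IsBundleMap (E : SmoothVectorBundle IB B) (E' : SmoothVectorBundle IB' B') (f : B → B')
    (L : ∀ b, E.Fiber b →ₗ[ℝ] E'.Fiber (f b)) : Prop :=
  ContMDiff E.TotI E'.TotI ∞ (fun p : E.Tot => (⟨f p.proj, L p.proj p.snd⟩ : E'.Tot))

end SmoothVectorBundle

/-! ## Lie groupoids -/

/-- The structure maps of a groupoid with objects `M` and arrows `G`.  The value `mul g h` is only
meaningful when `src g = tgt h`. -/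
structure GroupoidData (M G : Type*) where
  src : G → M
  tgt : G → M
  mul : G → G → G
  one : M → G
  inv : G → G

section LieGroupoids

variable {EM : Type*} [NormedAddCommGroup EM] [NormedSpace ℝ EM] {HM : Type*} [TopologicalSpace HM]
  (IM : ModelWithCorners ℝ EM HM) {M : Type*} [TopologicalSpace M] [ChartedSpace HM M]
  {EG : Type*} [NormedAddCommGroup EG] [NormedSpace ℝ EG] {HG : Type*} [TopologicalSpace HG]
  (IG : ModelWithCorners ℝ EG HG) {G : Type*} [TopologicalSpace G] [ChartedSpace HG G]

/-- The structure maps `S` make `G ⇉ M` a Lie groupoid.  The set of composable pairs is an embedded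
submanifold of `G × G` because the source map is a submersion; smoothness of the multiplication on
it is smoothness on that subset of `G × G`.  (The target map is the source map composed with the
inversion, hence it is a submersion too.) -/
structure IsLieGroupoid (S : GroupoidData M G) : Prop where
  src_one : ∀ x, S.src (S.one x) = x
  tgt_one : ∀ x, S.tgt (S.one x) = x
  src_mul : ∀ {g h}, S.src g = S.tgt h → S.src (S.mul g h) = S.src h
  tgt_mul : ∀ {g h}, S.src g = S.tgt h → S.tgt (S.mul g h) = S.tgt g
  mul_assoc : ∀ {g h k}, S.src g = S.tgt h → S.src h = S.tgt k →
    S.mul (S.mul g h) k = S.mul g (S.mul h k)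
  one_mul : ∀ g, S.mul (S.one (S.tgt g)) g = g
  mul_one : ∀ g, S.mul g (S.one (S.src g)) = g
  src_inv : ∀ g, S.src (S.inv g) = S.tgt g
  tgt_inv : ∀ g, S.tgt (S.inv g) = S.src g
  inv_mul : ∀ g, S.mul (S.inv g) g = S.one (S.src g)
  mul_inv : ∀ g, S.mul g (S.inv g) = S.one (S.tgt g)
  contMDiff_src : ContMDiff IG IM ∞ S.src
  contMDiff_tgt : ContMDiff IG IM ∞ S.tgt
  contMDiff_one : ContMDiff IM IG ∞ S.one
  contMDiff_inv : ContMDiff IG IG ∞ S.inv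
  contMDiffOn_mul : ContMDiffOn (IG.prod IG) IG ∞ (fun p : G × G => S.mul p.1 p.2)
    {p : G × G | S.src p.1 = S.tgt p.2}
  submersion_src : ∀ g, Function.Surjective (mfderiv IG IM S.src g)

variable (M G) in
/-- A Lie groupoid `G ⇉ M`, in bundled form. -/
structure LieGroupoid where
  src : C^∞⟮IG, G; IM, M⟯
  tgt : C^∞⟮IG, G; IM, M⟯
  mul : G → G → G
  one : M → G
  inv : G → G
  isLie : IsLieGroupoid IM IG (⟨src, tgt, mul, one, inv⟩ : GroupoidData M G)

end LieGroupoids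

namespace LieGroupoid

variable {EM : Type*} [NormedAddCommGroup EM] [NormedSpace ℝ EM] {HM : Type*} [TopologicalSpace HM]
  {IM : ModelWithCorners ℝ EM HM} {M : Type*} [TopologicalSpace M] [ChartedSpace HM M]
  {EG : Type*} [NormedAddCommGroup EG] [NormedSpace ℝ EG] {HG : Type*} [TopologicalSpace HG]
  {IG : ModelWithCorners ℝ EG HG} {G : Type*} [TopologicalSpace G] [ChartedSpace HG G]
  (𝒢 : LieGroupoid IM M IG G)

theorem src_one (x : M) : 𝒢.src (𝒢.one x) = x := 𝒢.isLie.src_one x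
theorem tgt_one (x : M) : 𝒢.tgt (𝒢.one x) = x := 𝒢.isLie.tgt_one x
theorem src_one_eq_tgt_one (x : M) : 𝒢.src (𝒢.one x) = 𝒢.tgt (𝒢.one x) :=
  (𝒢.src_one x).trans (𝒢.tgt_one x).symm
theorem src_mul {g h : G} (H : 𝒢.src g = 𝒢.tgt h) : 𝒢.src (𝒢.mul g h) = 𝒢.src h :=
  𝒢.isLie.src_mul H
theorem tgt_mul {g h : G} (H : 𝒢.src g = 𝒢.tgt h) : 𝒢.tgt (𝒢.mul g h) = 𝒢.tgt g :=
  𝒢.isLie.tgt_mul H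
theorem src_inv (g : G) : 𝒢.src (𝒢.inv g) = 𝒢.tgt g := 𝒢.isLie.src_inv g
theorem tgt_inv (g : G) : 𝒢.tgt (𝒢.inv g) = 𝒢.src g := 𝒢.isLie.tgt_inv g

end LieGroupoid

section Main

variable {EM : Type*} [NormedAddCommGroup EM] [NormedSpace ℝ EM] {HM : Type*} [TopologicalSpace HM]
  {IM : ModelWithCorners ℝ EM HM} {M : Type*} [TopologicalSpace M] [ChartedSpace HM M]
  {EG : Type*} [NormedAddCommGroup EG] [NormedSpace ℝ EG] {HG : Type*} [TopologicalSpace HG]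
  {IG : ModelWithCorners ℝ EG HG} {G : Type*} [TopologicalSpace G] [ChartedSpace HG G]

/-! ## 2-term representations up to homotopy -/

/-- A 2-term representation up to homotopy `(Δ^C, Δ^E, ∂, Ω)` of the Lie groupoid `𝒢` on the graded
vector bundle `E ⊕ C[1]`: unital quasi-actions `Δ^C`, `Δ^E`, a bundle map `∂ : C → E`, and a
normalized transformation 2-cochain `Ω` from `E` to `C`, satisfying the four structure equations.
A transformation 2-cochain lives on composable pairs only; by convention `Ω g₁ g₂ = 0` for pairs
that are not composable. -/
structure Ruth (𝒢 : LieGroupoid IM M IG G) (E C : SmoothVectorBundle IM M) where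
  ΔC : ∀ g : G, C.Fiber (𝒢.src g) →ₗ[ℝ] C.Fiber (𝒢.tgt g)
  ΔE : ∀ g : G, E.Fiber (𝒢.src g) →ₗ[ℝ] E.Fiber (𝒢.tgt g)
  bd : ∀ x : M, C.Fiber x →ₗ[ℝ] E.Fiber x
  Ω : ∀ g₁ g₂ : G, E.Fiber (𝒢.src g₂) →ₗ[ℝ] C.Fiber (𝒢.tgt g₁)
  Ω_off : ∀ g₁ g₂, 𝒢.src g₁ ≠ 𝒢.tgt g₂ → Ω g₁ g₂ = 0
  smooth_ΔC : (C.pullback 𝒢.src).IsBundleMap C 𝒢.tgt ΔC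
  smooth_ΔE : (E.pullback 𝒢.src).IsBundleMap E 𝒢.tgt ΔE
  smooth_bd : C.IsBundleMap E id bd
  smooth_Ω : ContMDiffOn (IG.prod (E.pullback 𝒢.src).TotI) C.TotI ∞
    (fun p : G × (E.pullback 𝒢.src).Tot =>
      (⟨𝒢.tgt p.1, Ω p.1 p.2.proj p.2.snd⟩ : C.Tot))
    {p | 𝒢.src p.1 = 𝒢.tgt p.2.proj}
  unital_ΔC : ∀ x c, ΔC (𝒢.one x) c = C.tr (𝒢.src_one_eq_tgt_one x) c
  unital_ΔE : ∀ x e, ΔE (𝒢.one x) e = E.tr (𝒢.src_one_eq_tgt_one x) e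
  normalized_left : ∀ g, Ω (𝒢.one (𝒢.tgt g)) g = 0
  normalized_right : ∀ g, Ω g (𝒢.one (𝒢.src g)) = 0
  eq_one : ∀ g c, ΔE g (bd (𝒢.src g) c) - bd (𝒢.tgt g) (ΔC g c) = 0
  eq_two : ∀ g₁ g₂ (H : 𝒢.src g₁ = 𝒢.tgt g₂) (c : C.Fiber (𝒢.src g₂)),
    ΔC g₁ (C.tr H.symm (ΔC g₂ c))
      - C.tr (𝒢.tgt_mul H) (ΔC (𝒢.mul g₁ g₂) (C.tr (𝒢.src_mul H).symm c))
      + Ω g₁ g₂ (bd (𝒢.src g₂) c) = 0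
  eq_three : ∀ g₁ g₂ (H : 𝒢.src g₁ = 𝒢.tgt g₂) (e : E.Fiber (𝒢.src g₂)),
    ΔE g₁ (E.tr H.symm (ΔE g₂ e))
      - E.tr (𝒢.tgt_mul H) (ΔE (𝒢.mul g₁ g₂) (E.tr (𝒢.src_mul H).symm e))
      + bd (𝒢.tgt g₁) (Ω g₁ g₂ e) = 0
  eq_four : ∀ g₁ g₂ g₃ (H : 𝒢.src g₁ = 𝒢.tgt g₂) (K : 𝒢.src g₂ = 𝒢.tgt g₃)
      (e : E.Fiber (𝒢.src g₃)),
    ΔC g₁ (C.tr H.symm (Ω g₂ g₃ e))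
      - C.tr (𝒢.tgt_mul H) (Ω (𝒢.mul g₁ g₂) g₃ e)
      + Ω g₁ (𝒢.mul g₂ g₃) (E.tr (𝒢.src_mul K).symm e)
      - Ω g₁ g₂ (E.tr K.symm (ΔE g₃ e)) = 0

/-! ## VB-groupoids, horizontal lifts, cores -/

/-- The structure maps `V` make the total space of the vector bundle `Γ → G`, over the total space
of the vector bundle `E → M`, a VB-groupoid over `𝒢`. -/
structure IsVBGroupoid (𝒢 : LieGroupoid IM M IG G) (E : SmoothVectorBundle IM M)
    (Γ : SmoothVectorBundle IG G) (V : GroupoidData E.Tot Γ.Tot) : Prop where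
  /-- `Γ ⇉ E` is a Lie groupoid -/
  isLie : IsLieGroupoid E.TotI Γ.TotI V
  /-- the source map is a morphism of vector bundles over the source map of `𝒢` -/
  src_bundleMap : ∃ L : ∀ g, Γ.Fiber g →ₗ[ℝ] E.Fiber (𝒢.src g),
    Γ.IsBundleMap E 𝒢.src L ∧ ∀ g v, V.src ⟨g, v⟩ = ⟨𝒢.src g, L g v⟩
  /-- the target map is a morphism of vector bundles over the target map of `𝒢` -/
  tgt_bundleMap : ∃ L : ∀ g, Γ.Fiber g →ₗ[ℝ] E.Fiber (𝒢.tgt g),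
    Γ.IsBundleMap E 𝒢.tgt L ∧ ∀ g v, V.tgt ⟨g, v⟩ = ⟨𝒢.tgt g, L g v⟩
  /-- the bundle projections form a morphism of Lie groupoids (they are smooth, and compatible with
  source and target by the two preceding conditions) -/
  proj_mul : ∀ γ₁ γ₂ : Γ.Tot, V.src γ₁ = V.tgt γ₂ →
    (V.mul γ₁ γ₂).proj = 𝒢.mul γ₁.proj γ₂.proj
  /-- the interchange law: `γ₁`, `γ₃` lie over `g₁`, `γ₂`, `γ₄` lie over `g₂`, and the products
  `γ₁ γ₂ = u`, `γ₃ γ₄ = w` lie over `g₁ g₂` -/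
  interchange : ∀ (g₁ g₂ : G) (γ₁ γ₃ : Γ.Fiber g₁) (γ₂ γ₄ : Γ.Fiber g₂)
      (u w : Γ.Fiber (𝒢.mul g₁ g₂)),
    V.src ⟨g₁, γ₁⟩ = V.tgt ⟨g₂, γ₂⟩ → V.src ⟨g₁, γ₃⟩ = V.tgt ⟨g₂, γ₄⟩ →
    V.mul ⟨g₁, γ₁⟩ ⟨g₂, γ₂⟩ = ⟨𝒢.mul g₁ g₂, u⟩ →
    V.mul ⟨g₁, γ₃⟩ ⟨g₂, γ₄⟩ = ⟨𝒢.mul g₁ g₂, w⟩ →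
    V.mul ⟨g₁, γ₁ + γ₃⟩ ⟨g₂, γ₂ + γ₄⟩ = ⟨𝒢.mul g₁ g₂, u + w⟩

/-- `h : s^* E → Γ` is a (right-)horizontal lift: a vector bundle morphism over the identity of `G`
which is a section of `Γ → s^* E` and agrees with the unit map of `Γ` over the units of `𝒢`. -/
structure IsHorizontalLift (𝒢 : LieGroupoid IM M IG G) {E : SmoothVectorBundle IM M}
    {Γ : SmoothVectorBundle IG G} (V : GroupoidData E.Tot Γ.Tot)
    (h : ∀ g : G, E.Fiber (𝒢.src g) →ₗ[ℝ] Γ.Fiber g) : Prop where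
  smooth : (E.pullback 𝒢.src).IsBundleMap Γ id h
  src_lift : ∀ g e, V.src ⟨g, h g e⟩ = ⟨𝒢.src g, e⟩
  lift_one : ∀ x e, (⟨𝒢.one x, h (𝒢.one x) e⟩ : Γ.Tot) = V.one ⟨𝒢.src (𝒢.one x), e⟩

/-- `k : C → Γ` identifies the vector bundle `C → M` with the (right-)core of the VB-groupoid, that
is, with the bundle over `M` whose fibre at `x` is the kernel of the source map on the fibre of `Γ`
over the unit at `x`. -/
structure IsCore (𝒢 : LieGroupoid IM M IG G) {E : SmoothVectorBundle IM M}
    {Γ : SmoothVectorBundle IG G} (V : GroupoidData E.Tot Γ.Tot) (C : SmoothVectorBundle IM M)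
    (k : ∀ x : M, C.Fiber x →ₗ[ℝ] Γ.Fiber (𝒢.one x)) : Prop where
  smooth : C.IsBundleMap Γ 𝒢.one k
  injective : ∀ x, Function.Injective (k x)
  range_eq : ∀ x v, (∃ c, k x c = v) ↔ V.src ⟨𝒢.one x, v⟩ = ⟨x, 0⟩

/-- The formulas for the components of a VB-groupoid with horizontal lift `h` and core
`k : C → Γ`:
* `∂ c = t̃(c)`;
* `Δ^E_g e = t̃(h_g(e))`;
* `Δ^C_g c = h_g(t̃(c)) · c · 0_{g⁻¹}`;
* `Ω_{g₁,g₂} e = (h_{g₁g₂}(e) - h_{g₁}(Δ^E_{g₂} e) · h_{g₂}(e)) · 0_{(g₁g₂)⁻¹}`, where `w` denotes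
  the product `h_{g₁}(Δ^E_{g₂} e) · h_{g₂}(e)`, an element of the fibre over `g₁g₂`. -/
structure IsComponents (𝒢 : LieGroupoid IM M IG G) {E : SmoothVectorBundle IM M}
    {Γ : SmoothVectorBundle IG G} (V : GroupoidData E.Tot Γ.Tot)
    (h : ∀ g : G, E.Fiber (𝒢.src g) →ₗ[ℝ] Γ.Fiber g) {C : SmoothVectorBundle IM M}
    (k : ∀ x : M, C.Fiber x →ₗ[ℝ] Γ.Fiber (𝒢.one x)) (D : Ruth 𝒢 E C) : Prop where
  bd_eq : ∀ x c, (⟨x, D.bd x c⟩ : E.Tot) = V.tgt ⟨𝒢.one x, k x c⟩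
  ΔE_eq : ∀ g e, (⟨𝒢.tgt g, D.ΔE g e⟩ : E.Tot) = V.tgt ⟨g, h g e⟩
  ΔC_eq : ∀ g c, (⟨𝒢.one (𝒢.tgt g), k (𝒢.tgt g) (D.ΔC g c)⟩ : Γ.Tot) =
    V.mul (V.mul ⟨g, h g (D.bd (𝒢.src g) c)⟩ ⟨𝒢.one (𝒢.src g), k (𝒢.src g) c⟩) ⟨𝒢.inv g, 0⟩
  Ω_eq : ∀ g₁ g₂ (H : 𝒢.src g₁ = 𝒢.tgt g₂) (e : E.Fiber (𝒢.src g₂))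
      (w : Γ.Fiber (𝒢.mul g₁ g₂)),
    V.mul ⟨g₁, h g₁ (E.tr H.symm (D.ΔE g₂ e))⟩ ⟨g₂, h g₂ e⟩ = ⟨𝒢.mul g₁ g₂, w⟩ →
    (⟨𝒢.one (𝒢.tgt g₁), k (𝒢.tgt g₁) (D.Ω g₁ g₂ e)⟩ : Γ.Tot) =
      V.mul ⟨𝒢.mul g₁ g₂, h (𝒢.mul g₁ g₂) (E.tr (𝒢.src_mul H).symm e) - w⟩
        ⟨𝒢.inv (𝒢.mul g₁ g₂), 0⟩

/-! ## The VB-groupoid of a representation up to homotopy -/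

/-- The vector bundle `t^* C ⊕ s^* E` over `G`; its fibre over `g` is `C_{t(g)} × E_{s(g)}`. -/
def LieGroupoid.split [IsManifold IG ∞ G] (𝒢 : LieGroupoid IM M IG G)
    (C E : SmoothVectorBundle IM M) : SmoothVectorBundle IG G :=
  (C.pullback 𝒢.tgt).sum (E.pullback 𝒢.src)

/-- The element `(c, g, e)` of `t^* C ⊕ s^* E`. -/
def LieGroupoid.elt [IsManifold IG ∞ G] (𝒢 : LieGroupoid IM M IG G)
    (C E : SmoothVectorBundle IM M) (g : G) (c : C.Fiber (𝒢.tgt g)) (e : E.Fiber (𝒢.src g)) :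
    (𝒢.split C E).Tot :=
  ⟨g, (c, e)⟩

/-- The component `c` of an element `(c, g, e)` of `t^* C ⊕ s^* E`. -/
def LieGroupoid.coreC [IsManifold IG ∞ G] (𝒢 : LieGroupoid IM M IG G)
    {C E : SmoothVectorBundle IM M} (γ : (𝒢.split C E).Tot) : C.Fiber (𝒢.tgt γ.proj) :=
  γ.snd.1

/-- The component `e` of an element `(c, g, e)` of `t^* C ⊕ s^* E`. -/
def LieGroupoid.sideE [IsManifold IG ∞ G] (𝒢 : LieGroupoid IM M IG G)
    {C E : SmoothVectorBundle IM M} (γ : (𝒢.split C E).Tot) : E.Fiber (𝒢.src γ.proj) :=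
  γ.snd.2

namespace Ruth

variable [IsManifold IG ∞ G] {𝒢 : LieGroupoid IM M IG G} {E C : SmoothVectorBundle IM M}
  (D : Ruth 𝒢 E C)

open Classical in
/-- The structure maps of the groupoid `t^* C ⊕ s^* E ⇉ E` of a representation up to homotopy:
* `s̃(c, g, e) = e` and `t̃(c, g, e) = ∂ c + Δ^E_g e`;
* `(c₁, g₁, e₁) · (c₂, g₂, e₂) = (c₁ + Δ^C_{g₁} c₂ - Ω_{g₁,g₂} e₂, g₁ g₂, e₂)`;
* `1̃_e = (0, 1_x, e)` for `e ∈ E_x`;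
* `(c, g, e)⁻¹ = (-Δ^C_{g⁻¹} c + Ω_{g⁻¹,g} e, g⁻¹, ∂ c + Δ^E_g e)`. -/
def groupoid : GroupoidData E.Tot (𝒢.split C E).Tot where
  src γ := ⟨𝒢.src γ.proj, (𝒢.sideE γ)⟩
  tgt γ := ⟨𝒢.tgt γ.proj, D.bd (𝒢.tgt γ.proj) (𝒢.coreC γ) + D.ΔE γ.proj (𝒢.sideE γ)⟩
  mul γ₁ γ₂ :=
    if H : 𝒢.src γ₁.proj = 𝒢.tgt γ₂.proj then
      𝒢.elt C E (𝒢.mul γ₁.proj γ₂.proj)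
        (C.tr (𝒢.tgt_mul H).symm
          ((𝒢.coreC γ₁) + D.ΔC γ₁.proj (C.tr H.symm (𝒢.coreC γ₂)) - D.Ω γ₁.proj γ₂.proj (𝒢.sideE γ₂)))
        (E.tr (𝒢.src_mul H).symm (𝒢.sideE γ₂))
    else γ₁
  one e := 𝒢.elt C E (𝒢.one e.proj) 0 (E.tr (𝒢.src_one e.proj).symm e.snd)
  inv γ :=
    𝒢.elt C E (𝒢.inv γ.proj)
      (-D.ΔC (𝒢.inv γ.proj) (C.tr (𝒢.src_inv γ.proj).symm (𝒢.coreC γ))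
        + D.Ω (𝒢.inv γ.proj) γ.proj (𝒢.sideE γ))
      (E.tr (𝒢.src_inv γ.proj).symm
        (D.bd (𝒢.tgt γ.proj) (𝒢.coreC γ) + D.ΔE γ.proj (𝒢.sideE γ)))

end Ruth

section Split

variable [IsManifold IG ∞ G] (𝒢 : LieGroupoid IM M IG G) (C E : SmoothVectorBundle IM M)

/-- The privileged horizontal lift `(g, e) ↦ (0, g, e)` into `t^* C ⊕ s^* E`. -/
def LieGroupoid.splitLift (g : G) : E.Fiber (𝒢.src g) →ₗ[ℝ] (𝒢.split C E).Fiber g :=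
  LinearMap.inr ℝ (C.Fiber (𝒢.tgt g)) (E.Fiber (𝒢.src g))

/-- The inclusion `c ↦ (c, 1_x, 0)` of `C` into `t^* C ⊕ s^* E`. -/
def LieGroupoid.splitCore (x : M) : C.Fiber x →ₗ[ℝ] (𝒢.split C E).Fiber (𝒢.one x) :=
  LinearMap.inl ℝ (C.Fiber (𝒢.tgt (𝒢.one x))) (E.Fiber (𝒢.src (𝒢.one x))) ∘ₗ
    (C.tr (𝒢.tgt_one x).symm).toLinearMap

end Split

/-! ## Isomorphisms -/

/-- An isomorphism of VB-groupoids equipped with horizontal lifts, over the identities of `𝒢` and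
of `E`: an isomorphism of vector bundles `Γ → Γ'` over `G` that is an isomorphism of groupoids and
takes one horizontal lift to the other. -/
structure IsLiftedIso (𝒢 : LieGroupoid IM M IG G) {E : SmoothVectorBundle IM M}
    {Γ Γ' : SmoothVectorBundle IG G}
    (V : GroupoidData E.Tot Γ.Tot) (h : ∀ g : G, E.Fiber (𝒢.src g) →ₗ[ℝ] Γ.Fiber g)
    (V' : GroupoidData E.Tot Γ'.Tot) (h' : ∀ g : G, E.Fiber (𝒢.src g) →ₗ[ℝ] Γ'.Fiber g)
    (Φ : ∀ g : G, Γ.Fiber g ≃ₗ[ℝ] Γ'.Fiber g) : Prop where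
  smooth : Γ.IsBundleMap Γ' id (fun g => (Φ g).toLinearMap)
  smooth_symm : Γ'.IsBundleMap Γ id (fun g => (Φ g).symm.toLinearMap)
  map_src : ∀ γ : Γ.Tot, V'.src ⟨γ.proj, Φ γ.proj γ.snd⟩ = V.src γ
  map_tgt : ∀ γ : Γ.Tot, V'.tgt ⟨γ.proj, Φ γ.proj γ.snd⟩ = V.tgt γ
  map_mul : ∀ γ₁ γ₂ : Γ.Tot, V.src γ₁ = V.tgt γ₂ →
    V'.mul ⟨γ₁.proj, Φ γ₁.proj γ₁.snd⟩ ⟨γ₂.proj, Φ γ₂.proj γ₂.snd⟩ =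
      ⟨(V.mul γ₁ γ₂).proj, Φ (V.mul γ₁ γ₂).proj (V.mul γ₁ γ₂).snd⟩
  map_lift : ∀ g e, Φ g (h g e) = h' g e

/-- An isomorphism between representations up to homotopy on `E ⊕ C[1]` and on `E ⊕ C'[1]` which is
the identity on `E`: an isomorphism of vector bundles `φ : C → C'` that carries the components of
one to those of the other. -/
structure IsRuthIso {𝒢 : LieGroupoid IM M IG G} {E C C' : SmoothVectorBundle IM M}
    (D : Ruth 𝒢 E C) (D' : Ruth 𝒢 E C') (φ : ∀ x : M, C.Fiber x ≃ₗ[ℝ] C'.Fiber x) : Prop where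
  smooth : C.IsBundleMap C' id (fun x => (φ x).toLinearMap)
  smooth_symm : C'.IsBundleMap C id (fun x => (φ x).symm.toLinearMap)
  map_ΔC : ∀ g c, φ (𝒢.tgt g) (D.ΔC g c) = D'.ΔC g (φ (𝒢.src g) c)
  map_ΔE : ∀ g e, D.ΔE g e = D'.ΔE g e
  map_bd : ∀ x c, D.bd x c = D'.bd x (φ x c)
  map_Ω : ∀ g₁ g₂ e, 𝒢.src g₁ = 𝒢.tgt g₂ → φ (𝒢.tgt g₁) (D.Ω g₁ g₂ e) = D'.Ω g₁ g₂ e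

/-- A VB-groupoid over `𝒢` with side bundle `E`, equipped with a horizontal lift. -/
structure LiftedVBGroupoid (𝒢 : LieGroupoid IM M IG G) (E : SmoothVectorBundle.{u, v} IM M) where
  Γ : SmoothVectorBundle.{u, v} IG G
  str : GroupoidData E.Tot Γ.Tot
  isVB : IsVBGroupoid 𝒢 E Γ str
  lift : ∀ g : G, E.Fiber (𝒢.src g) →ₗ[ℝ] Γ.Fiber g
  isLift : IsHorizontalLift 𝒢 str lift

/-- A 2-term representation up to homotopy on `E ⊕ C[1]` for some vector bundle `C`. -/
structure TwoTermRep (𝒢 : LieGroupoid IM M IG G) (E : SmoothVectorBundle.{u, v} IM M) where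
  C : SmoothVectorBundle.{u, v} IM M
  ruth : Ruth 𝒢 E C

/-- Two representations up to homotopy are isomorphic by the identity of `E` and some `C ≅ C'`. -/
def TwoTermRep.Iso {𝒢 : LieGroupoid IM M IG G} {E : SmoothVectorBundle.{u, v} IM M}
    (R R' : TwoTermRep 𝒢 E) : Prop :=
  ∃ φ : ∀ x : M, R.C.Fiber x ≃ₗ[ℝ] R'.C.Fiber x, IsRuthIso R.ruth R'.ruth φ

/-- Two VB-groupoids with horizontal lift are isomorphic over the identities of `𝒢` and `E`. -/
def LiftedVBGroupoid.Iso {𝒢 : LieGroupoid IM M IG G} {E : SmoothVectorBundle.{u, v} IM M}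
    (X X' : LiftedVBGroupoid 𝒢 E) : Prop :=
  ∃ Φ : ∀ g : G, X.Γ.Fiber g ≃ₗ[ℝ] X'.Γ.Fiber g,
    IsLiftedIso 𝒢 X.str X.lift X'.str X'.lift Φ

end Main

end

/-! A horizontal lift `h` splits a VB-groupoid `Γ`. For `γ` over `g`, the element `γ - h_g(s̃ γ)`
lies in `ker s̃`, and right multiplication by `0_g` maps the core at `t(g)` bijectively onto `ker
s̃` in the fibre over `g`, with inverse right multiplication by `0_{g⁻¹}`. So `γ = c · 0_g + h_g(e)`
for unique `c` and `e = s̃ γ`, and all that remains of the structure is the target map and the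
multiplication in the coordinates `(c, g, e)`. The target is `∂ c + Δ^E_g e`. By the interchange
law, a product of two such elements is the sum of three products: `(c₁ · 0) · 0`, which is a
translation; `h(∂ c₂) · (c₂ · 0)`, which is `Δ^C` by definition; and `h(Δ^E e₂) · h(e₂)`, which
differs from the lift of the product by `Ω`. This gives the multiplication formula of the split
groupoid (`SplitData.mul_formula`).

For this formula the groupoid axioms match the axioms of a representation up to homotopy.
Compatibility of the target with products uses the first and third structure equations.
Associativity compares the coefficients of `c₃` and `e₃` in the core component, which are the second
and fourth equations. The unit laws correspond to unitality and normalization. The existence of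
inverses then follows. One direction is `Ruth.isLieGroupoid_groupoid`, the other is
`SplitData.toRuth` with `SplitData.assoc_formula`.

An isomorphism that respects `s̃` and the lifts is block diagonal, the identity on the `E` part;
multiplying by units shows that its core block over `g` depends on `t(g)` only
(`Ruth.exists_isRuthIso_of_isLiftedIso`).

Three points are analytic. The interchange law gives only additivity of the multiplication;
homogeneity comes from continuity (`IsVBGroupoid.mul_smul`). Smoothness of `Δ^C` and `Ω` is tested
after the fibrewise injective map `k` (`IsBundleMap.contMDiffWithinAt_of_injective`). The core is a
smooth bundle because it is the image of the smooth projection `id - h ∘ s̃`, of constant rank, on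
the restriction of `Γ` to the units (`IsVBGroupoid.exists_isCore`). -/

section LinearFamilies

variable {EN : Type*} [NormedAddCommGroup EN] [NormedSpace ℝ EN] {HN : Type*} [TopologicalSpace HN]
  {J : ModelWithCorners ℝ EN HN} {N : Type*} [TopologicalSpace N] [ChartedSpace HN N]
  {F F' : Type*} [NormedAddCommGroup F] [NormedSpace ℝ F] [FiniteDimensional ℝ F]
  [NormedAddCommGroup F'] [NormedSpace ℝ F']

/-- A family of linear maps on a finite-dimensional space is smooth if it is pointwise smooth. -/
theorem ContMDiffWithinAt.clm_of_apply {A : N → F →L[ℝ] F'} {s : Set N} {x : N}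
    (h : ∀ w, ContMDiffWithinAt J 𝓘(ℝ, F') ∞ (fun n => A n w) s x) :
    ContMDiffWithinAt J 𝓘(ℝ, F →L[ℝ] F') ∞ A s x := by
  let b := Module.finBasis ℝ F
  -- In a basis, `A n` is the sum of the rank-one maps `w ↦ coord_i(w) • A n (b_i)`, each a fixed
  -- continuous linear function of the column `A n (b_i)`.
  have hsum : A = fun n => ∑ i, (ContinuousLinearMap.smulRightL ℝ F F'
      (LinearMap.toContinuousLinearMap (b.coord i))) (A n (b i)) := by
    funext n
    ext w
    conv_lhs => rw [← b.sum_repr w, map_sum]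
    simp only [map_smul]
    simp
  rw [hsum]
  refine contMDiffWithinAt_finsetSum fun i _ => ?_
  exact (ContinuousLinearMap.contMDiff _).contMDiffAt.comp_contMDiffWithinAt x (h (b i))

end LinearFamilies

/-! ## Smooth maps into total spaces -/

namespace SmoothVectorBundle

open Filter Topology

variable {EB : Type*} [NormedAddCommGroup EB] [NormedSpace ℝ EB] {HB : Type*} [TopologicalSpace HB]
  {IB : ModelWithCorners ℝ EB HB} {B : Type*} [TopologicalSpace B] [ChartedSpace HB B]
  {EB' : Type*} [NormedAddCommGroup EB'] [NormedSpace ℝ EB'] {HB' : Type*} [TopologicalSpace HB']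
  {IB' : ModelWithCorners ℝ EB' HB'} {B' : Type*} [TopologicalSpace B'] [ChartedSpace HB' B']
  {EN : Type*} [NormedAddCommGroup EN] [NormedSpace ℝ EN] {HN : Type*} [TopologicalSpace HN]
  {J : ModelWithCorners ℝ EN HN} {N : Type*} [TopologicalSpace N] [ChartedSpace HN N]

/-- The map of total spaces `f^* E → E`. -/
noncomputable def lift (E : SmoothVectorBundle IB B) (f : C^∞⟮IB', B'; IB, B⟯)
    (p : (E.pullback f).Tot) : E.Tot :=
  ⟨f p.proj, p.snd⟩

/-- The trivializations of a pullback are those of `E` read over the image point, so the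
fibre-coordinate condition is definitionally the same on both sides; only the base component has to
be treated separately. -/
theorem contMDiffWithinAt_pullback_iff (E : SmoothVectorBundle IB B) (φ : C^∞⟮IB', B'; IB, B⟯)
    {f : N → (E.pullback φ).Tot} {s : Set N} {x : N} :
    ContMDiffWithinAt J (E.pullback φ).TotI ∞ f s x ↔
      ContMDiffWithinAt J IB' ∞ (fun n => (f n).proj) s x ∧
      ContMDiffWithinAt J E.TotI ∞ (fun n => E.lift φ (f n)) s x := by
  constructor
  · intro h
    have h' := contMDiffWithinAt_totalSpace.1 h
    exact ⟨h'.1, contMDiffWithinAt_totalSpace.2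
      ⟨φ.contMDiff.contMDiffAt.comp_contMDiffWithinAt x h'.1, h'.2⟩⟩
  · rintro ⟨h1, h2⟩
    exact contMDiffWithinAt_totalSpace.2 ⟨h1, (contMDiffWithinAt_totalSpace.1 h2).2⟩

theorem contMDiff_pullback_iff (E : SmoothVectorBundle IB B) (φ : C^∞⟮IB', B'; IB, B⟯)
    {f : N → (E.pullback φ).Tot} :
    ContMDiff J (E.pullback φ).TotI ∞ f ↔
      ContMDiff J IB' ∞ (fun n => (f n).proj) ∧ ContMDiff J E.TotI ∞ (fun n => E.lift φ (f n)) := by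
  simp only [← contMDiffOn_univ, ContMDiffOn, contMDiffWithinAt_pullback_iff, ← forall_and]

theorem contMDiff_lift (E : SmoothVectorBundle IB B) (φ : C^∞⟮IB', B'; IB, B⟯) :
    ContMDiff (E.pullback φ).TotI E.TotI ∞ (E.lift φ) :=
  ((E.contMDiff_pullback_iff φ).1 contMDiff_id).2

/-- The first projection of a Whitney sum. -/
noncomputable def sumFst [IsManifold IB ∞ B] (E₁ E₂ : SmoothVectorBundle IB B)
    (p : (E₁.sum E₂).Tot) : E₁.Tot :=
  ⟨p.proj, p.snd.1⟩

/-- The second projection of a Whitney sum. -/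
noncomputable def sumSnd [IsManifold IB ∞ B] (E₁ E₂ : SmoothVectorBundle IB B)
    (p : (E₁.sum E₂).Tot) : E₂.Tot :=
  ⟨p.proj, p.snd.2⟩

theorem contMDiffWithinAt_sum_iff [IsManifold IB ∞ B] (E₁ E₂ : SmoothVectorBundle IB B)
    {f : N → (E₁.sum E₂).Tot} {s : Set N} {x : N} :
    ContMDiffWithinAt J (E₁.sum E₂).TotI ∞ f s x ↔
      ContMDiffWithinAt J E₁.TotI ∞ (fun n => sumFst E₁ E₂ (f n)) s x ∧
      ContMDiffWithinAt J E₂.TotI ∞ (fun n => sumSnd E₁ E₂ (f n)) s x := by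
  constructor
  · intro h
    have h' := contMDiffWithinAt_totalSpace.1 h
    exact ⟨contMDiffWithinAt_totalSpace.2 ⟨h'.1,
      (ContinuousLinearMap.fst ℝ E₁.Model E₂.Model).contMDiff.contMDiffAt.comp_contMDiffWithinAt
        x h'.2⟩,
      contMDiffWithinAt_totalSpace.2 ⟨h'.1,
      (ContinuousLinearMap.snd ℝ E₁.Model E₂.Model).contMDiff.contMDiffAt.comp_contMDiffWithinAt
        x h'.2⟩⟩
  · rintro ⟨h1, h2⟩
    have h1' := contMDiffWithinAt_totalSpace.1 h1
    have h2' := contMDiffWithinAt_totalSpace.1 h2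
    exact contMDiffWithinAt_totalSpace.2 ⟨h1'.1, h1'.2.prodMk_space h2'.2⟩

theorem contMDiff_sum_iff [IsManifold IB ∞ B] (E₁ E₂ : SmoothVectorBundle IB B)
    {f : N → (E₁.sum E₂).Tot} :
    ContMDiff J (E₁.sum E₂).TotI ∞ f ↔
      ContMDiff J E₁.TotI ∞ (fun n => sumFst E₁ E₂ (f n)) ∧
      ContMDiff J E₂.TotI ∞ (fun n => sumSnd E₁ E₂ (f n)) := by
  simp only [← contMDiffOn_univ, ContMDiffOn, contMDiffWithinAt_sum_iff, ← forall_and]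

theorem contMDiff_sumFst [IsManifold IB ∞ B] (E₁ E₂ : SmoothVectorBundle IB B) :
    ContMDiff (E₁.sum E₂).TotI E₁.TotI ∞ (sumFst E₁ E₂) :=
  ((contMDiff_sum_iff E₁ E₂).1 contMDiff_id).1

theorem contMDiff_sumSnd [IsManifold IB ∞ B] (E₁ E₂ : SmoothVectorBundle IB B) :
    ContMDiff (E₁.sum E₂).TotI E₂.TotI ∞ (sumSnd E₁ E₂) :=
  ((contMDiff_sum_iff E₁ E₂).1 contMDiff_id).2

variable (E : SmoothVectorBundle IB B)

theorem eventually_mem_baseSet {b : N → B} {s : Set N} {x : N}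
    (hb : ContinuousWithinAt b s x) :
    ∀ᶠ n in 𝓝[s] x, b n ∈ (trivializationAt E.Model E.Fiber (b x)).baseSet :=
  hb ((trivializationAt E.Model E.Fiber (b x)).open_baseSet.mem_nhds
    (mem_baseSet_trivializationAt E.Model E.Fiber (b x)))

/-- A fibrewise linear combination of smooth maps to the total space of a bundle is smooth. -/
theorem _root_.ContMDiffWithinAt.fiber_linearCombination {b : N → B} {v w : ∀ n, E.Fiber (b n)}
    {s : Set N} {x : N} (r t : ℝ)
    (hv : ContMDiffWithinAt J E.TotI ∞ (fun n => (⟨b n, v n⟩ : E.Tot)) s x)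
    (hw : ContMDiffWithinAt J E.TotI ∞ (fun n => (⟨b n, w n⟩ : E.Tot)) s x) :
    ContMDiffWithinAt J E.TotI ∞ (fun n => (⟨b n, r • v n + t • w n⟩ : E.Tot)) s x := by
  have h1 := contMDiffWithinAt_totalSpace.1 hv
  have h2 := contMDiffWithinAt_totalSpace.1 hw
  refine contMDiffWithinAt_totalSpace.2 ⟨h1.1, ?_⟩
  -- Trivializations are linear only over their base set, so the formula in coordinates holds near
  -- `x` rather than everywhere.
  have key : ∀ n, b n ∈ (trivializationAt E.Model E.Fiber (b x)).baseSet →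
      (trivializationAt E.Model E.Fiber (b x) ⟨b n, r • v n + t • w n⟩).2 =
      r • (trivializationAt E.Model E.Fiber (b x) ⟨b n, v n⟩).2 +
        t • (trivializationAt E.Model E.Fiber (b x) ⟨b n, w n⟩).2 := fun n hn => by
    have := (trivializationAt E.Model E.Fiber (b x)).linear ℝ hn
    rw [this.map_add, this.map_smul, this.map_smul]
  have hs : ∀ c : ℝ, ContMDiff 𝓘(ℝ, E.Model) 𝓘(ℝ, E.Model) ∞ (fun y : E.Model => c • y) := fun c =>
    (contDiff_const_smul c).contMDiff
  exact (((hs r).contMDiffAt.comp_contMDiffWithinAt x h1.2).add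
    ((hs t).contMDiffAt.comp_contMDiffWithinAt x h2.2)).congr_of_eventuallyEq
    ((E.eventually_mem_baseSet h1.1.continuousWithinAt).mono key)
    (key x (mem_baseSet_trivializationAt E.Model E.Fiber (b x)))

theorem _root_.ContMDiffWithinAt.fiber_add {b : N → B} {v w : ∀ n, E.Fiber (b n)}
    {s : Set N} {x : N}
    (hv : ContMDiffWithinAt J E.TotI ∞ (fun n => (⟨b n, v n⟩ : E.Tot)) s x)
    (hw : ContMDiffWithinAt J E.TotI ∞ (fun n => (⟨b n, w n⟩ : E.Tot)) s x) :
    ContMDiffWithinAt J E.TotI ∞ (fun n => (⟨b n, v n + w n⟩ : E.Tot)) s x := by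
  simpa using ContMDiffWithinAt.fiber_linearCombination E 1 1 hv hw

theorem _root_.ContMDiffWithinAt.fiber_sub {b : N → B} {v w : ∀ n, E.Fiber (b n)}
    {s : Set N} {x : N}
    (hv : ContMDiffWithinAt J E.TotI ∞ (fun n => (⟨b n, v n⟩ : E.Tot)) s x)
    (hw : ContMDiffWithinAt J E.TotI ∞ (fun n => (⟨b n, w n⟩ : E.Tot)) s x) :
    ContMDiffWithinAt J E.TotI ∞ (fun n => (⟨b n, v n - w n⟩ : E.Tot)) s x := by
  simpa [sub_eq_add_neg] using ContMDiffWithinAt.fiber_linearCombination E 1 (-1) hv hw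

theorem _root_.ContMDiffWithinAt.fiber_neg {b : N → B} {v : ∀ n, E.Fiber (b n)}
    {s : Set N} {x : N}
    (hv : ContMDiffWithinAt J E.TotI ∞ (fun n => (⟨b n, v n⟩ : E.Tot)) s x) :
    ContMDiffWithinAt J E.TotI ∞ (fun n => (⟨b n, -v n⟩ : E.Tot)) s x := by
  simpa using ContMDiffWithinAt.fiber_linearCombination E (-1) 0 hv hv

theorem _root_.ContMDiffWithinAt.fiber_zero {b : N → B} {s : Set N} {x : N}
    (hb : ContMDiffWithinAt J IB ∞ b s x) :
    ContMDiffWithinAt J E.TotI ∞ (fun n => (⟨b n, 0⟩ : E.Tot)) s x :=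
  (contMDiff_zeroSection ℝ E.Fiber).contMDiffAt.comp_contMDiffWithinAt x hb

variable {E} in
theorem IsBundleMap.comp_within {E' : SmoothVectorBundle IB' B'} {f : B → B'}
    {L : ∀ b, E.Fiber b →ₗ[ℝ] E'.Fiber (f b)} (hL : E.IsBundleMap E' f L)
    {b : N → B} {v : ∀ n, E.Fiber (b n)} {s : Set N} {x : N}
    (hv : ContMDiffWithinAt J E.TotI ∞ (fun n => (⟨b n, v n⟩ : E.Tot)) s x) :
    ContMDiffWithinAt J E'.TotI ∞ (fun n => (⟨f (b n), L (b n) (v n)⟩ : E'.Tot)) s x :=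
  (hL.contMDiffAt).comp_contMDiffWithinAt x hv

/-- A morphism of smooth vector bundles, read in local trivializations, is a smooth family of
linear maps. -/
theorem IsBundleMap.exists_local {E : SmoothVectorBundle IB B} {E' : SmoothVectorBundle IB' B'}
    {f : B → B'} {L : ∀ b, E.Fiber b →ₗ[ℝ] E'.Fiber (f b)} (hL : E.IsBundleMap E' f L) (x₀ : B) :
    ∃ A : B → E.Model →L[ℝ] E'.Model, ContMDiffAt IB 𝓘(ℝ, E.Model →L[ℝ] E'.Model) ∞ A x₀ ∧
      ∀ x, x ∈ (trivializationAt E.Model E.Fiber x₀).baseSet →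
        f x ∈ (trivializationAt E'.Model E'.Fiber (f x₀)).baseSet →
        ∀ v : E.Fiber x, A x (trivializationAt E.Model E.Fiber x₀ ⟨x, v⟩).2 =
          (trivializationAt E'.Model E'.Fiber (f x₀) ⟨f x, L x v⟩).2 := by
  set e := trivializationAt E.Model E.Fiber x₀ with he
  set e' := trivializationAt E'.Model E'.Fiber (f x₀) with he'
  have hx₀ : x₀ ∈ e.baseSet := mem_baseSet_trivializationAt E.Model E.Fiber x₀
  have hx₀' : f x₀ ∈ e'.baseSet := mem_baseSet_trivializationAt E'.Model E'.Fiber (f x₀)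
  let A : B → E.Model →L[ℝ] E'.Model := fun x =>
    LinearMap.toContinuousLinearMap ((e'.linearMapAt ℝ (f x)) ∘ₗ L x ∘ₗ (e.symmₗ ℝ x))
  have hA : ∀ x, x ∈ e.baseSet → f x ∈ e'.baseSet → ∀ w,
      A x w = (e' ⟨f x, L x (e.symm x w)⟩).2 := fun x hx hfx w => by
    simp [A, hfx, hx]
  refine ⟨A, ?_, fun x hx hfx v => ?_⟩
  -- Continuity of the base map is not assumed: it is recovered by restricting to the zero section
  -- and projecting.
  · have hfc : Continuous f := by
      have h0 : Continuous (fun b => (⟨b, 0⟩ : E.Tot)) :=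
        (contMDiff_zeroSection ℝ E.Fiber (IB := IB) (n := ∞)).continuous
      exact (FiberBundle.continuous_proj E'.Model E'.Fiber).comp (hL.continuous.comp h0)
    -- Each column of `A` is the coordinate of `L` applied to a section that is constant in the
    -- trivialization.
    have hcol : ∀ w, ContMDiffAt IB 𝓘(ℝ, E'.Model) ∞ (fun x => A x w) x₀ := fun w => by
      have h1 : ContMDiffAt IB E.TotI ∞ (fun x => (⟨x, e.symm x w⟩ : E.Tot)) x₀ := by
        refine (e.contMDiffAt_iff (by simpa [e.mem_source] using hx₀)).2 ⟨contMDiffAt_id, ?_⟩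
        refine (contMDiffAt_const (c := w)).congr_of_eventuallyEq ?_
        filter_upwards [e.open_baseSet.mem_nhds hx₀] with x hx
        rw [e.apply_mk_symm hx]
      have h2 : ContMDiffAt IB E'.TotI ∞ (fun x => (⟨f x, L x (e.symm x w)⟩ : E'.Tot)) x₀ :=
        hL.contMDiffAt.comp x₀ h1
      refine (contMDiffAt_totalSpace.1 h2).2.congr_of_eventuallyEq ?_
      filter_upwards [e.open_baseSet.mem_nhds hx₀,
        hfc.continuousAt.preimage_mem_nhds (e'.open_baseSet.mem_nhds hx₀')] with x hx hfx
      exact hA x hx hfx w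
    exact contMDiffWithinAt_univ.1 (ContMDiffWithinAt.clm_of_apply hcol)
  · rw [hA x hx hfx]
    rw [e.symm_apply_apply_mk hx]

end SmoothVectorBundle

/-! ### Fibrewise injective morphisms, and submersions between total spaces -/

namespace SmoothVectorBundle

open Filter Topology

variable {EB : Type*} [NormedAddCommGroup EB] [NormedSpace ℝ EB] {HB : Type*} [TopologicalSpace HB]
  {IB : ModelWithCorners ℝ EB HB} {B : Type*} [TopologicalSpace B] [ChartedSpace HB B]
  {EB' : Type*} [NormedAddCommGroup EB'] [NormedSpace ℝ EB'] {HB' : Type*} [TopologicalSpace HB']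
  {IB' : ModelWithCorners ℝ EB' HB'} {B' : Type*} [TopologicalSpace B'] [ChartedSpace HB' B']
  {EN : Type*} [NormedAddCommGroup EN] [NormedSpace ℝ EN] {HN : Type*} [TopologicalSpace HN]
  {J : ModelWithCorners ℝ EN HN} {N : Type*} [TopologicalSpace N] [ChartedSpace HN N]

theorem IsBundleMap.contMDiff_base {E : SmoothVectorBundle IB B} {E' : SmoothVectorBundle IB' B'}
    {f : B → B'} {L : ∀ b, E.Fiber b →ₗ[ℝ] E'.Fiber (f b)} (hL : E.IsBundleMap E' f L) :
    ContMDiff IB IB' ∞ f :=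
  (contMDiff_proj E'.Fiber).comp (hL.comp (contMDiff_zeroSection ℝ E.Fiber))

/-- A map into a bundle that becomes smooth after composition with a fibrewise injective morphism of
bundles is smooth, as soon as the underlying map to the base is smooth. -/
theorem IsBundleMap.contMDiffWithinAt_of_injective {E : SmoothVectorBundle IB B}
    {E' : SmoothVectorBundle IB' B'}
    {f : B → B'} {L : ∀ b, E.Fiber b →ₗ[ℝ] E'.Fiber (f b)} (hL : E.IsBundleMap E' f L)
    (hinj : ∀ b, Function.Injective (L b)) {b : N → B} {v : ∀ n, E.Fiber (b n)} {s : Set N} {x : N}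
    (hb : ContMDiffWithinAt J IB ∞ b s x)
    (hv : ContMDiffWithinAt J E'.TotI ∞ (fun n => (⟨f (b n), L (b n) (v n)⟩ : E'.Tot)) s x) :
    ContMDiffWithinAt J E.TotI ∞ (fun n => (⟨b n, v n⟩ : E.Tot)) s x := by
  obtain ⟨A, hA, hAL⟩ := hL.exists_local (b x)
  set e := trivializationAt E.Model E.Fiber (b x) with he
  set e' := trivializationAt E'.Model E'.Fiber (f (b x)) with he'
  have hx₀ : b x ∈ e.baseSet := mem_baseSet_trivializationAt E.Model E.Fiber (b x)
  have hx₀' : f (b x) ∈ e'.baseSet := mem_baseSet_trivializationAt E'.Model E'.Fiber (f (b x))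
  have hAinj : Function.Injective (A (b x)) := by
    rw [injective_iff_map_eq_zero]
    intro w hw
    have h1 := hAL (b x) hx₀ hx₀' (e.symm (b x) w)
    rw [e.apply_mk_symm hx₀] at h1
    rw [hw] at h1
    have h2 : (e'.continuousLinearEquivAt ℝ (f (b x)) hx₀') (L (b x) (e.symm (b x) w)) = 0 :=
      h1.symm
    rw [map_eq_zero_iff _ (ContinuousLinearEquiv.injective _)] at h2
    rw [map_eq_zero_iff _ (hinj _)] at h2
    have h3 : (e.continuousLinearEquivAt ℝ (b x) hx₀).symm w = 0 := h2
    exact (map_eq_zero_iff _ (ContinuousLinearEquiv.injective _)).1 h3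
  -- Fix a left inverse `Q` of `A` at the one point `b x`. Near it `Q ∘ A` stays invertible, since
  -- invertibility is open, and `(Q ∘ A)⁻¹ ∘ Q` recovers the coordinate of `v` smoothly from that of
  -- `L v`.
  obtain ⟨Q', hQ'⟩ := (A (b x)).toLinearMap.exists_leftInverse_of_injective
    (LinearMap.ker_eq_bot.2 hAinj)
  let Q : E'.Model →L[ℝ] E.Model := LinearMap.toContinuousLinearMap Q'
  have hQ : Q ∘L A (b x) = ContinuousLinearMap.id ℝ E.Model := by
    ext w; exact LinearMap.congr_fun hQ' w
  have hQA : ContMDiffWithinAt J 𝓘(ℝ, E.Model →L[ℝ] E.Model) ∞ (fun n => Q ∘L A (b n)) s x :=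
    (contMDiffWithinAt_const (c := Q)).clm_comp (hA.comp_contMDiffWithinAt x hb)
  have hunit : (Q ∘L A (b x)).IsInvertible := by
    rw [hQ]; exact ⟨ContinuousLinearEquiv.refl ℝ _, rfl⟩
  have hinv : ContMDiffWithinAt J 𝓘(ℝ, E.Model →L[ℝ] E.Model) ∞
      (fun n => ContinuousLinearMap.inverse (Q ∘L A (b n))) s x := by
    have : ContDiffAt ℝ ∞ ContinuousLinearMap.inverse (Q ∘L A (b x)) :=
      hunit.contDiffAt_map_inverse
    exact this.contMDiffAt.comp_contMDiffWithinAt x hQA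
  have hz := (contMDiffWithinAt_totalSpace.1 hv).2
  refine contMDiffWithinAt_totalSpace.2 ⟨hb, ?_⟩
  have hy : ContMDiffWithinAt J 𝓘(ℝ, E.Model) ∞ (fun n =>
      ContinuousLinearMap.inverse (Q ∘L A (b n)) (Q (e' ⟨f (b n), L (b n) (v n)⟩).2)) s x :=
    hinv.clm_apply (Q.contMDiff.contMDiffAt.comp_contMDiffWithinAt x hz)
  have key : ∀ n, b n ∈ e.baseSet → f (b n) ∈ e'.baseSet → (Q ∘L A (b n)).IsInvertible →
      (e ⟨b n, v n⟩).2 =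
      ContinuousLinearMap.inverse (Q ∘L A (b n)) (Q (e' ⟨f (b n), L (b n) (v n)⟩).2) := by
    intro n h1 h2 h3
    rw [← hAL (b n) h1 h2]
    have := h3.inverse_comp_self
    exact (DFunLike.congr_fun this (e ⟨b n, v n⟩).2).symm
  refine hy.congr_of_eventuallyEq ?_ (key x hx₀ hx₀' hunit)
  have hopen : IsOpen {T : E.Model →L[ℝ] E.Model | T.IsInvertible} :=
    ContinuousLinearEquiv.isOpen
  filter_upwards [E.eventually_mem_baseSet hb.continuousWithinAt,
    (hL.contMDiff_base.continuous.continuousAt.comp_continuousWithinAt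
      hb.continuousWithinAt) (e'.open_baseSet.mem_nhds hx₀'),
    hQA.continuousWithinAt (hopen.mem_nhds hunit)] with n h1 h2 h3
  exact key n h1 h2 h3

/-- If `f` is a submersion and `F` is a map of total spaces over `f` that has a smooth partial
section in the fibre direction, then `F` is a submersion. -/
theorem surjective_mfderiv_of_local_section {E : SmoothVectorBundle IB B}
    {E' : SmoothVectorBundle IB' B'} {f : B → B'} {F : E.Tot → E'.Tot}
    (hf : ContMDiff IB IB' ∞ f) (hF : ContMDiff E.TotI E'.TotI ∞ F) (γ : E.Tot)
    (hsub : Function.Surjective (mfderiv IB IB' f γ.proj))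
    (ψ : B × E'.Model → E.Tot)
    (hψ : ContMDiffAt (IB.prod 𝓘(ℝ, E'.Model)) E.TotI ∞ ψ
      (γ.proj, (trivializationAt E'.Model E'.Fiber (f γ.proj) (F γ)).2))
    (hψγ : ψ (γ.proj, (trivializationAt E'.Model E'.Fiber (f γ.proj) (F γ)).2) = γ)
    (hFψ : ∀ᶠ p in 𝓝 (γ.proj, (trivializationAt E'.Model E'.Fiber (f γ.proj) (F γ)).2),
      F (ψ p) = (trivializationAt E'.Model E'.Fiber (f γ.proj)).toOpenPartialHomeomorph.symm
        (f p.1, p.2)) :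
    Function.Surjective (mfderiv E.TotI E'.TotI F γ) := by
  set e' := trivializationAt E'.Model E'.Fiber (f γ.proj) with he'
  set p₀ : B × E'.Model := (γ.proj, (e' (F γ)).2) with hp₀
  have hFγ : F γ = e'.toOpenPartialHomeomorph.symm (f γ.proj, (e' (F γ)).2) := by
    rw [← hFψ.self_of_nhds, hψγ]
  have htarget : (f γ.proj, (e' (F γ)).2) ∈ e'.target :=
    e'.mem_target.2 (mem_baseSet_trivializationAt E'.Model E'.Fiber (f γ.proj))
  have hsource : F γ ∈ e'.source := by
    rw [hFγ]; exact e'.toOpenPartialHomeomorph.map_target htarget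
  have heF : e' (F γ) = (f γ.proj, (e' (F γ)).2) := by
    conv_lhs => rw [hFγ]
    exact e'.toOpenPartialHomeomorph.right_inv htarget
  have hne : (∞ : WithTop ℕ∞) ≠ 0 := by simp
  have de' : MDifferentiableAt E'.TotI (IB'.prod 𝓘(ℝ, E'.Model)) e' (F γ) :=
    ((e'.contMDiffOn (IB := IB') (n := ∞)).contMDiffAt
      (e'.open_source.mem_nhds hsource)).mdifferentiableAt hne
  have des : MDifferentiableAt (IB'.prod 𝓘(ℝ, E'.Model)) E'.TotI
      e'.toOpenPartialHomeomorph.symm (e' (F γ)) := by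
    rw [heF]
    exact ((e'.contMDiffOn_symm (IB := IB') (n := ∞)).contMDiffAt
      (e'.open_target.mem_nhds htarget)).mdifferentiableAt hne
  -- The inverse of the chart `e'`, precomposed with `e'`, is the identity near `F γ`; the chain
  -- rule makes its derivative surjective.
  have hs1 : Function.Surjective (mfderiv (IB'.prod 𝓘(ℝ, E'.Model)) E'.TotI
      e'.toOpenPartialHomeomorph.symm (f γ.proj, (e' (F γ)).2)) := by
    have h1 := mfderiv_comp (F γ) des de'
    have h2 : (e'.toOpenPartialHomeomorph.symm ∘ e') =ᶠ[𝓝 (F γ)] id := by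
      filter_upwards [e'.open_source.mem_nhds hsource] with z hz
      exact e'.toOpenPartialHomeomorph.left_inv hz
    rw [h2.mfderiv_eq, mfderiv_id] at h1
    rw [← heF]
    intro y
    exact ⟨_, (DFunLike.congr_fun h1 y).symm⟩
  have dprod : HasMFDerivAt (IB.prod 𝓘(ℝ, E'.Model)) (IB'.prod 𝓘(ℝ, E'.Model))
      (Prod.map f id) p₀
      ((mfderiv IB IB' f γ.proj).prodMap
        (mfderiv 𝓘(ℝ, E'.Model) 𝓘(ℝ, E'.Model) (id : E'.Model → E'.Model) (e' (F γ)).2)) :=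
    HasMFDerivAt.prodMap (p := p₀) ((hf.mdifferentiableAt hne).hasMFDerivAt)
      mdifferentiableAt_id.hasMFDerivAt
  have hs2 : Function.Surjective (mfderiv (IB.prod 𝓘(ℝ, E'.Model)) (IB'.prod 𝓘(ℝ, E'.Model))
      (Prod.map f (id : E'.Model → E'.Model)) p₀) := by
    rw [dprod.mfderiv, mfderiv_id]
    exact Function.Surjective.prodMap hsub Function.surjective_id
  -- Near `p₀` the composite `F ∘ ψ` is the inverse of `e'` after `f × id`, whose derivative is
  -- surjective; hence so is that of `F` at `ψ p₀ = γ`.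
  have hcomp : (F ∘ ψ) =ᶠ[𝓝 p₀]
      (e'.toOpenPartialHomeomorph.symm ∘ Prod.map f (id : E'.Model → E'.Model)) := hFψ
  have h3 := mfderiv_comp p₀ (g := e'.toOpenPartialHomeomorph.symm)
    (f := Prod.map f (id : E'.Model → E'.Model)) (I := IB.prod 𝓘(ℝ, E'.Model))
    (I' := IB'.prod 𝓘(ℝ, E'.Model)) (I'' := E'.TotI) (by rw [heF] at des; exact des)
    dprod.mdifferentiableAt
  have h4 := mfderiv_comp p₀ (g := F) (f := ψ) (I := IB.prod 𝓘(ℝ, E'.Model))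
    (I' := E.TotI) (I'' := E'.TotI) (by rw [hψγ]; exact hF.mdifferentiableAt hne)
    (hψ.mdifferentiableAt hne)
  rw [hcomp.mfderiv_eq, h3] at h4
  have h5 := hs1.comp hs2
  have h6 : Function.Surjective (mfderiv E.TotI E'.TotI F (ψ p₀)) := by
    intro y
    obtain ⟨z, hz⟩ := h5 y
    exact ⟨_, (DFunLike.congr_fun h4 z).symm.trans hz⟩
  rw [hψγ] at h6
  exact h6

end SmoothVectorBundle

/-! ### Transport between fibres over equal base points -/

namespace SmoothVectorBundle

variable {EB : Type*} [NormedAddCommGroup EB] [NormedSpace ℝ EB] {HB : Type*} [TopologicalSpace HB]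
  {IB : ModelWithCorners ℝ EB HB} {B : Type*} [TopologicalSpace B] [ChartedSpace HB B]
  (E : SmoothVectorBundle IB B)

@[simp] theorem tr_rfl {x : B} (h : x = x) (v : E.Fiber x) : E.tr h v = v := rfl

@[simp] theorem tr_tr {x y z : B} (h : x = y) (h' : y = z) (v : E.Fiber x) :
    E.tr h' (E.tr h v) = E.tr (h.trans h') v := by
  subst h h'; rfl

/-- Trades an equality of dependent pairs for an equality of base points and a transported equation
in one fibre; this stands in for heterogeneous equality from here on. -/
theorem mk_eq_mk_iff {x y : B} {v : E.Fiber x} {w : E.Fiber y} :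
    (⟨x, v⟩ : E.Tot) = ⟨y, w⟩ ↔ ∃ h : x = y, w = E.tr h v := by
  constructor
  · intro h
    cases h
    exact ⟨rfl, rfl⟩
  · rintro ⟨h, rfl⟩
    exact (E.mk_tr h v).symm

theorem mk_inj {x : B} {v w : E.Fiber x} : (⟨x, v⟩ : E.Tot) = ⟨x, w⟩ ↔ v = w := by
  rw [mk_eq_mk_iff]
  exact ⟨fun ⟨_, h⟩ => h.symm, fun h => ⟨rfl, h.symm⟩⟩

theorem tr_eq_iff {x y : B} (h : x = y) {v : E.Fiber x} {w : E.Fiber y} :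
    E.tr h v = w ↔ v = E.tr h.symm w := by
  subst h; rfl

end SmoothVectorBundle

namespace LieGroupoid

variable {EM : Type*} [NormedAddCommGroup EM] [NormedSpace ℝ EM] {HM : Type*} [TopologicalSpace HM]
  {IM : ModelWithCorners ℝ EM HM} {M : Type*} [TopologicalSpace M] [ChartedSpace HM M]
  {EG : Type*} [NormedAddCommGroup EG] [NormedSpace ℝ EG] {HG : Type*} [TopologicalSpace HG]
  {IG : ModelWithCorners ℝ EG HG} {G : Type*} [TopologicalSpace G] [ChartedSpace HG G]
  (𝒢 : LieGroupoid IM M IG G)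

theorem mul_assoc {g h k : G} (H : 𝒢.src g = 𝒢.tgt h) (K : 𝒢.src h = 𝒢.tgt k) :
    𝒢.mul (𝒢.mul g h) k = 𝒢.mul g (𝒢.mul h k) := 𝒢.isLie.mul_assoc H K
theorem one_mul (g : G) : 𝒢.mul (𝒢.one (𝒢.tgt g)) g = g := 𝒢.isLie.one_mul g
theorem mul_one (g : G) : 𝒢.mul g (𝒢.one (𝒢.src g)) = g := 𝒢.isLie.mul_one g
theorem inv_mul (g : G) : 𝒢.mul (𝒢.inv g) g = 𝒢.one (𝒢.src g) := 𝒢.isLie.inv_mul g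
theorem mul_inv (g : G) : 𝒢.mul g (𝒢.inv g) = 𝒢.one (𝒢.tgt g) := 𝒢.isLie.mul_inv g

variable [IsManifold IG ∞ G] (C E : SmoothVectorBundle IM M)

theorem elt_eq_elt_iff {g g' : G} {c : C.Fiber (𝒢.tgt g)} {e : E.Fiber (𝒢.src g)}
    {c' : C.Fiber (𝒢.tgt g')} {e' : E.Fiber (𝒢.src g')} :
    𝒢.elt C E g c e = 𝒢.elt C E g' c' e' ↔ ∃ h : g = g',
      c' = C.tr (congrArg 𝒢.tgt h) c ∧ e' = E.tr (congrArg 𝒢.src h) e := by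
  constructor
  · intro h
    obtain ⟨rfl, h2⟩ := ((𝒢.split C E).mk_eq_mk_iff).1 h
    exact ⟨rfl, congrArg Prod.fst h2, congrArg Prod.snd h2⟩
  · rintro ⟨rfl, rfl, rfl⟩
    rfl

end LieGroupoid

/-! ### Groupoid axioms from the structure equations -/

namespace Ruth

variable {EM : Type*} [NormedAddCommGroup EM] [NormedSpace ℝ EM] {HM : Type*} [TopologicalSpace HM]
  {IM : ModelWithCorners ℝ EM HM} {M : Type*} [TopologicalSpace M] [ChartedSpace HM M]
  {EG : Type*} [NormedAddCommGroup EG] [NormedSpace ℝ EG] {HG : Type*} [TopologicalSpace HG]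
  {IG : ModelWithCorners ℝ EG HG} {G : Type*} [TopologicalSpace G] [ChartedSpace HG G]
  {𝒢 : LieGroupoid IM M IG G} {E C : SmoothVectorBundle IM M} (D : Ruth 𝒢 E C)

theorem bd_tr {x y : M} (h : x = y) (c : C.Fiber x) :
    D.bd y (C.tr h c) = E.tr h (D.bd x c) := by
  subst h; rfl

theorem ΔC_comp {g₁ g₂ : G} (H : 𝒢.src g₁ = 𝒢.tgt g₂) (c : C.Fiber (𝒢.src g₂)) :
    D.ΔC g₁ (C.tr H.symm (D.ΔC g₂ c)) =
      C.tr (𝒢.tgt_mul H) (D.ΔC (𝒢.mul g₁ g₂) (C.tr (𝒢.src_mul H).symm c))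
        - D.Ω g₁ g₂ (D.bd (𝒢.src g₂) c) := by
  have := D.eq_two g₁ g₂ H c
  rw [sub_add_eq_add_sub, sub_eq_zero] at this
  rw [← this]; abel

theorem ΔE_comp {g₁ g₂ : G} (H : 𝒢.src g₁ = 𝒢.tgt g₂) (e : E.Fiber (𝒢.src g₂)) :
    D.ΔE g₁ (E.tr H.symm (D.ΔE g₂ e)) =
      E.tr (𝒢.tgt_mul H) (D.ΔE (𝒢.mul g₁ g₂) (E.tr (𝒢.src_mul H).symm e))
        - D.bd (𝒢.tgt g₁) (D.Ω g₁ g₂ e) := by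
  have := D.eq_three g₁ g₂ H e
  rw [sub_add_eq_add_sub, sub_eq_zero] at this
  rw [← this]; abel

theorem ΔE_bd (g : G) (c : C.Fiber (𝒢.src g)) :
    D.ΔE g (D.bd (𝒢.src g) c) = D.bd (𝒢.tgt g) (D.ΔC g c) := sub_eq_zero.1 (D.eq_one g c)

theorem ΔC_Ω {g₁ g₂ g₃ : G} (H : 𝒢.src g₁ = 𝒢.tgt g₂) (K : 𝒢.src g₂ = 𝒢.tgt g₃)
    (e : E.Fiber (𝒢.src g₃)) :
    D.ΔC g₁ (C.tr H.symm (D.Ω g₂ g₃ e)) = C.tr (𝒢.tgt_mul H) (D.Ω (𝒢.mul g₁ g₂) g₃ e)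
      - D.Ω g₁ (𝒢.mul g₂ g₃) (E.tr (𝒢.src_mul K).symm e)
      + D.Ω g₁ g₂ (E.tr K.symm (D.ΔE g₃ e)) := by
  rw [← sub_eq_zero, ← D.eq_four g₁ g₂ g₃ H K e]; abel

/-- Covers products such as `g⁻¹ g`, which equal a unit only propositionally. -/
theorem ΔC_of_eq_one {g : G} {x : M} (h : g = 𝒢.one x) (c : C.Fiber (𝒢.src g)) :
    D.ΔC g c = C.tr (by rw [h]; exact 𝒢.src_one_eq_tgt_one x) c := by
  subst h; exact D.unital_ΔC x c

theorem ΔE_of_eq_one {g : G} {x : M} (h : g = 𝒢.one x) (e : E.Fiber (𝒢.src g)) :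
    D.ΔE g e = E.tr (by rw [h]; exact 𝒢.src_one_eq_tgt_one x) e := by
  subst h; exact D.unital_ΔE x e

/-- For a composable pair this is the normalization axiom; otherwise it is the convention `Ω_off`.
-/
theorem Ω_of_left_eq_one {g₁ g₂ : G} {x : M} (h : g₁ = 𝒢.one x) : D.Ω g₁ g₂ = 0 := by
  by_cases H : 𝒢.src g₁ = 𝒢.tgt g₂
  · have : x = 𝒢.tgt g₂ := by rw [← H, h, 𝒢.src_one]
    subst this h
    exact D.normalized_left g₂
  · exact D.Ω_off _ _ H

theorem Ω_of_right_eq_one {g₁ g₂ : G} {x : M} (h : g₂ = 𝒢.one x) : D.Ω g₁ g₂ = 0 := by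
  by_cases H : 𝒢.src g₁ = 𝒢.tgt g₂
  · have : x = 𝒢.src g₁ := by rw [H, h, 𝒢.tgt_one]
    subst this h
    exact D.normalized_right g₁
  · exact D.Ω_off _ _ H

variable [IsManifold IG ∞ G]

theorem groupoid_src (g : G) (c : C.Fiber (𝒢.tgt g)) (e : E.Fiber (𝒢.src g)) :
    D.groupoid.src (𝒢.elt C E g c e) = ⟨𝒢.src g, e⟩ := rfl

theorem groupoid_tgt (g : G) (c : C.Fiber (𝒢.tgt g)) (e : E.Fiber (𝒢.src g)) :
    D.groupoid.tgt (𝒢.elt C E g c e) = ⟨𝒢.tgt g, D.bd (𝒢.tgt g) c + D.ΔE g e⟩ := rfl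

theorem groupoid_mul {g₁ g₂ : G} (H : 𝒢.src g₁ = 𝒢.tgt g₂) (c₁ : C.Fiber (𝒢.tgt g₁))
    (e₁ : E.Fiber (𝒢.src g₁)) (c₂ : C.Fiber (𝒢.tgt g₂)) (e₂ : E.Fiber (𝒢.src g₂)) :
    D.groupoid.mul (𝒢.elt C E g₁ c₁ e₁) (𝒢.elt C E g₂ c₂ e₂) =
      𝒢.elt C E (𝒢.mul g₁ g₂)
        (C.tr (𝒢.tgt_mul H).symm (c₁ + D.ΔC g₁ (C.tr H.symm c₂) - D.Ω g₁ g₂ e₂))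
        (E.tr (𝒢.src_mul H).symm e₂) := dif_pos H

theorem groupoid_one (x : M) (e : E.Fiber x) :
    D.groupoid.one ⟨x, e⟩ = 𝒢.elt C E (𝒢.one x) 0 (E.tr (𝒢.src_one x).symm e) := rfl

theorem groupoid_inv (g : G) (c : C.Fiber (𝒢.tgt g)) (e : E.Fiber (𝒢.src g)) :
    D.groupoid.inv (𝒢.elt C E g c e) = 𝒢.elt C E (𝒢.inv g)
      (-D.ΔC (𝒢.inv g) (C.tr (𝒢.src_inv g).symm c) + D.Ω (𝒢.inv g) g e)
      (E.tr (𝒢.src_inv g).symm (D.bd (𝒢.tgt g) c + D.ΔE g e)) := rfl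

theorem composable_iff {g₁ g₂ : G} {c₁ : C.Fiber (𝒢.tgt g₁)}
    {e₁ : E.Fiber (𝒢.src g₁)} {c₂ : C.Fiber (𝒢.tgt g₂)} {e₂ : E.Fiber (𝒢.src g₂)} :
    D.groupoid.src (𝒢.elt C E g₁ c₁ e₁) = D.groupoid.tgt (𝒢.elt C E g₂ c₂ e₂) ↔
      ∃ H : 𝒢.src g₁ = 𝒢.tgt g₂, e₁ = E.tr H.symm (D.bd (𝒢.tgt g₂) c₂ + D.ΔE g₂ e₂) := by
  rw [groupoid_src, groupoid_tgt, E.mk_eq_mk_iff]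
  refine exists_congr fun H => ?_
  rw [eq_comm, E.tr_eq_iff]

theorem exists_elt (γ : (𝒢.split C E).Tot) : ∃ g c e, γ = 𝒢.elt C E g c e :=
  ⟨γ.proj, γ.snd.1, γ.snd.2, rfl⟩

/-- Expanding `∂ c₁ + Δ^E_{g₁}(∂ c₂ + Δ^E_{g₂} e₂)`, the first structure equation moves `∂` past `Δ`
in the `c₂` term and the third handles the `e₂` term. -/
theorem groupoid_tgt_mul {γ₁ γ₂ : (𝒢.split C E).Tot}
    (h : D.groupoid.src γ₁ = D.groupoid.tgt γ₂) :
    D.groupoid.tgt (D.groupoid.mul γ₁ γ₂) = D.groupoid.tgt γ₁ := by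
  obtain ⟨g₁, c₁, e₁, rfl⟩ := exists_elt γ₁
  obtain ⟨g₂, c₂, e₂, rfl⟩ := exists_elt γ₂
  obtain ⟨H, rfl⟩ := D.composable_iff.1 h
  rw [D.groupoid_mul H, groupoid_tgt, groupoid_tgt, E.mk_eq_mk_iff]
  refine ⟨𝒢.tgt_mul H, ?_⟩
  have h3 := D.ΔE_bd g₁ (C.tr H.symm c₂)
  rw [D.bd_tr] at h3
  simp only [D.bd_tr, map_add, map_sub, SmoothVectorBundle.tr_tr, SmoothVectorBundle.tr_rfl,
    D.ΔE_comp H, h3]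
  abel

theorem groupoid_src_mul {γ₁ γ₂ : (𝒢.split C E).Tot}
    (h : D.groupoid.src γ₁ = D.groupoid.tgt γ₂) :
    D.groupoid.src (D.groupoid.mul γ₁ γ₂) = D.groupoid.src γ₂ := by
  obtain ⟨g₁, c₁, e₁, rfl⟩ := exists_elt γ₁
  obtain ⟨g₂, c₂, e₂, rfl⟩ := exists_elt γ₂
  obtain ⟨H, rfl⟩ := D.composable_iff.1 h
  rw [D.groupoid_mul H, groupoid_src, groupoid_src, E.mk_tr]

/-- In the core component, with `e₂ = ∂ c₃ + Δ^E_{g₃} e₃` substituted, the terms in `c₁` and `c₂`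
agree on both sides, the terms in `c₃` agree by the second structure equation, and those in `e₃` by
the fourth. -/
theorem groupoid_mul_assoc {γ₁ γ₂ γ₃ : (𝒢.split C E).Tot}
    (h : D.groupoid.src γ₁ = D.groupoid.tgt γ₂) (k : D.groupoid.src γ₂ = D.groupoid.tgt γ₃) :
    D.groupoid.mul (D.groupoid.mul γ₁ γ₂) γ₃ = D.groupoid.mul γ₁ (D.groupoid.mul γ₂ γ₃) := by
  obtain ⟨g₁, c₁, e₁, rfl⟩ := exists_elt γ₁
  obtain ⟨g₂, c₂, e₂, rfl⟩ := exists_elt γ₂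
  obtain ⟨g₃, c₃, e₃, rfl⟩ := exists_elt γ₃
  obtain ⟨K, rfl⟩ := D.composable_iff.1 k
  obtain ⟨H, rfl⟩ := D.composable_iff.1 h
  have H' : 𝒢.src (𝒢.mul g₁ g₂) = 𝒢.tgt g₃ := (𝒢.src_mul H).trans K
  have K' : 𝒢.src g₁ = 𝒢.tgt (𝒢.mul g₂ g₃) := H.trans (𝒢.tgt_mul K).symm
  rw [D.groupoid_mul H, D.groupoid_mul K, D.groupoid_mul H', D.groupoid_mul K',
    𝒢.elt_eq_elt_iff]
  refine ⟨𝒢.mul_assoc H K, ?_, by simp⟩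
  have h1 := D.ΔC_Ω H K e₃
  have h2 := D.ΔC_comp H (C.tr K.symm c₃)
  simp only [map_add, map_sub, SmoothVectorBundle.tr_tr, D.bd_tr] at h1 h2 ⊢
  rw [h1, h2]
  simp only [map_add, map_sub, SmoothVectorBundle.tr_tr]
  abel

theorem groupoid_one_mul (γ : (𝒢.split C E).Tot) :
    D.groupoid.mul (D.groupoid.one (D.groupoid.tgt γ)) γ = γ := by
  obtain ⟨g, c, e, rfl⟩ := exists_elt γ
  rw [groupoid_tgt, groupoid_one, D.groupoid_mul (𝒢.src_one _), 𝒢.elt_eq_elt_iff]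
  refine ⟨𝒢.one_mul g, ?_, by simp⟩
  simp [D.Ω_of_left_eq_one rfl, D.unital_ΔC]

theorem groupoid_mul_one (γ : (𝒢.split C E).Tot) :
    D.groupoid.mul γ (D.groupoid.one (D.groupoid.src γ)) = γ := by
  obtain ⟨g, c, e, rfl⟩ := exists_elt γ
  rw [groupoid_src, groupoid_one, D.groupoid_mul (𝒢.tgt_one _).symm, 𝒢.elt_eq_elt_iff]
  refine ⟨𝒢.mul_one g, ?_, by simp⟩
  simp [D.Ω_of_right_eq_one rfl]

theorem groupoid_src_inv (γ : (𝒢.split C E).Tot) :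
    D.groupoid.src (D.groupoid.inv γ) = D.groupoid.tgt γ := by
  obtain ⟨g, c, e, rfl⟩ := exists_elt γ
  rw [groupoid_inv, groupoid_src, groupoid_tgt, E.mk_tr]

theorem groupoid_tgt_inv (γ : (𝒢.split C E).Tot) :
    D.groupoid.tgt (D.groupoid.inv γ) = D.groupoid.src γ := by
  obtain ⟨g, c, e, rfl⟩ := exists_elt γ
  rw [groupoid_inv, groupoid_src, groupoid_tgt, E.mk_eq_mk_iff]
  refine ⟨𝒢.tgt_inv g, ?_⟩
  have h2 := D.ΔE_comp (𝒢.src_inv g) e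
  have h3 := D.ΔE_bd (𝒢.inv g) (C.tr (𝒢.src_inv g).symm c)
  rw [D.bd_tr] at h3
  rw [D.ΔE_of_eq_one (𝒢.inv_mul g)] at h2
  simp only [map_add, map_neg, map_sub, SmoothVectorBundle.tr_tr, h2, h3]
  simp only [SmoothVectorBundle.tr_rfl]
  abel

theorem groupoid_inv_mul (γ : (𝒢.split C E).Tot) :
    D.groupoid.mul (D.groupoid.inv γ) γ = D.groupoid.one (D.groupoid.src γ) := by
  obtain ⟨g, c, e, rfl⟩ := exists_elt γ
  rw [groupoid_inv, groupoid_src, groupoid_one, D.groupoid_mul (𝒢.src_inv g),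
    𝒢.elt_eq_elt_iff]
  refine ⟨𝒢.inv_mul g, ?_, by simp⟩
  simp

/-- The inverse formula is built so that `γ⁻¹ γ` cancels outright. Here one needs the second
equation for `(g, g⁻¹)`, which gives `Δ^C_g Δ^C_{g⁻¹} = id - Ω_{g,g⁻¹} ∂`, and the fourth for `(g,
g⁻¹, g)`, which by normalization gives `Δ^C_g Ω_{g⁻¹,g} = Ω_{g,g⁻¹} Δ^E_g`. -/
theorem groupoid_mul_inv (γ : (𝒢.split C E).Tot) :
    D.groupoid.mul γ (D.groupoid.inv γ) = D.groupoid.one (D.groupoid.tgt γ) := by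
  obtain ⟨g, c, e, rfl⟩ := exists_elt γ
  rw [groupoid_inv, groupoid_tgt, groupoid_one, D.groupoid_mul (𝒢.tgt_inv g).symm,
    𝒢.elt_eq_elt_iff]
  refine ⟨𝒢.mul_inv g, ?_, by simp⟩
  have h1 := D.ΔC_comp (𝒢.tgt_inv g).symm (C.tr (𝒢.src_inv g).symm c)
  have h2 := D.ΔC_Ω (𝒢.tgt_inv g).symm (𝒢.src_inv g) e
  rw [D.Ω_of_left_eq_one (𝒢.mul_inv g), D.Ω_of_right_eq_one (𝒢.inv_mul g)] at h2
  rw [D.ΔC_of_eq_one (𝒢.mul_inv g)] at h1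
  simp only [map_add, map_neg, map_sub, SmoothVectorBundle.tr_tr, h1, h2, D.bd_tr]
  simp only [LinearMap.zero_apply, map_zero]
  abel

end Ruth

/-! ### Smooth maps into and out of `t^* C ⊕ s^* E` -/

section SplitSmooth

open Filter Topology

variable {EM : Type*} [NormedAddCommGroup EM] [NormedSpace ℝ EM] {HM : Type*} [TopologicalSpace HM]
  {IM : ModelWithCorners ℝ EM HM} {M : Type*} [TopologicalSpace M] [ChartedSpace HM M]
  {EG : Type*} [NormedAddCommGroup EG] [NormedSpace ℝ EG] {HG : Type*} [TopologicalSpace HG]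
  {IG : ModelWithCorners ℝ EG HG} {G : Type*} [TopologicalSpace G] [ChartedSpace HG G]
  [IsManifold IG ∞ G]
  {EN : Type*} [NormedAddCommGroup EN] [NormedSpace ℝ EN] {HN : Type*} [TopologicalSpace HN]
  {J : ModelWithCorners ℝ EN HN} {N : Type*} [TopologicalSpace N] [ChartedSpace HN N]
  (𝒢 : LieGroupoid IM M IG G) {E C : SmoothVectorBundle IM M}

theorem LieGroupoid.contMDiffWithinAt_elt {g : N → G} {c : ∀ n, C.Fiber (𝒢.tgt (g n))}
    {e : ∀ n, E.Fiber (𝒢.src (g n))} {s : Set N} {x : N}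
    (hg : ContMDiffWithinAt J IG ∞ g s x)
    (hc : ContMDiffWithinAt J C.TotI ∞ (fun n => (⟨𝒢.tgt (g n), c n⟩ : C.Tot)) s x)
    (he : ContMDiffWithinAt J E.TotI ∞ (fun n => (⟨𝒢.src (g n), e n⟩ : E.Tot)) s x) :
    ContMDiffWithinAt J (𝒢.split C E).TotI ∞ (fun n => 𝒢.elt C E (g n) (c n) (e n)) s x :=
  ((C.pullback 𝒢.tgt).contMDiffWithinAt_sum_iff (E.pullback 𝒢.src)).2
    ⟨(C.contMDiffWithinAt_pullback_iff 𝒢.tgt).2 ⟨hg, hc⟩,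
      (E.contMDiffWithinAt_pullback_iff 𝒢.src).2 ⟨hg, he⟩⟩

theorem LieGroupoid.contMDiff_split_proj :
    ContMDiff (𝒢.split C E).TotI IG ∞ (fun γ : (𝒢.split C E).Tot => γ.proj) :=
  contMDiff_proj (𝒢.split C E).Fiber

theorem LieGroupoid.contMDiff_coreC :
    ContMDiff (𝒢.split C E).TotI C.TotI ∞
      (fun γ : (𝒢.split C E).Tot => (⟨𝒢.tgt γ.proj, 𝒢.coreC γ⟩ : C.Tot)) :=
  (C.contMDiff_lift 𝒢.tgt).comp
    (SmoothVectorBundle.contMDiff_sumFst (C.pullback 𝒢.tgt) (E.pullback 𝒢.src))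

theorem LieGroupoid.contMDiff_sideE :
    ContMDiff (𝒢.split C E).TotI E.TotI ∞
      (fun γ : (𝒢.split C E).Tot => (⟨𝒢.src γ.proj, 𝒢.sideE γ⟩ : E.Tot)) :=
  (E.contMDiff_lift 𝒢.src).comp
    (SmoothVectorBundle.contMDiff_sumSnd (C.pullback 𝒢.tgt) (E.pullback 𝒢.src))

/-- The base map `𝒢.src` is a submersion, and freezing the `C` coordinate of `γ` while the `E`
coordinate varies gives the section in the fibre direction required by
`surjective_mfderiv_of_local_section`. -/
theorem LieGroupoid.surjective_mfderiv_sideE (γ : (𝒢.split C E).Tot) :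
    Function.Surjective (mfderiv (𝒢.split C E).TotI E.TotI
      (fun γ : (𝒢.split C E).Tot => (⟨𝒢.src γ.proj, 𝒢.sideE γ⟩ : E.Tot)) γ) := by
  let e := trivializationAt (𝒢.split C E).Model (𝒢.split C E).Fiber γ.proj
  let ι : E.Model → (𝒢.split C E).Model := fun v => (((e γ).2.1, v) : C.Model × E.Model)
  have hι : ContMDiff 𝓘(ℝ, E.Model) 𝓘(ℝ, (𝒢.split C E).Model) ∞ ι :=
    ContDiff.contMDiff (𝕜 := ℝ) (E := E.Model) (E' := C.Model × E.Model)
      (contDiff_const.prodMk contDiff_id)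
  have hγ : γ.proj ∈ e.baseSet :=
    mem_baseSet_trivializationAt (𝒢.split C E).Model (𝒢.split C E).Fiber γ.proj
  let e₀ := trivializationAt E.Model E.Fiber (𝒢.src γ.proj)
  let v₀ : E.Model := (e₀ ⟨𝒢.src γ.proj, 𝒢.sideE γ⟩).2
  have hpt : (γ.proj, ι v₀) = e γ := Prod.ext (e.coe_fst' hγ).symm rfl
  refine SmoothVectorBundle.surjective_mfderiv_of_local_section (f := 𝒢.src) 𝒢.src.contMDiff
    𝒢.contMDiff_sideE γ (𝒢.isLie.submersion_src γ.proj)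
    (fun p => e.toOpenPartialHomeomorph.symm (p.1, ι p.2)) ?_ ?_ ?_
  · have h1 : ContMDiffAt (IG.prod 𝓘(ℝ, (𝒢.split C E).Model)) (𝒢.split C E).TotI ∞
        e.toOpenPartialHomeomorph.symm
        ((fun p : G × E.Model => (p.1, ι p.2)) (γ.proj, v₀)) :=
      (e.contMDiffOn_symm (IB := IG) (n := ∞)).contMDiffAt
        (e.open_target.mem_nhds (e.mem_target.2 hγ))
    refine h1.comp (γ.proj, v₀) ?_
    exact ContMDiffAt.prodMk contMDiffAt_fst (hι.contMDiffAt.comp _ contMDiffAt_snd)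
  · change e.toOpenPartialHomeomorph.symm (γ.proj, ι v₀) = γ
    rw [hpt]
    exact e.toOpenPartialHomeomorph.left_inv (e.mem_source.2 hγ)
  · have hb : ∀ᶠ p in 𝓝 (γ.proj, v₀), p.1 ∈ e.baseSet :=
      continuous_fst.continuousAt (e.open_baseSet.mem_nhds hγ)
    refine hb.mono fun p hp => ?_
    have ht : (p.1, ι p.2) ∈ e.target := e.mem_target.2 hp
    have hp' : 𝒢.src p.1 ∈ e₀.baseSet := hp.2
    set q := e.toOpenPartialHomeomorph.symm (p.1, ι p.2) with hq
    have hqp : q.proj = p.1 := e.proj_symm_apply ht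
    have hqe : e q = (p.1, ι p.2) := e.apply_symm_apply ht
    -- The `E` part of the trivialization of the sum bundle at `γ.proj` is, by definition, the
    -- trivialization `e₀` of `E` at the source.
    have hq2 : (e₀ ⟨𝒢.src q.proj, 𝒢.sideE q⟩).2 = p.2 :=
      congrArg (fun z : G × (C.Model × E.Model) => z.2.2) hqe
    have hs : (⟨𝒢.src q.proj, 𝒢.sideE q⟩ : E.Tot) ∈ e₀.source :=
      e₀.mem_source.2 ((congrArg (fun z => 𝒢.src z ∈ e₀.baseSet) hqp).mpr hp')
    have h0 : e₀ ⟨𝒢.src q.proj, 𝒢.sideE q⟩ = (𝒢.src p.1, p.2) :=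
      Prod.ext ((e₀.coe_fst hs).trans (congrArg 𝒢.src hqp)) hq2
    change (⟨𝒢.src q.proj, 𝒢.sideE q⟩ : E.Tot) =
      e₀.toOpenPartialHomeomorph.symm (𝒢.src p.1, p.2)
    rw [← h0]
    exact (e₀.toOpenPartialHomeomorph.left_inv hs).symm

end SplitSmooth

/-! ### The VB-groupoid of a representation up to homotopy -/

namespace Ruth

variable {EM : Type*} [NormedAddCommGroup EM] [NormedSpace ℝ EM] {HM : Type*} [TopologicalSpace HM]
  {IM : ModelWithCorners ℝ EM HM} {M : Type*} [TopologicalSpace M] [ChartedSpace HM M]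
  {EG : Type*} [NormedAddCommGroup EG] [NormedSpace ℝ EG] {HG : Type*} [TopologicalSpace HG]
  {IG : ModelWithCorners ℝ EG HG} {G : Type*} [TopologicalSpace G] [ChartedSpace HG G]
  {EN : Type*} [NormedAddCommGroup EN] [NormedSpace ℝ EN] {HN : Type*} [TopologicalSpace HN]
  {J : ModelWithCorners ℝ EN HN} {N : Type*} [TopologicalSpace N] [ChartedSpace HN N]
  {𝒢 : LieGroupoid IM M IG G} {E C : SmoothVectorBundle IM M} (D : Ruth 𝒢 E C)

theorem contMDiffWithinAt_ΔC {g : N → G} {c : ∀ n, C.Fiber (𝒢.src (g n))} {s : Set N} {x : N}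
    (hg : ContMDiffWithinAt J IG ∞ g s x)
    (hc : ContMDiffWithinAt J C.TotI ∞ (fun n => (⟨𝒢.src (g n), c n⟩ : C.Tot)) s x) :
    ContMDiffWithinAt J C.TotI ∞ (fun n => (⟨𝒢.tgt (g n), D.ΔC (g n) (c n)⟩ : C.Tot)) s x :=
  D.smooth_ΔC.comp_within (b := g) (v := c)
    ((C.contMDiffWithinAt_pullback_iff 𝒢.src).2 ⟨hg, hc⟩)

theorem contMDiffWithinAt_ΔE {g : N → G} {e : ∀ n, E.Fiber (𝒢.src (g n))} {s : Set N} {x : N}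
    (hg : ContMDiffWithinAt J IG ∞ g s x)
    (he : ContMDiffWithinAt J E.TotI ∞ (fun n => (⟨𝒢.src (g n), e n⟩ : E.Tot)) s x) :
    ContMDiffWithinAt J E.TotI ∞ (fun n => (⟨𝒢.tgt (g n), D.ΔE (g n) (e n)⟩ : E.Tot)) s x :=
  D.smooth_ΔE.comp_within (b := g) (v := e)
    ((E.contMDiffWithinAt_pullback_iff 𝒢.src).2 ⟨hg, he⟩)

theorem contMDiffWithinAt_Ω {g₁ g₂ : N → G} {e : ∀ n, E.Fiber (𝒢.src (g₂ n))} {s : Set N} {x : N}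
    (hx : x ∈ s) (hs : ∀ n ∈ s, 𝒢.src (g₁ n) = 𝒢.tgt (g₂ n))
    (hg₁ : ContMDiffWithinAt J IG ∞ g₁ s x) (hg₂ : ContMDiffWithinAt J IG ∞ g₂ s x)
    (he : ContMDiffWithinAt J E.TotI ∞ (fun n => (⟨𝒢.src (g₂ n), e n⟩ : E.Tot)) s x) :
    ContMDiffWithinAt J C.TotI ∞
      (fun n => (⟨𝒢.tgt (g₁ n), D.Ω (g₁ n) (g₂ n) (e n)⟩ : C.Tot)) s x := by
  have h1 : ContMDiffWithinAt J (IG.prod (E.pullback 𝒢.src).TotI) ∞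
      (fun n => ((g₁ n, ⟨g₂ n, e n⟩) : G × (E.pullback 𝒢.src).Tot)) s x :=
    hg₁.prodMk ((E.contMDiffWithinAt_pullback_iff 𝒢.src).2 ⟨hg₂, he⟩)
  exact (D.smooth_Ω (g₁ x, ⟨g₂ x, e x⟩) (hs x hx)).comp x h1 (fun n hn => hs n hn)

variable [IsManifold IG ∞ G]

theorem contMDiff_groupoid_tgt :
    ContMDiff (𝒢.split C E).TotI E.TotI ∞ D.groupoid.tgt := by
  intro γ
  rw [← contMDiffWithinAt_univ]
  exact ContMDiffWithinAt.fiber_add E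
    (D.smooth_bd.comp_within 𝒢.contMDiff_coreC.contMDiffAt.contMDiffWithinAt)
    (D.contMDiffWithinAt_ΔE 𝒢.contMDiff_split_proj.contMDiffAt.contMDiffWithinAt
      𝒢.contMDiff_sideE.contMDiffAt.contMDiffWithinAt)

theorem contMDiff_groupoid_one : ContMDiff E.TotI (𝒢.split C E).TotI ∞ D.groupoid.one := by
  intro γ
  have hone : ContMDiffAt E.TotI IG ∞ (fun e : E.Tot => 𝒢.one e.proj) γ :=
    (𝒢.isLie.contMDiff_one.comp (contMDiff_proj E.Fiber)).contMDiffAt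
  refine 𝒢.contMDiffWithinAt_elt (C := C) (E := E) (g := fun e : E.Tot => 𝒢.one e.proj)
    (c := fun _ => 0) (e := fun e => E.tr (𝒢.src_one e.proj).symm e.snd) hone ?_ ?_
  · exact ContMDiffWithinAt.fiber_zero C (𝒢.tgt.contMDiff.contMDiffAt.comp γ hone)
  · simp only [E.mk_tr]
    exact contMDiffAt_id

theorem contMDiff_groupoid_inv :
    ContMDiff (𝒢.split C E).TotI (𝒢.split C E).TotI ∞ D.groupoid.inv := by
  intro γ
  rw [← contMDiffWithinAt_univ]
  have hp : ContMDiffWithinAt (𝒢.split C E).TotI IG ∞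
      (fun γ : (𝒢.split C E).Tot => γ.proj) Set.univ γ :=
    𝒢.contMDiff_split_proj.contMDiffAt.contMDiffWithinAt
  have hinv : ContMDiffWithinAt (𝒢.split C E).TotI IG ∞
      (fun γ : (𝒢.split C E).Tot => 𝒢.inv γ.proj) Set.univ γ :=
    𝒢.isLie.contMDiff_inv.contMDiffAt.comp_contMDiffWithinAt γ hp
  refine 𝒢.contMDiffWithinAt_elt (C := C) (E := E)
    (g := fun γ : (𝒢.split C E).Tot => 𝒢.inv γ.proj)
    (c := fun γ => -D.ΔC (𝒢.inv γ.proj) (C.tr (𝒢.src_inv γ.proj).symm (𝒢.coreC γ))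
        + D.Ω (𝒢.inv γ.proj) γ.proj (𝒢.sideE γ))
    (e := fun γ => E.tr (𝒢.src_inv γ.proj).symm
        (D.bd (𝒢.tgt γ.proj) (𝒢.coreC γ) + D.ΔE γ.proj (𝒢.sideE γ))) hinv ?_ ?_
  · refine ContMDiffWithinAt.fiber_add C (ContMDiffWithinAt.fiber_neg C ?_) ?_
    · refine D.contMDiffWithinAt_ΔC hinv ?_
      simp only [C.mk_tr]
      exact 𝒢.contMDiff_coreC.contMDiffAt.contMDiffWithinAt
    · exact D.contMDiffWithinAt_Ω (Set.mem_univ _) (fun n _ => 𝒢.src_inv n.proj) hinv hp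
        𝒢.contMDiff_sideE.contMDiffAt.contMDiffWithinAt
  · simp only [E.mk_tr]
    exact D.contMDiff_groupoid_tgt.contMDiffAt.contMDiffWithinAt

theorem contMDiffOn_groupoid_mul :
    ContMDiffOn ((𝒢.split C E).TotI.prod (𝒢.split C E).TotI) (𝒢.split C E).TotI ∞
      (fun p : (𝒢.split C E).Tot × (𝒢.split C E).Tot => D.groupoid.mul p.1 p.2)
      {p | D.groupoid.src p.1 = D.groupoid.tgt p.2} := by
  classical
  intro p hp
  set s := {p : (𝒢.split C E).Tot × (𝒢.split C E).Tot |
    D.groupoid.src p.1 = D.groupoid.tgt p.2} with hsdef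
  have hs : ∀ p ∈ s, 𝒢.src p.1.proj = 𝒢.tgt p.2.proj := fun p hp =>
    congrArg (fun z : E.Tot => z.proj) hp
  have h1 : ContMDiffWithinAt ((𝒢.split C E).TotI.prod (𝒢.split C E).TotI) (𝒢.split C E).TotI ∞
    (fun p : (𝒢.split C E).Tot × (𝒢.split C E).Tot => p.1) s p := contMDiffWithinAt_fst
  have h2 : ContMDiffWithinAt ((𝒢.split C E).TotI.prod (𝒢.split C E).TotI) (𝒢.split C E).TotI ∞
    (fun p : (𝒢.split C E).Tot × (𝒢.split C E).Tot => p.2) s p := contMDiffWithinAt_snd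
  have g1 := (𝒢.contMDiff_split_proj (C := C) (E := E)).contMDiffAt.comp_contMDiffWithinAt p h1
  have g2 := (𝒢.contMDiff_split_proj (C := C) (E := E)).contMDiffAt.comp_contMDiffWithinAt p h2
  have c1 := (𝒢.contMDiff_coreC (C := C) (E := E)).contMDiffAt.comp_contMDiffWithinAt p h1
  have c2 := (𝒢.contMDiff_coreC (C := C) (E := E)).contMDiffAt.comp_contMDiffWithinAt p h2
  have e2 := (𝒢.contMDiff_sideE (C := C) (E := E)).contMDiffAt.comp_contMDiffWithinAt p h2
  have gm : ContMDiffWithinAt ((𝒢.split C E).TotI.prod (𝒢.split C E).TotI) IG ∞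
      (fun p : (𝒢.split C E).Tot × (𝒢.split C E).Tot => 𝒢.mul p.1.proj p.2.proj) s p :=
    (𝒢.isLie.contMDiffOn_mul (p.1.proj, p.2.proj) (hs p hp)).comp p
      (g1.prodMk g2) (fun p hp => hs p hp)
  -- Transport to the fibre over the source of the first factor needs a proof of composability,
  -- available only on `s`. The sections are therefore extended by zero off `s`, and smoothness
  -- within `s` does not see the extension.
  let c : ∀ p : (𝒢.split C E).Tot × (𝒢.split C E).Tot, C.Fiber (𝒢.src p.1.proj) := fun p =>
    if H : 𝒢.src p.1.proj = 𝒢.tgt p.2.proj then C.tr H.symm (𝒢.coreC p.2) else 0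
  have hc : ∀ p ∈ s, (⟨𝒢.src p.1.proj, c p⟩ : C.Tot) = ⟨𝒢.tgt p.2.proj, 𝒢.coreC p.2⟩ := by
    intro p hp
    simp only [c, dif_pos (hs p hp), C.mk_tr]
  have hsm : ContMDiffWithinAt ((𝒢.split C E).TotI.prod (𝒢.split C E).TotI) C.TotI ∞
      (fun p : (𝒢.split C E).Tot × (𝒢.split C E).Tot => (⟨𝒢.tgt p.1.proj,
        𝒢.coreC p.1 + D.ΔC p.1.proj (c p) - D.Ω p.1.proj p.2.proj (𝒢.sideE p.2)⟩ : C.Tot)) s p := by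
    refine ContMDiffWithinAt.fiber_sub C (ContMDiffWithinAt.fiber_add C c1 ?_) ?_
    · exact D.contMDiffWithinAt_ΔC g1 (c2.congr hc (hc p hp))
    · exact D.contMDiffWithinAt_Ω hp hs g1 g2 e2
  let c' : ∀ p : (𝒢.split C E).Tot × (𝒢.split C E).Tot,
      C.Fiber (𝒢.tgt (𝒢.mul p.1.proj p.2.proj)) := fun p =>
    if H : 𝒢.src p.1.proj = 𝒢.tgt p.2.proj then C.tr (𝒢.tgt_mul H).symm
      (𝒢.coreC p.1 + D.ΔC p.1.proj (C.tr H.symm (𝒢.coreC p.2))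
        - D.Ω p.1.proj p.2.proj (𝒢.sideE p.2)) else 0
  let e' : ∀ p : (𝒢.split C E).Tot × (𝒢.split C E).Tot,
      E.Fiber (𝒢.src (𝒢.mul p.1.proj p.2.proj)) := fun p =>
    if H : 𝒢.src p.1.proj = 𝒢.tgt p.2.proj then E.tr (𝒢.src_mul H).symm (𝒢.sideE p.2) else 0
  have hc' : ∀ p ∈ s, (⟨𝒢.tgt (𝒢.mul p.1.proj p.2.proj), c' p⟩ : C.Tot) = ⟨𝒢.tgt p.1.proj,
      𝒢.coreC p.1 + D.ΔC p.1.proj (c p) - D.Ω p.1.proj p.2.proj (𝒢.sideE p.2)⟩ := by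
    intro p hp
    simp only [c, c', dif_pos (hs p hp), C.mk_tr]
  have he' : ∀ p ∈ s, (⟨𝒢.src (𝒢.mul p.1.proj p.2.proj), e' p⟩ : E.Tot) =
      ⟨𝒢.src p.2.proj, 𝒢.sideE p.2⟩ := by
    intro p hp
    simp only [e', dif_pos (hs p hp), E.mk_tr]
  have key : ∀ p ∈ s, D.groupoid.mul p.1 p.2 =
      𝒢.elt C E (𝒢.mul p.1.proj p.2.proj) (c' p) (e' p) := by
    intro p hp
    simp only [groupoid, c', e', dif_pos (hs p hp)]
  exact (𝒢.contMDiffWithinAt_elt gm (hsm.congr hc' (hc' p hp)) (e2.congr he' (he' p hp))).congr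
    key (key p hp)

theorem isLieGroupoid_groupoid :
    IsLieGroupoid E.TotI (𝒢.split C E).TotI D.groupoid where
  src_one x := E.mk_tr (𝒢.src_one x.proj).symm x.snd
  tgt_one x := by
    obtain ⟨x, e⟩ := x
    rw [groupoid_one, groupoid_tgt, E.mk_eq_mk_iff]
    refine ⟨𝒢.tgt_one x, ?_⟩
    simp [D.unital_ΔE]
  src_mul := D.groupoid_src_mul
  tgt_mul := D.groupoid_tgt_mul
  mul_assoc := D.groupoid_mul_assoc
  one_mul := D.groupoid_one_mul
  mul_one := D.groupoid_mul_one
  src_inv := D.groupoid_src_inv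
  tgt_inv := D.groupoid_tgt_inv
  inv_mul := D.groupoid_inv_mul
  mul_inv := D.groupoid_mul_inv
  contMDiff_src := 𝒢.contMDiff_sideE
  contMDiff_tgt := D.contMDiff_groupoid_tgt
  contMDiff_one := D.contMDiff_groupoid_one
  contMDiff_inv := D.contMDiff_groupoid_inv
  contMDiffOn_mul := D.contMDiffOn_groupoid_mul
  submersion_src γ := 𝒢.surjective_mfderiv_sideE γ

theorem isVBGroupoid_groupoid :
    IsVBGroupoid 𝒢 E (𝒢.split C E) D.groupoid where
  isLie := D.isLieGroupoid_groupoid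
  src_bundleMap := ⟨fun g => LinearMap.snd ℝ (C.Fiber (𝒢.tgt g)) (E.Fiber (𝒢.src g)),
    𝒢.contMDiff_sideE, fun _ _ => rfl⟩
  tgt_bundleMap := ⟨fun g => (D.bd (𝒢.tgt g)).coprod (D.ΔE g),
    D.contMDiff_groupoid_tgt, fun _ _ => rfl⟩
  proj_mul γ₁ γ₂ h := by
    obtain ⟨g₁, c₁, e₁, rfl⟩ := exists_elt γ₁
    obtain ⟨g₂, c₂, e₂, rfl⟩ := exists_elt γ₂
    obtain ⟨H, rfl⟩ := D.composable_iff.1 h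
    rw [D.groupoid_mul H]
    rfl
  interchange := by
    rintro g₁ g₂ ⟨c₁, e₁⟩ ⟨c₃, e₃⟩ ⟨c₂, e₂⟩ ⟨c₄, e₄⟩ u w h₁₂ h₃₄ hu hw
    obtain ⟨H, -⟩ := D.composable_iff.1 h₁₂
    have hu' := (((𝒢.split C E).mk_inj).1 ((D.groupoid_mul H c₁ e₁ c₂ e₂).symm.trans hu)).symm
    have hw' := (((𝒢.split C E).mk_inj).1 ((D.groupoid_mul H c₃ e₃ c₄ e₄).symm.trans hw)).symm
    -- The interchange law is the additivity of the core component in `(c₁, c₂, e₂)` jointly.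
    have key : ∀ (c₁ c₃ : C.Fiber (𝒢.tgt g₁)) (c₂ c₄ : C.Fiber (𝒢.tgt g₂))
        (e₂ e₄ : E.Fiber (𝒢.src g₂)),
        C.tr (𝒢.tgt_mul H).symm
          (c₁ + c₃ + D.ΔC g₁ (C.tr H.symm (c₂ + c₄)) - D.Ω g₁ g₂ (e₂ + e₄)) =
        C.tr (𝒢.tgt_mul H).symm (c₁ + D.ΔC g₁ (C.tr H.symm c₂) - D.Ω g₁ g₂ e₂) +
        C.tr (𝒢.tgt_mul H).symm (c₃ + D.ΔC g₁ (C.tr H.symm c₄) - D.Ω g₁ g₂ e₄) := by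
      intros
      simp only [map_add, map_sub]
      abel
    refine (D.groupoid_mul H (c₁ + c₃) (e₁ + e₃) (c₂ + c₄) (e₂ + e₄)).trans ?_
    rw [hu', hw']
    refine congrArg (TotalSpace.mk (𝒢.mul g₁ g₂)) (Prod.ext ?_ ?_)
    · exact key c₁ c₃ c₂ c₄ e₂ e₄
    · exact map_add (E.tr _) _ _

theorem isHorizontalLift_splitLift : IsHorizontalLift 𝒢 D.groupoid (𝒢.splitLift C E) where
  smooth := by
    intro p
    have hp : ContMDiffAt (E.pullback 𝒢.src).TotI IG ∞
        (fun p : (E.pullback 𝒢.src).Tot => p.proj) p :=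
      (contMDiff_proj (E.pullback 𝒢.src).Fiber).contMDiffAt
    exact 𝒢.contMDiffWithinAt_elt (C := C) (E := E) (g := fun p : (E.pullback 𝒢.src).Tot => p.proj)
      (c := fun _ => 0) (e := fun p => p.snd) hp
      (ContMDiffWithinAt.fiber_zero C (𝒢.tgt.contMDiff.contMDiffAt.comp p hp))
      (E.contMDiff_lift 𝒢.src).contMDiffAt
  src_lift _ _ := rfl
  lift_one x e := by
    rw [groupoid_one]
    refine (𝒢.elt_eq_elt_iff C E (c := 0) (e := e)).2 ⟨?_, ?_, ?_⟩
    · rw [𝒢.src_one]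
    · simp
    · simp

theorem isCore_splitCore : IsCore 𝒢 D.groupoid C (𝒢.splitCore C E) where
  smooth := by
    intro p
    have hp : ContMDiffAt C.TotI IG ∞ (fun p : C.Tot => 𝒢.one p.proj) p :=
      (𝒢.isLie.contMDiff_one.comp (contMDiff_proj C.Fiber)).contMDiffAt
    refine 𝒢.contMDiffWithinAt_elt (C := C) (E := E) (g := fun p : C.Tot => 𝒢.one p.proj)
      (c := fun p => C.tr (𝒢.tgt_one p.proj).symm p.snd) (e := fun _ => 0) hp ?_
      (ContMDiffWithinAt.fiber_zero E (𝒢.src.contMDiff.contMDiffAt.comp p hp))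
    simp only [C.mk_tr]
    exact contMDiffAt_id
  injective x c c' h := (C.tr (𝒢.tgt_one x).symm).injective (congrArg Prod.fst h)
  range_eq x v := by
    obtain ⟨c, e⟩ := v
    refine Iff.trans ?_ (E.mk_eq_mk_iff (v := e)).symm
    constructor
    · rintro ⟨c', h⟩
      refine ⟨𝒢.src_one x, ?_⟩
      have : (0 : E.Fiber (𝒢.src (𝒢.one x))) = e := congrArg Prod.snd h
      rw [← this, map_zero]
    · rintro ⟨h, h'⟩
      refine ⟨C.tr (𝒢.tgt_one x) c, ?_⟩
      have he : e = 0 := (map_eq_zero_iff _ (E.tr h).injective).1 h'.symm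
      subst he
      exact Prod.ext (C.tr_tr _ _ c) rfl

theorem isComponents_groupoid :
    IsComponents 𝒢 D.groupoid (𝒢.splitLift C E) (𝒢.splitCore C E) D where
  bd_eq x c := by
    refine Eq.trans ?_ (D.groupoid_tgt (𝒢.one x) (C.tr (𝒢.tgt_one x).symm c) 0).symm
    rw [E.mk_eq_mk_iff]
    exact ⟨(𝒢.tgt_one x).symm, by simp [D.bd_tr]⟩
  ΔE_eq g e := by
    refine Eq.trans ?_ (D.groupoid_tgt g 0 e).symm
    simp
  ΔC_eq g c := by
    have h1 : 𝒢.src g = 𝒢.tgt (𝒢.one (𝒢.src g)) := (𝒢.tgt_one _).symm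
    have h2 : 𝒢.src (𝒢.mul g (𝒢.one (𝒢.src g))) = 𝒢.tgt (𝒢.inv g) := by
      rw [𝒢.mul_one, 𝒢.tgt_inv]
    refine Eq.trans ?_ (congrArg (fun z => D.groupoid.mul z (𝒢.elt C E (𝒢.inv g) 0 0))
      (D.groupoid_mul h1 0 (D.bd (𝒢.src g) c) (C.tr h1 c) 0)).symm
    rw [D.groupoid_mul h2]
    refine (𝒢.elt_eq_elt_iff C E (c := C.tr (𝒢.tgt_one (𝒢.tgt g)).symm (D.ΔC g c))
      (e := 0)).2 ⟨?_, ?_, ?_⟩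
    · rw [𝒢.mul_one, 𝒢.mul_inv]
    · simp
    · simp
  Ω_eq g₁ g₂ H e w hw := by
    have hw' := ((𝒢.split C E).mk_inj).1 ((D.groupoid_mul H 0 _ 0 e).symm.trans hw)
    have h2 : 𝒢.src (𝒢.mul g₁ g₂) = 𝒢.tgt (𝒢.inv (𝒢.mul g₁ g₂)) := (𝒢.tgt_inv _).symm
    -- The product of the two lifts has core component `-Ω e` and the same side component as the
    -- lift of `g₁ g₂`, so the difference is `(Ω e, g₁ g₂, 0)`. Multiplying by a zero on the right
    -- then only changes the base arrow.
    have h3 : (𝒢.splitLift C E (𝒢.mul g₁ g₂) (E.tr (𝒢.src_mul H).symm e) - w) =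
        ((C.tr (𝒢.tgt_mul H).symm (D.Ω g₁ g₂ e), 0) : (𝒢.split C E).Fiber (𝒢.mul g₁ g₂)) := by
      rw [← hw']
      refine Prod.ext ?_ (sub_self _)
      have : ∀ a : C.Fiber (𝒢.tgt g₁), (0 : C.Fiber (𝒢.tgt (𝒢.mul g₁ g₂))) -
          C.tr (𝒢.tgt_mul H).symm (0 + D.ΔC g₁ (C.tr H.symm 0) - a) =
          C.tr (𝒢.tgt_mul H).symm a := by simp
      exact this _
    rw [h3]
    refine Eq.trans ?_ (D.groupoid_mul h2 (C.tr (𝒢.tgt_mul H).symm (D.Ω g₁ g₂ e)) 0 0 0).symm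
    refine (𝒢.elt_eq_elt_iff C E (c := C.tr (𝒢.tgt_one (𝒢.tgt g₁)).symm (D.Ω g₁ g₂ e))
      (e := 0)).2 ⟨?_, ?_, ?_⟩
    · rw [𝒢.mul_inv, 𝒢.tgt_mul H]
    · simp
    · simp

end Ruth

/-! ### Linearity of the multiplication of a VB-groupoid -/

section VBGroupoid

variable {EM : Type*} [NormedAddCommGroup EM] [NormedSpace ℝ EM] {HM : Type*} [TopologicalSpace HM]
  {IM : ModelWithCorners ℝ EM HM} {M : Type*} [TopologicalSpace M] [ChartedSpace HM M]
  {EG : Type*} [NormedAddCommGroup EG] [NormedSpace ℝ EG] {HG : Type*} [TopologicalSpace HG]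
  {IG : ModelWithCorners ℝ EG HG} {G : Type*} [TopologicalSpace G] [ChartedSpace HG G]
  {𝒢 : LieGroupoid IM M IG G} {E C : SmoothVectorBundle IM M} {Γ : SmoothVectorBundle IG G}
  {V : GroupoidData E.Tot Γ.Tot}

namespace IsVBGroupoid

/-- The source map of a VB-groupoid on the fibre over `g`. -/
noncomputable def srcL (hV : IsVBGroupoid 𝒢 E Γ V) : ∀ g, Γ.Fiber g →ₗ[ℝ] E.Fiber (𝒢.src g) :=
  hV.src_bundleMap.choose

/-- The target map of a VB-groupoid on the fibre over `g`. -/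
noncomputable def tgtL (hV : IsVBGroupoid 𝒢 E Γ V) : ∀ g, Γ.Fiber g →ₗ[ℝ] E.Fiber (𝒢.tgt g) :=
  hV.tgt_bundleMap.choose

variable (hV : IsVBGroupoid 𝒢 E Γ V)
include hV

theorem src_mk (g : G) (v : Γ.Fiber g) : V.src ⟨g, v⟩ = ⟨𝒢.src g, hV.srcL g v⟩ :=
  hV.src_bundleMap.choose_spec.2 g v

theorem tgt_mk (g : G) (v : Γ.Fiber g) : V.tgt ⟨g, v⟩ = ⟨𝒢.tgt g, hV.tgtL g v⟩ :=
  hV.tgt_bundleMap.choose_spec.2 g v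

theorem src_zero (g : G) : V.src ⟨g, 0⟩ = ⟨𝒢.src g, 0⟩ := by rw [hV.src_mk, map_zero]

theorem tgt_zero (g : G) : V.tgt ⟨g, 0⟩ = ⟨𝒢.tgt g, 0⟩ := by rw [hV.tgt_mk, map_zero]

theorem composable_add {g₁ g₂ : G} {v₁ v₁' : Γ.Fiber g₁} {v₂ v₂' : Γ.Fiber g₂}
    (h : V.src ⟨g₁, v₁⟩ = V.tgt ⟨g₂, v₂⟩) (h' : V.src ⟨g₁, v₁'⟩ = V.tgt ⟨g₂, v₂'⟩) :
    V.src ⟨g₁, v₁ + v₁'⟩ = V.tgt ⟨g₂, v₂ + v₂'⟩ := by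
  rw [hV.src_mk, hV.tgt_mk, E.mk_eq_mk_iff] at h h' ⊢
  obtain ⟨H, h⟩ := h
  obtain ⟨_, h'⟩ := h'
  exact ⟨H, by simp only [map_add, h, h']⟩

theorem composable_smul (r : ℝ) {g₁ g₂ : G} {v₁ : Γ.Fiber g₁} {v₂ : Γ.Fiber g₂}
    (h : V.src ⟨g₁, v₁⟩ = V.tgt ⟨g₂, v₂⟩) :
    V.src ⟨g₁, r • v₁⟩ = V.tgt ⟨g₂, r • v₂⟩ := by
  rw [hV.src_mk, hV.tgt_mk, E.mk_eq_mk_iff] at h ⊢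
  obtain ⟨H, h⟩ := h
  exact ⟨H, by simp only [map_smul, h]⟩

theorem composable_zero {g₁ g₂ : G} (H : 𝒢.src g₁ = 𝒢.tgt g₂) :
    V.src ⟨g₁, 0⟩ = V.tgt ⟨g₂, 0⟩ := by
  rw [hV.src_zero, hV.tgt_zero, E.mk_eq_mk_iff]
  exact ⟨H, by simp⟩

theorem exists_mul {g₁ g₂ : G} {v₁ : Γ.Fiber g₁} {v₂ : Γ.Fiber g₂}
    (h : V.src ⟨g₁, v₁⟩ = V.tgt ⟨g₂, v₂⟩) :
    ∃ w, V.mul ⟨g₁, v₁⟩ ⟨g₂, v₂⟩ = ⟨𝒢.mul g₁ g₂, w⟩ := by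
  have hp := hV.proj_mul ⟨g₁, v₁⟩ ⟨g₂, v₂⟩ h
  refine ⟨Γ.tr hp (V.mul ⟨g₁, v₁⟩ ⟨g₂, v₂⟩).snd, ?_⟩
  rw [Γ.mk_tr hp]

/-- Interchange applied to `0 + 0` shows that the product `w` satisfies `w = w + w`. -/
theorem mul_zero_zero {g₁ g₂ : G} (H : 𝒢.src g₁ = 𝒢.tgt g₂) :
    V.mul ⟨g₁, 0⟩ ⟨g₂, 0⟩ = ⟨𝒢.mul g₁ g₂, 0⟩ := by
  have h := hV.composable_zero H
  obtain ⟨w, hw⟩ := hV.exists_mul h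
  have h2 := hV.interchange g₁ g₂ 0 0 0 0 w w h h hw hw
  rw [add_zero, add_zero, hw, Γ.mk_inj] at h2
  rw [hw, left_eq_add.1 h2]

/-- The interchange law yields only that `t ↦ (t v₁)(t v₂)` is additive. It is also continuous,
because the multiplication is, and a continuous additive map from `ℝ` is real linear. -/
theorem mul_smul (r : ℝ) {g₁ g₂ : G} {v₁ : Γ.Fiber g₁} {v₂ : Γ.Fiber g₂}
    {w : Γ.Fiber (𝒢.mul g₁ g₂)}
    (h : V.src ⟨g₁, v₁⟩ = V.tgt ⟨g₂, v₂⟩) (hw : V.mul ⟨g₁, v₁⟩ ⟨g₂, v₂⟩ = ⟨𝒢.mul g₁ g₂, w⟩) :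
    V.mul ⟨g₁, r • v₁⟩ ⟨g₂, r • v₂⟩ = ⟨𝒢.mul g₁ g₂, r • w⟩ := by
  have hc : ∀ t : ℝ, V.src ⟨g₁, t • v₁⟩ = V.tgt ⟨g₂, t • v₂⟩ := fun t => hV.composable_smul t h
  choose f hf using fun t => hV.exists_mul (hc t)
  have hadd : ∀ a b, f (a + b) = f a + f b := fun a b => by
    have := hV.interchange g₁ g₂ _ _ _ _ _ _ (hc a) (hc b) (hf a) (hf b)
    rw [← add_smul, ← add_smul, hf, Γ.mk_inj] at this
    exact this
  have hline : ∀ (g : G) (v : Γ.Fiber g), Continuous (fun t : ℝ => (⟨g, t • v⟩ : Γ.Tot)) := by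
    intro g v
    have hcf : Continuous (fun t : ℝ => t • v) := by
      let e := (trivializationAt Γ.Model Γ.Fiber g).continuousLinearEquivAt ℝ g
        (mem_baseSet_trivializationAt Γ.Model Γ.Fiber g)
      have : (fun t : ℝ => t • v) = fun t : ℝ => e.symm (t • e v) := by
        funext t; simp
      rw [this]
      exact e.symm.continuous.comp (continuous_id.smul continuous_const)
    exact (FiberBundle.continuous_totalSpaceMk Γ.Model Γ.Fiber g).comp hcf
  have hcont : Continuous f := by
    rw [(FiberBundle.totalSpaceMk_isInducing Γ.Model Γ.Fiber _).continuous_iff]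
    have : (TotalSpace.mk (𝒢.mul g₁ g₂) ∘ f : ℝ → Γ.Tot) =
        fun t => V.mul ⟨g₁, t • v₁⟩ ⟨g₂, t • v₂⟩ := by
      funext t; exact (hf t).symm
    rw [this]
    exact hV.isLie.contMDiffOn_mul.continuousOn.comp_continuous
      ((hline g₁ v₁).prodMk (hline g₂ v₂)) hc
  let e := (trivializationAt Γ.Model Γ.Fiber (𝒢.mul g₁ g₂)).continuousLinearEquivAt ℝ _
    (mem_baseSet_trivializationAt Γ.Model Γ.Fiber (𝒢.mul g₁ g₂))
  -- The fibre carries only a topology, so the real-linearity argument is made in the normed model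
  -- fibre.
  let F : ℝ →+ Γ.Model := AddMonoidHom.mk' (fun t => e (f t)) (fun a b => by
    rw [hadd, map_add])
  have hF := map_real_smul F (e.continuous.comp hcont) r 1
  have h1 : f r = r • f 1 := by
    apply e.injective
    rw [map_smul]
    simpa [F] using hF
  have h2 : f 1 = w := by
    have := hf 1
    rw [one_smul, one_smul, hw, Γ.mk_inj] at this
    exact this.symm
  rw [hf r, h1, h2]

/-- The product of two linear families of composable elements, as a linear family. -/
theorem exists_mulL {X : Type*} [AddCommGroup X] [Module ℝ X] {g₁ g₂ : G}
    (A : X →ₗ[ℝ] Γ.Fiber g₁) (B : X →ₗ[ℝ] Γ.Fiber g₂)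
    (h : ∀ x, V.src ⟨g₁, A x⟩ = V.tgt ⟨g₂, B x⟩) {g : G} (hg : 𝒢.mul g₁ g₂ = g) :
    ∃ P : X →ₗ[ℝ] Γ.Fiber g, ∀ x, V.mul ⟨g₁, A x⟩ ⟨g₂, B x⟩ = ⟨g, P x⟩ := by
  subst hg
  choose f hf using fun x => hV.exists_mul (h x)
  refine ⟨{ toFun := f, map_add' := fun x y => ?_, map_smul' := fun r x => ?_ }, hf⟩
  · have := hV.interchange g₁ g₂ _ _ _ _ _ _ (h x) (h y) (hf x) (hf y)
    rw [← map_add, ← map_add, hf, Γ.mk_inj] at this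
    exact this
  · have := hV.mul_smul r (h x) (hf x)
    rw [← map_smul, ← map_smul, hf, Γ.mk_inj] at this
    exact this

/-- Interchange law with the products given over an arbitrary `g` equal to `g₁ g₂`. -/
theorem mul_add {g₁ g₂ g : G} (hg : 𝒢.mul g₁ g₂ = g) {v₁ v₁' : Γ.Fiber g₁} {v₂ v₂' : Γ.Fiber g₂}
    {u w : Γ.Fiber g}
    (h : V.src ⟨g₁, v₁⟩ = V.tgt ⟨g₂, v₂⟩) (h' : V.src ⟨g₁, v₁'⟩ = V.tgt ⟨g₂, v₂'⟩)
    (hu : V.mul ⟨g₁, v₁⟩ ⟨g₂, v₂⟩ = ⟨g, u⟩) (hw : V.mul ⟨g₁, v₁'⟩ ⟨g₂, v₂'⟩ = ⟨g, w⟩) :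
    V.mul ⟨g₁, v₁ + v₁'⟩ ⟨g₂, v₂ + v₂'⟩ = ⟨g, u + w⟩ := by
  subst hg
  exact hV.interchange g₁ g₂ _ _ _ _ _ _ h h' hu hw

/-- The zero over a unit arrow is idempotent by `mul_zero_zero`, and an idempotent of a groupoid is
a unit. -/
theorem one_zero (x : M) : V.one ⟨x, 0⟩ = ⟨𝒢.one x, 0⟩ := by
  have h1 : 𝒢.mul (𝒢.one x) (𝒢.one x) = 𝒢.one x := by
    have := 𝒢.mul_one (𝒢.one x)
    rwa [𝒢.src_one] at this
  have h2 := hV.mul_zero_zero (𝒢.src_one_eq_tgt_one x)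
  rw [h1] at h2
  have hz : V.src ⟨𝒢.one x, 0⟩ = (⟨x, 0⟩ : E.Tot) := by
    rw [hV.src_zero, E.mk_eq_mk_iff]; exact ⟨𝒢.src_one x, by simp⟩
  have ht : V.tgt ⟨𝒢.one x, 0⟩ = (⟨x, 0⟩ : E.Tot) := by
    rw [hV.tgt_zero, E.mk_eq_mk_iff]; exact ⟨𝒢.tgt_one x, by simp⟩
  set z : Γ.Tot := ⟨𝒢.one x, 0⟩ with hzdef
  have h3 : V.mul (V.inv z) (V.mul z z) = V.mul (V.inv z) z := by rw [h2]
  rw [← hV.isLie.mul_assoc (hV.isLie.src_inv z) (hz.trans ht.symm), hV.isLie.inv_mul, hz] at h3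
  have h4 := hV.isLie.one_mul z
  rw [ht] at h4
  exact h3.symm.trans h4

end IsVBGroupoid

end VBGroupoid

/-! ### Splitting a VB-groupoid by a horizontal lift -/

section Splitting

variable {EM : Type*} [NormedAddCommGroup EM] [NormedSpace ℝ EM] {HM : Type*} [TopologicalSpace HM]
  {IM : ModelWithCorners ℝ EM HM} {M : Type*} [TopologicalSpace M] [ChartedSpace HM M]
  {EG : Type*} [NormedAddCommGroup EG] [NormedSpace ℝ EG] {HG : Type*} [TopologicalSpace HG]
  {IG : ModelWithCorners ℝ EG HG} {G : Type*} [TopologicalSpace G] [ChartedSpace HG G]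

/-- The algebraic data by which a VB-groupoid with horizontal lift `h` and core `k` is split into
core and side parts: `act g c = k(c) · 0_g`, and the components of the associated representation
up to homotopy. -/
structure SplitData (𝒢 : LieGroupoid IM M IG G) {E : SmoothVectorBundle IM M}
    {Γ : SmoothVectorBundle IG G} (V : GroupoidData E.Tot Γ.Tot)
    (h : ∀ g : G, E.Fiber (𝒢.src g) →ₗ[ℝ] Γ.Fiber g) {C : SmoothVectorBundle IM M}
    (k : ∀ x : M, C.Fiber x →ₗ[ℝ] Γ.Fiber (𝒢.one x)) where
  act : ∀ g : G, C.Fiber (𝒢.tgt g) →ₗ[ℝ] Γ.Fiber g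
  bd : ∀ x : M, C.Fiber x →ₗ[ℝ] E.Fiber x
  ΔE : ∀ g : G, E.Fiber (𝒢.src g) →ₗ[ℝ] E.Fiber (𝒢.tgt g)
  ΔC : ∀ g : G, C.Fiber (𝒢.src g) →ₗ[ℝ] C.Fiber (𝒢.tgt g)
  Ω : ∀ g₁ g₂ : G, E.Fiber (𝒢.src g₂) →ₗ[ℝ] C.Fiber (𝒢.tgt g₁)
  act_eq : ∀ g c, V.mul ⟨𝒢.one (𝒢.tgt g), k (𝒢.tgt g) c⟩ ⟨g, 0⟩ = ⟨g, act g c⟩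
  mul_act_inv : ∀ g c, V.mul ⟨g, act g c⟩ ⟨𝒢.inv g, 0⟩ = ⟨𝒢.one (𝒢.tgt g), k (𝒢.tgt g) c⟩
  act_surj : ∀ g v, V.src ⟨g, v⟩ = ⟨𝒢.src g, 0⟩ → ∃ c, act g c = v
  bd_eq : ∀ x c, V.tgt ⟨𝒢.one x, k x c⟩ = ⟨x, bd x c⟩
  ΔE_eq : ∀ g e, V.tgt ⟨g, h g e⟩ = ⟨𝒢.tgt g, ΔE g e⟩
  ΔC_eq : ∀ g c, V.mul ⟨g, h g (bd (𝒢.src g) c)⟩ ⟨𝒢.one (𝒢.src g), k (𝒢.src g) c⟩ =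
    ⟨g, act g (ΔC g c)⟩
  Ω_eq : ∀ g₁ g₂ (H : 𝒢.src g₁ = 𝒢.tgt g₂) (e : E.Fiber (𝒢.src g₂)),
    V.mul ⟨g₁, h g₁ (E.tr H.symm (ΔE g₂ e))⟩ ⟨g₂, h g₂ e⟩ =
      ⟨𝒢.mul g₁ g₂, h (𝒢.mul g₁ g₂) (E.tr (𝒢.src_mul H).symm e)
        - act (𝒢.mul g₁ g₂) (C.tr (𝒢.tgt_mul H).symm (Ω g₁ g₂ e))⟩
  Ω_off : ∀ g₁ g₂, 𝒢.src g₁ ≠ 𝒢.tgt g₂ → Ω g₁ g₂ = 0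

variable {𝒢 : LieGroupoid IM M IG G} {E C : SmoothVectorBundle IM M} {Γ : SmoothVectorBundle IG G}
  {V : GroupoidData E.Tot Γ.Tot}
  {h : ∀ g : G, E.Fiber (𝒢.src g) →ₗ[ℝ] Γ.Fiber g}
  {k : ∀ x : M, C.Fiber x →ₗ[ℝ] Γ.Fiber (𝒢.one x)}

theorem IsCore.src_core (hk : IsCore 𝒢 V C k) (x : M) (c : C.Fiber x) :
    V.src ⟨𝒢.one x, k x c⟩ = ⟨x, 0⟩ := (hk.range_eq x _).1 ⟨c, rfl⟩

theorem core_mk_tr (k : ∀ x : M, C.Fiber x →ₗ[ℝ] Γ.Fiber (𝒢.one x)) {x y : M} (H : x = y)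
    (c : C.Fiber x) : (⟨𝒢.one y, k y (C.tr H c)⟩ : Γ.Tot) = ⟨𝒢.one x, k x c⟩ := by
  subst H; rfl

/-- Right multiplication by `0_g` and by `0_{g⁻¹}` are mutually inverse, so `act g` identifies the
core at `t(g)` with `ker s̃` over `g`. Both `h_g(∂ c) · c` and `h_{g₁g₂}(e) - h_{g₁}(Δ^E e) ·
h_{g₂}(e)` have source zero; read through this identification they are `Δ^C` and `Ω`. -/
theorem exists_splitData (hV : IsVBGroupoid 𝒢 E Γ V) (hh : IsHorizontalLift 𝒢 V h)
    (hk : IsCore 𝒢 V C k) : Nonempty (SplitData 𝒢 V h k) := by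
  have hc : ∀ g (c : C.Fiber (𝒢.tgt g)),
      V.src ⟨𝒢.one (𝒢.tgt g), k (𝒢.tgt g) c⟩ = V.tgt ⟨g, 0⟩ := fun g c => by
    rw [hk.src_core, hV.tgt_zero]
  have hzinv : ∀ g, V.src ⟨g, 0⟩ = V.tgt ⟨𝒢.inv g, 0⟩ := fun g =>
    hV.composable_zero (𝒢.tgt_inv g).symm
  have hinvz : ∀ g, V.src ⟨𝒢.inv g, 0⟩ = V.tgt ⟨g, 0⟩ := fun g =>
    hV.composable_zero (𝒢.src_inv g)
  choose act act_eq using fun g => hV.exists_mulL (k (𝒢.tgt g)) 0 (hc g) (𝒢.one_mul g)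
  simp only [LinearMap.zero_apply] at act_eq
  have src_act : ∀ g c, V.src ⟨g, act g c⟩ = ⟨𝒢.src g, 0⟩ := fun g c => by
    rw [← act_eq, hV.isLie.src_mul (hc g c), hV.src_zero]
  have mul_act_inv : ∀ g c, V.mul ⟨g, act g c⟩ ⟨𝒢.inv g, 0⟩ =
      ⟨𝒢.one (𝒢.tgt g), k (𝒢.tgt g) c⟩ := fun g c => by
    rw [← act_eq, hV.isLie.mul_assoc (hc g c) (hzinv g), hV.mul_zero_zero (𝒢.tgt_inv g).symm,
      𝒢.mul_inv, ← hV.one_zero, ← hk.src_core _ c]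
    exact hV.isLie.mul_one _
  have act_inj : ∀ g, Function.Injective (act g) := fun g c c' hcc => by
    have h1 := mul_act_inv g c
    rw [hcc, mul_act_inv, Γ.mk_inj] at h1
    exact (hk.injective _ h1).symm
  have act_surj : ∀ g v, V.src ⟨g, v⟩ = ⟨𝒢.src g, 0⟩ → ∃ c, act g c = v := fun g v hv => by
    have h1 : V.src ⟨g, v⟩ = V.tgt ⟨𝒢.inv g, 0⟩ := by rw [hv, ← hV.src_zero, hzinv]
    obtain ⟨w, hw⟩ := hV.exists_mul h1
    rw [← Γ.mk_tr (𝒢.mul_inv g) w] at hw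
    have h2 : V.src ⟨𝒢.one (𝒢.tgt g), Γ.tr (𝒢.mul_inv g) w⟩ = ⟨𝒢.tgt g, 0⟩ := by
      rw [← hw, hV.isLie.src_mul h1, hinvz, hV.tgt_zero]
    obtain ⟨c, hcw⟩ := (hk.range_eq _ _).2 h2
    refine ⟨c, ?_⟩
    have h3 := act_eq g c
    rw [hcw, ← hw, hV.isLie.mul_assoc h1 (hinvz g), hV.mul_zero_zero (𝒢.src_inv g), 𝒢.inv_mul,
      ← hV.one_zero, ← hv] at h3
    exact (Γ.mk_inj.1 ((hV.isLie.mul_one _).symm.trans h3)).symm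
  -- A linear left inverse of `act g`, arbitrary off its image, inverts it on `ker s̃`. Defining
  -- `Δ^C` and `Ω` through `r` makes them linear from the start.
  choose r hr using fun g => (act g).exists_leftInverse_of_injective
    (LinearMap.ker_eq_bot.2 (act_inj g))
  have act_r : ∀ g v, V.src ⟨g, v⟩ = ⟨𝒢.src g, 0⟩ → act g (r g v) = v := fun g v hv => by
    obtain ⟨c, rfl⟩ := act_surj g v hv
    exact congrArg (act g) (LinearMap.congr_fun (hr g) c)
  let bd : ∀ x : M, C.Fiber x →ₗ[ℝ] E.Fiber x := fun x =>
    (E.tr (𝒢.tgt_one x)).toLinearMap ∘ₗ hV.tgtL (𝒢.one x) ∘ₗ k x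
  have bd_eq : ∀ x c, V.tgt ⟨𝒢.one x, k x c⟩ = ⟨x, bd x c⟩ := fun x c => by
    rw [hV.tgt_mk]
    exact (E.mk_tr (𝒢.tgt_one x) _).symm
  let ΔE : ∀ g : G, E.Fiber (𝒢.src g) →ₗ[ℝ] E.Fiber (𝒢.tgt g) := fun g => hV.tgtL g ∘ₗ h g
  have ΔE_eq : ∀ g e, V.tgt ⟨g, h g e⟩ = ⟨𝒢.tgt g, ΔE g e⟩ := fun g e => hV.tgt_mk g _
  have hbd : ∀ g (c : C.Fiber (𝒢.src g)), V.src ⟨g, (h g ∘ₗ bd (𝒢.src g)) c⟩ =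
      V.tgt ⟨𝒢.one (𝒢.src g), k (𝒢.src g) c⟩ := fun g c => by
    rw [bd_eq]; exact hh.src_lift g _
  choose P hP using fun g => hV.exists_mulL (h g ∘ₗ bd (𝒢.src g)) (k (𝒢.src g)) (hbd g)
    (𝒢.mul_one g)
  have hΩ : ∀ g₁ g₂, ∃ Ω : E.Fiber (𝒢.src g₂) →ₗ[ℝ] C.Fiber (𝒢.tgt g₁),
      (∀ (H : 𝒢.src g₁ = 𝒢.tgt g₂) (e : E.Fiber (𝒢.src g₂)),
        V.mul ⟨g₁, h g₁ (E.tr H.symm (ΔE g₂ e))⟩ ⟨g₂, h g₂ e⟩ =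
          ⟨𝒢.mul g₁ g₂, h (𝒢.mul g₁ g₂) (E.tr (𝒢.src_mul H).symm e)
            - act (𝒢.mul g₁ g₂) (C.tr (𝒢.tgt_mul H).symm (Ω e))⟩) ∧
      (𝒢.src g₁ ≠ 𝒢.tgt g₂ → Ω = 0) := by
    intro g₁ g₂
    by_cases H : 𝒢.src g₁ = 𝒢.tgt g₂
    · have hcomp : ∀ e, V.src ⟨g₁, (h g₁ ∘ₗ (E.tr H.symm).toLinearMap ∘ₗ ΔE g₂) e⟩ =
          V.tgt ⟨g₂, h g₂ e⟩ := fun e => by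
        rw [ΔE_eq]
        exact (hh.src_lift g₁ _).trans (E.mk_tr _ _)
      obtain ⟨Q, hQ⟩ := hV.exists_mulL _ _ hcomp rfl
      refine ⟨(C.tr (𝒢.tgt_mul H)).toLinearMap ∘ₗ r (𝒢.mul g₁ g₂) ∘ₗ
        (h (𝒢.mul g₁ g₂) ∘ₗ (E.tr (𝒢.src_mul H).symm).toLinearMap - Q), fun _ e => ?_,
        fun H' => (H' H).elim⟩
      refine (hQ e).trans (Γ.mk_inj.2 ?_)
      have hs : V.src ⟨𝒢.mul g₁ g₂, h (𝒢.mul g₁ g₂) (E.tr (𝒢.src_mul H).symm e) - Q e⟩ =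
          ⟨𝒢.src (𝒢.mul g₁ g₂), 0⟩ := by
        have h1 : V.src ⟨𝒢.mul g₁ g₂, h (𝒢.mul g₁ g₂) (E.tr (𝒢.src_mul H).symm e)⟩ =
            V.src ⟨𝒢.mul g₁ g₂, Q e⟩ := by
          rw [hh.src_lift, E.mk_tr, ← hQ e, hV.isLie.src_mul (hcomp e), hh.src_lift]
        rw [hV.src_mk, hV.src_mk, E.mk_inj] at h1
        rw [hV.src_mk, map_sub, h1, sub_self]
      have h2 := act_r _ _ hs
      simp only [LinearMap.comp_apply, LinearMap.sub_apply, LinearEquiv.coe_coe,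
        SmoothVectorBundle.tr_tr, SmoothVectorBundle.tr_rfl, h2]
      abel
    · exact ⟨0, fun H' => (H H').elim, fun _ => rfl⟩
  choose Ω hΩ₁ hΩ₂ using hΩ
  refine ⟨{ act := act, bd := bd, ΔE := ΔE, ΔC := fun g => r g ∘ₗ P g, Ω := Ω, act_eq := act_eq,
            mul_act_inv := mul_act_inv, act_surj := act_surj, bd_eq := bd_eq, ΔE_eq := ΔE_eq,
            ΔC_eq := fun g c => ?_, Ω_eq := hΩ₁, Ω_off := hΩ₂ }⟩
  refine (hP g c).trans (Γ.mk_inj.2 (act_r g _ ?_).symm)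
  rw [← hP, hV.isLie.src_mul (hbd g c), hk.src_core]

namespace SplitData

variable (S : SplitData 𝒢 V h k)

theorem bd_tr {x y : M} (H : x = y) (c : C.Fiber x) :
    S.bd y (C.tr H c) = E.tr H (S.bd x c) := by
  subst H; rfl

theorem act_injective (hk : IsCore 𝒢 V C k) (g : G) : Function.Injective (S.act g) := by
  intro c c' hcc
  have h1 := S.mul_act_inv g c
  rw [hcc, S.mul_act_inv, Γ.mk_inj] at h1
  exact (hk.injective _ h1).symm

variable (hV : IsVBGroupoid 𝒢 E Γ V) (hh : IsHorizontalLift 𝒢 V h) (hk : IsCore 𝒢 V C k)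

section

include hV hk

theorem composable_core (g : G) (c : C.Fiber (𝒢.tgt g)) :
    V.src ⟨𝒢.one (𝒢.tgt g), k (𝒢.tgt g) c⟩ = V.tgt ⟨g, 0⟩ := by
  rw [hk.src_core, hV.tgt_zero]

theorem src_act (g : G) (c : C.Fiber (𝒢.tgt g)) : V.src ⟨g, S.act g c⟩ = ⟨𝒢.src g, 0⟩ := by
  rw [← S.act_eq, hV.isLie.src_mul (composable_core hV hk g c), hV.src_zero]

theorem tgt_act (g : G) (c : C.Fiber (𝒢.tgt g)) :
    V.tgt ⟨g, S.act g c⟩ = ⟨𝒢.tgt g, S.bd (𝒢.tgt g) c⟩ := by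
  rw [← S.act_eq, hV.isLie.tgt_mul (composable_core hV hk g c), S.bd_eq]

theorem act_mul_zero {g₁ g₂ : G} (H : 𝒢.src g₁ = 𝒢.tgt g₂) (c : C.Fiber (𝒢.tgt g₁)) :
    V.mul ⟨g₁, S.act g₁ c⟩ ⟨g₂, 0⟩ =
      ⟨𝒢.mul g₁ g₂, S.act (𝒢.mul g₁ g₂) (C.tr (𝒢.tgt_mul H).symm c)⟩ := by
  rw [← S.act_eq, hV.isLie.mul_assoc (composable_core hV hk g₁ c) (hV.composable_zero H),
    hV.mul_zero_zero H, ← S.act_eq, core_mk_tr]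

theorem act_one (x : M) (c : C.Fiber (𝒢.tgt (𝒢.one x))) :
    (⟨𝒢.one x, S.act (𝒢.one x) c⟩ : Γ.Tot) = ⟨𝒢.one x, k x (C.tr (𝒢.tgt_one x) c)⟩ := by
  have h1 := S.act_eq (𝒢.one x) c
  rw [← core_mk_tr k (𝒢.tgt_one x), ← hV.one_zero,
    ← hk.src_core _ (C.tr (𝒢.tgt_one x) c), hV.isLie.mul_one] at h1
  exact h1.symm

end

section

include hV hh hk

/-- Associativity: `h(∂ c) · (c · 0_{g₂}) = (h(∂ c) · c) · 0_{g₂} = (Δ^C c · 0_{g₁}) · 0_{g₂}`. -/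
theorem lift_mul_act {g₁ g₂ : G} (H : 𝒢.src g₁ = 𝒢.tgt g₂) (c : C.Fiber (𝒢.tgt g₂)) :
    V.mul ⟨g₁, h g₁ (E.tr H.symm (S.bd (𝒢.tgt g₂) c))⟩ ⟨g₂, S.act g₂ c⟩ =
      ⟨𝒢.mul g₁ g₂, S.act (𝒢.mul g₁ g₂) (C.tr (𝒢.tgt_mul H).symm
        (S.ΔC g₁ (C.tr H.symm c)))⟩ := by
  have h1 : V.src ⟨g₁, h g₁ (S.bd (𝒢.src g₁) (C.tr H.symm c))⟩ =
      V.tgt ⟨𝒢.one (𝒢.src g₁), k (𝒢.src g₁) (C.tr H.symm c)⟩ := by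
    rw [hh.src_lift, S.bd_eq]
  have h2 : V.src ⟨𝒢.one (𝒢.src g₁), k (𝒢.src g₁) (C.tr H.symm c)⟩ = V.tgt ⟨g₂, 0⟩ := by
    rw [core_mk_tr, hk.src_core, hV.tgt_zero]
  rw [← S.act_eq, ← core_mk_tr k H.symm, ← S.bd_tr, ← hV.isLie.mul_assoc h1 h2, S.ΔC_eq,
    S.act_mul_zero hV hk H]

/-- The multiplication of a VB-groupoid in terms of its splitting. -/
theorem mul_formula {g₁ g₂ : G} (H : 𝒢.src g₁ = 𝒢.tgt g₂) (c₁ : C.Fiber (𝒢.tgt g₁))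
    (c₂ : C.Fiber (𝒢.tgt g₂)) (e₂ : E.Fiber (𝒢.src g₂)) :
    V.mul ⟨g₁, S.act g₁ c₁ + h g₁ (E.tr H.symm (S.bd (𝒢.tgt g₂) c₂ + S.ΔE g₂ e₂))⟩
        ⟨g₂, S.act g₂ c₂ + h g₂ e₂⟩ =
      ⟨𝒢.mul g₁ g₂, S.act (𝒢.mul g₁ g₂) (C.tr (𝒢.tgt_mul H).symm
          (c₁ + S.ΔC g₁ (C.tr H.symm c₂) - S.Ω g₁ g₂ e₂))
        + h (𝒢.mul g₁ g₂) (E.tr (𝒢.src_mul H).symm e₂)⟩ := by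
  have h1 : V.src ⟨g₁, S.act g₁ c₁⟩ = V.tgt ⟨g₂, 0⟩ := by
    rw [S.src_act hV hk, ← hV.src_zero, hV.composable_zero H]
  have h2 : V.src ⟨g₁, h g₁ (E.tr H.symm (S.bd (𝒢.tgt g₂) c₂))⟩ = V.tgt ⟨g₂, S.act g₂ c₂⟩ := by
    rw [hh.src_lift, S.tgt_act hV hk, E.mk_tr]
  have h3 : V.src ⟨g₁, h g₁ (E.tr H.symm (S.ΔE g₂ e₂))⟩ = V.tgt ⟨g₂, h g₂ e₂⟩ := by
    rw [hh.src_lift, S.ΔE_eq, E.mk_tr]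
  -- The pair of factors is the sum of the composable pairs `(act c₁, 0)`, `(h(∂ c₂), act c₂)` and
  -- `(h(Δ^E e₂), h(e₂))`, whose products are known; two uses of interchange add them up.
  have h4 := hV.mul_add rfl h1 h2 (S.act_mul_zero hV hk H c₁) (S.lift_mul_act hV hh hk H c₂)
  have h5 := hV.mul_add rfl (hV.composable_add h1 h2) h3 h4 (S.Ω_eq g₁ g₂ H e₂)
  have e1 : S.act g₁ c₁ + h g₁ (E.tr H.symm (S.bd (𝒢.tgt g₂) c₂ + S.ΔE g₂ e₂)) =
      S.act g₁ c₁ + h g₁ (E.tr H.symm (S.bd (𝒢.tgt g₂) c₂)) +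
        h g₁ (E.tr H.symm (S.ΔE g₂ e₂)) := by
    simp only [map_add]; abel
  rw [e1, ← zero_add (S.act g₂ c₂), h5, Γ.mk_inj]
  simp only [map_add, map_sub]
  abel

/-- The source map reads off `e`, and then injectivity of `act` gives `c`. This is how an identity
in `Γ` is turned into one between core components. -/
theorem split_inj {g g' : G} {c : C.Fiber (𝒢.tgt g)} {e : E.Fiber (𝒢.src g)}
    {c' : C.Fiber (𝒢.tgt g')} {e' : E.Fiber (𝒢.src g')}
    (H : (⟨g, S.act g c + h g e⟩ : Γ.Tot) = ⟨g', S.act g' c' + h g' e'⟩) :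
    ∃ hg : g = g', c' = C.tr (congrArg 𝒢.tgt hg) c ∧ e' = E.tr (congrArg 𝒢.src hg) e := by
  have hg : g = g' := congrArg (fun z : Γ.Tot => z.proj) H
  subst hg
  refine ⟨rfl, ?_⟩
  have hs : ∀ c e, hV.srcL g (S.act g c + h g e) = e := fun c e => by
    have h1 := S.src_act hV hk g c
    have h2 := hh.src_lift g e
    rw [hV.src_mk, E.mk_inj] at h1 h2
    rw [map_add, h1, h2, zero_add]
  rw [Γ.mk_inj] at H
  have he : e = e' := by rw [← hs c e, H, hs]
  subst he
  exact ⟨(S.act_injective hk g (add_right_cancel H)).symm, rfl⟩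

/-- Core component of associativity for three factors whose core parts are `0`, `0`, `c`. It
contains the second structure equation (`e = 0`) and the fourth (`c = 0`) at once. -/
theorem assoc_formula {g₁ g₂ g₃ : G} (H : 𝒢.src g₁ = 𝒢.tgt g₂) (K : 𝒢.src g₂ = 𝒢.tgt g₃)
    (c : C.Fiber (𝒢.tgt g₃)) (e : E.Fiber (𝒢.src g₃)) :
    -S.Ω g₁ g₂ (E.tr K.symm (S.bd (𝒢.tgt g₃) c + S.ΔE g₃ e))
        + C.tr (𝒢.tgt_mul H)
          (S.ΔC (𝒢.mul g₁ g₂) (C.tr (K.symm.trans (𝒢.src_mul H).symm) c))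
        - C.tr (𝒢.tgt_mul H) (S.Ω (𝒢.mul g₁ g₂) g₃ e) =
      S.ΔC g₁ (C.tr H.symm (S.ΔC g₂ (C.tr K.symm c))) - S.ΔC g₁ (C.tr H.symm (S.Ω g₂ g₃ e))
        - S.Ω g₁ (𝒢.mul g₂ g₃) (E.tr (𝒢.src_mul K).symm e) := by
  have H' : 𝒢.src (𝒢.mul g₁ g₂) = 𝒢.tgt g₃ := (𝒢.src_mul H).trans K
  have K' : 𝒢.src g₁ = 𝒢.tgt (𝒢.mul g₂ g₃) := H.trans (𝒢.tgt_mul K).symm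
  have src_split : ∀ g c e, V.src ⟨g, S.act g c + h g e⟩ = ⟨𝒢.src g, e⟩ := fun g c e => by
    have h1 := S.src_act hV hk g c
    have h2 := hh.src_lift g e
    rw [hV.src_mk, E.mk_inj] at h1 h2 ⊢
    rw [map_add, h1, h2, zero_add]
  have tgt_split : ∀ g c e, V.tgt ⟨g, S.act g c + h g e⟩ =
      ⟨𝒢.tgt g, S.bd (𝒢.tgt g) c + S.ΔE g e⟩ := fun g c e => by
    have h1 := S.tgt_act hV hk g c
    have h2 := S.ΔE_eq g e
    rw [hV.tgt_mk, E.mk_inj] at h1 h2 ⊢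
    rw [map_add, h1, h2]
  set e₂ : E.Fiber (𝒢.src g₂) := E.tr K.symm (S.bd (𝒢.tgt g₃) c + S.ΔE g₃ e) with he₂
  have k12 : V.src ⟨g₁, S.act g₁ 0 + h g₁ (E.tr H.symm (S.bd (𝒢.tgt g₂) 0 + S.ΔE g₂ e₂))⟩ =
      V.tgt ⟨g₂, S.act g₂ 0 + h g₂ e₂⟩ := by
    rw [src_split, tgt_split, E.mk_tr]
  have k23 : V.src ⟨g₂, S.act g₂ 0 + h g₂ e₂⟩ = V.tgt ⟨g₃, S.act g₃ c + h g₃ e⟩ := by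
    rw [src_split, tgt_split, he₂, E.mk_tr]
  have hassoc := hV.isLie.mul_assoc k12 k23
  have hl := S.mul_formula hV hh hk H 0 0 e₂
  have hr := S.mul_formula hV hh hk K 0 c e
  rw [← he₂] at hr
  have hl' := S.mul_formula hV hh hk H'
    (C.tr (𝒢.tgt_mul H).symm (0 + S.ΔC g₁ (C.tr H.symm 0) - S.Ω g₁ g₂ e₂)) c e
  have hr' := S.mul_formula hV hh hk K' 0
    (C.tr (𝒢.tgt_mul K).symm (0 + S.ΔC g₂ (C.tr K.symm c) - S.Ω g₂ g₃ e))
    (E.tr (𝒢.src_mul K).symm e)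
  have he12 : E.tr (𝒢.src_mul H).symm e₂ =
      E.tr H'.symm (S.bd (𝒢.tgt g₃) c + S.ΔE g₃ e) := by
    rw [he₂, E.tr_tr]
  -- To apply `mul_formula` to the right-bracketed product, the side part of the first factor must
  -- be written as the target of `γ₂ γ₃`; that target equals the target of `γ₂`.
  have he1 : E.tr H.symm (S.bd (𝒢.tgt g₂) 0 + S.ΔE g₂ e₂) = E.tr K'.symm
      (S.bd (𝒢.tgt (𝒢.mul g₂ g₃))
        (C.tr (𝒢.tgt_mul K).symm (0 + S.ΔC g₂ (C.tr K.symm c) - S.Ω g₂ g₃ e)) +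
        S.ΔE (𝒢.mul g₂ g₃) (E.tr (𝒢.src_mul K).symm e)) := by
    have h1 := hV.isLie.tgt_mul k23
    rw [hr, tgt_split, tgt_split, E.mk_eq_mk_iff] at h1
    obtain ⟨h2, h3⟩ := h1
    rw [h3, E.tr_tr]
  rw [hl, he12, hl', hr, he1, hr'] at hassoc
  obtain ⟨hg, h1, -⟩ := S.split_inj hV hh hk hassoc
  rw [SmoothVectorBundle.tr_tr, eq_comm, SmoothVectorBundle.tr_eq_iff] at h1
  simp only [map_add, map_sub, map_neg, map_zero, zero_add, zero_sub,
    SmoothVectorBundle.tr_tr] at h1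
  have h2 := congrArg (C.tr ((𝒢.tgt_mul H').trans (𝒢.tgt_mul H))) h1
  simpa only [map_add, map_sub, map_neg, SmoothVectorBundle.tr_tr,
    SmoothVectorBundle.tr_rfl] using h2

end

end SplitData

end Splitting

/-! ### The components form a representation up to homotopy, uniquely -/

section SplittingRuth

variable {EM : Type*} [NormedAddCommGroup EM] [NormedSpace ℝ EM] {HM : Type*} [TopologicalSpace HM]
  {IM : ModelWithCorners ℝ EM HM} {M : Type*} [TopologicalSpace M] [ChartedSpace HM M]
  {EG : Type*} [NormedAddCommGroup EG] [NormedSpace ℝ EG] {HG : Type*} [TopologicalSpace HG]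
  {IG : ModelWithCorners ℝ EG HG} {G : Type*} [TopologicalSpace G] [ChartedSpace HG G]
  {EN : Type*} [NormedAddCommGroup EN] [NormedSpace ℝ EN] {HN : Type*} [TopologicalSpace HN]
  {J : ModelWithCorners ℝ EN HN} {N : Type*} [TopologicalSpace N] [ChartedSpace HN N]
  {𝒢 : LieGroupoid IM M IG G} {E C : SmoothVectorBundle IM M} {Γ : SmoothVectorBundle IG G}
  {V : GroupoidData E.Tot Γ.Tot}
  {h : ∀ g : G, E.Fiber (𝒢.src g) →ₗ[ℝ] Γ.Fiber g}
  {k : ∀ x : M, C.Fiber x →ₗ[ℝ] Γ.Fiber (𝒢.one x)}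

theorem IsLieGroupoid.contMDiffWithinAt_mul {S : GroupoidData M G} (hS : IsLieGroupoid IM IG S)
    {f₁ f₂ : N → G} {s : Set N} {x : N} (hx : x ∈ s) (hs : ∀ n ∈ s, S.src (f₁ n) = S.tgt (f₂ n))
    (h₁ : ContMDiffWithinAt J IG ∞ f₁ s x) (h₂ : ContMDiffWithinAt J IG ∞ f₂ s x) :
    ContMDiffWithinAt J IG ∞ (fun n => S.mul (f₁ n) (f₂ n)) s x :=
  (hS.contMDiffOn_mul (f₁ x, f₂ x) (hs x hx)).comp x (h₁.prodMk h₂) (fun n hn => hs n hn)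

theorem IsHorizontalLift.contMDiffWithinAt_lift (hh : IsHorizontalLift 𝒢 V h) {g : N → G}
    {e : ∀ n, E.Fiber (𝒢.src (g n))} {s : Set N} {x : N}
    (hg : ContMDiffWithinAt J IG ∞ g s x)
    (he : ContMDiffWithinAt J E.TotI ∞ (fun n => (⟨𝒢.src (g n), e n⟩ : E.Tot)) s x) :
    ContMDiffWithinAt J Γ.TotI ∞ (fun n => (⟨g n, h (g n) (e n)⟩ : Γ.Tot)) s x :=
  hh.smooth.comp_within (b := g) (v := e) ((E.contMDiffWithinAt_pullback_iff 𝒢.src).2 ⟨hg, he⟩)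

theorem Ruth.ext_of {D D' : Ruth 𝒢 E C} (hΔC : D.ΔC = D'.ΔC) (hΔE : D.ΔE = D'.ΔE)
    (hbd : D.bd = D'.bd) (hΩ : D.Ω = D'.Ω) : D = D' := by
  cases D; cases D'
  cases hΔC; cases hΔE; cases hbd; cases hΩ
  rfl

namespace SplitData

variable (S : SplitData 𝒢 V h k)

section

variable (hV : IsVBGroupoid 𝒢 E Γ V) (hk : IsCore 𝒢 V C k)
include hV hk

theorem contMDiffWithinAt_act {g : N → G} {c : ∀ n, C.Fiber (𝒢.tgt (g n))} {s : Set N} {x : N}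
    (hx : x ∈ s) (hg : ContMDiffWithinAt J IG ∞ g s x)
    (hc : ContMDiffWithinAt J C.TotI ∞ (fun n => (⟨𝒢.tgt (g n), c n⟩ : C.Tot)) s x) :
    ContMDiffWithinAt J Γ.TotI ∞ (fun n => (⟨g n, S.act (g n) (c n)⟩ : Γ.Tot)) s x := by
  simp only [← S.act_eq]
  exact hV.isLie.contMDiffWithinAt_mul hx
    (fun n _ => composable_core hV hk (g n) (c n)) (hk.smooth.comp_within hc)
    (ContMDiffWithinAt.fiber_zero Γ hg)

/-- Multiplying by the smooth family `0_{g⁻¹}` undoes `act` up to the inclusion `k`, which can be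
cancelled because it is fibrewise injective. Smoothness of `Δ^C` and `Ω`, known only through `act`,
is obtained this way. -/
theorem contMDiffWithinAt_of_act {g : N → G} {c : ∀ n, C.Fiber (𝒢.tgt (g n))} {s : Set N} {x : N}
    (hx : x ∈ s) (hg : ContMDiffWithinAt J IG ∞ g s x)
    (hc : ContMDiffWithinAt J Γ.TotI ∞ (fun n => (⟨g n, S.act (g n) (c n)⟩ : Γ.Tot)) s x) :
    ContMDiffWithinAt J C.TotI ∞ (fun n => (⟨𝒢.tgt (g n), c n⟩ : C.Tot)) s x := by
  refine hk.smooth.contMDiffWithinAt_of_injective hk.injective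
    (𝒢.tgt.contMDiff.contMDiffAt.comp_contMDiffWithinAt x hg) ?_
  simp only [← S.mul_act_inv]
  refine hV.isLie.contMDiffWithinAt_mul hx (fun n _ => ?_) hc
    (ContMDiffWithinAt.fiber_zero Γ (𝒢.isLie.contMDiff_inv.contMDiffAt.comp_contMDiffWithinAt x hg))
  rw [S.src_act hV hk, ← hV.src_zero, hV.composable_zero (𝒢.tgt_inv _).symm]

end

variable (hV : IsVBGroupoid 𝒢 E Γ V) (hh : IsHorizontalLift 𝒢 V h) (hk : IsCore 𝒢 V C k)

section

include hV hk

theorem smooth_bd : C.IsBundleMap E id S.bd :=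
  (hV.isLie.contMDiff_tgt.comp hk.smooth).congr fun p => (S.bd_eq p.proj p.snd).symm

end

section

include hV hh

theorem smooth_ΔE : (E.pullback 𝒢.src).IsBundleMap E 𝒢.tgt S.ΔE :=
  (hV.isLie.contMDiff_tgt.comp hh.smooth).congr fun p => (S.ΔE_eq p.proj p.snd).symm

end

section

include hV hh hk

theorem smooth_ΔC : (C.pullback 𝒢.src).IsBundleMap C 𝒢.tgt S.ΔC := by
  intro p
  rw [← contMDiffWithinAt_univ]
  have hg : ContMDiffWithinAt (C.pullback 𝒢.src).TotI IG ∞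
      (fun p : (C.pullback 𝒢.src).Tot => p.proj) Set.univ p :=
    (contMDiff_proj (C.pullback 𝒢.src).Fiber).contMDiffAt
  have hc : ContMDiffWithinAt (C.pullback 𝒢.src).TotI C.TotI ∞
      (fun p : (C.pullback 𝒢.src).Tot => (⟨𝒢.src p.proj, p.snd⟩ : C.Tot)) Set.univ p :=
    (C.contMDiff_lift 𝒢.src).contMDiffAt
  refine S.contMDiffWithinAt_of_act hV hk (Set.mem_univ p) hg
    (c := fun p : (C.pullback 𝒢.src).Tot => S.ΔC p.proj p.snd) ?_
  refine ContMDiffWithinAt.congr (f := fun p : (C.pullback 𝒢.src).Tot =>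
    V.mul ⟨p.proj, h p.proj (S.bd (𝒢.src p.proj) p.snd)⟩
      ⟨𝒢.one (𝒢.src p.proj), k (𝒢.src p.proj) p.snd⟩) ?_
    (fun q _ => (S.ΔC_eq q.proj q.snd).symm) (S.ΔC_eq p.proj p.snd).symm
  refine hV.isLie.contMDiffWithinAt_mul (Set.mem_univ p) (fun q _ => ?_)
    (hh.contMDiffWithinAt_lift hg ((S.smooth_bd hV hk).comp_within hc)) (hk.smooth.comp_within hc)
  exact (hh.src_lift _ _).trans (S.bd_eq _ _).symm

theorem smooth_Ω : ContMDiffOn (IG.prod (E.pullback 𝒢.src).TotI) C.TotI ∞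
    (fun p : G × (E.pullback 𝒢.src).Tot => (⟨𝒢.tgt p.1, S.Ω p.1 p.2.proj p.2.snd⟩ : C.Tot))
    {p | 𝒢.src p.1 = 𝒢.tgt p.2.proj} := by
  classical
  intro p hp
  set s := {p : G × (E.pullback 𝒢.src).Tot | 𝒢.src p.1 = 𝒢.tgt p.2.proj} with hs
  have h1 : ContMDiffWithinAt (IG.prod (E.pullback 𝒢.src).TotI) IG ∞
      (fun p : G × (E.pullback 𝒢.src).Tot => p.1) s p := contMDiffWithinAt_fst
  have h2 : ContMDiffWithinAt (IG.prod (E.pullback 𝒢.src).TotI) IG ∞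
      (fun p : G × (E.pullback 𝒢.src).Tot => p.2.proj) s p :=
    (contMDiff_proj (E.pullback 𝒢.src).Fiber).contMDiffAt.comp_contMDiffWithinAt p
      contMDiffWithinAt_snd
  have he : ContMDiffWithinAt (IG.prod (E.pullback 𝒢.src).TotI) E.TotI ∞
      (fun p : G × (E.pullback 𝒢.src).Tot => (⟨𝒢.src p.2.proj, p.2.snd⟩ : E.Tot)) s p :=
    (E.contMDiff_lift 𝒢.src).contMDiffAt.comp_contMDiffWithinAt p contMDiffWithinAt_snd
  have hm : ContMDiffWithinAt (IG.prod (E.pullback 𝒢.src).TotI) IG ∞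
      (fun p : G × (E.pullback 𝒢.src).Tot => 𝒢.mul p.1 p.2.proj) s p :=
    𝒢.isLie.contMDiffWithinAt_mul hp (fun _ h => h) h1 h2
  -- Again transported sections, set to zero away from composable pairs.
  let a : ∀ p : G × (E.pullback 𝒢.src).Tot, E.Fiber (𝒢.src (𝒢.mul p.1 p.2.proj)) := fun p =>
    if H : 𝒢.src p.1 = 𝒢.tgt p.2.proj then E.tr (𝒢.src_mul H).symm p.2.snd else 0
  let b : ∀ p : G × (E.pullback 𝒢.src).Tot, E.Fiber (𝒢.src p.1) := fun p =>
    if H : 𝒢.src p.1 = 𝒢.tgt p.2.proj then E.tr H.symm (S.ΔE p.2.proj p.2.snd) else 0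
  let c : ∀ p : G × (E.pullback 𝒢.src).Tot, C.Fiber (𝒢.tgt (𝒢.mul p.1 p.2.proj)) := fun p =>
    if H : 𝒢.src p.1 = 𝒢.tgt p.2.proj then
      C.tr (𝒢.tgt_mul H).symm (S.Ω p.1 p.2.proj p.2.snd) else 0
  have ha : ∀ p ∈ s, (⟨𝒢.src (𝒢.mul p.1 p.2.proj), a p⟩ : E.Tot) = ⟨𝒢.src p.2.proj, p.2.snd⟩ :=
    fun p hp => by
      simp only [a, dif_pos (show 𝒢.src p.1 = 𝒢.tgt p.2.proj from hp)]
      exact E.mk_tr _ _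
  have hb : ∀ p ∈ s, (⟨𝒢.src p.1, b p⟩ : E.Tot) = ⟨𝒢.tgt p.2.proj, S.ΔE p.2.proj p.2.snd⟩ :=
    fun p hp => by
      simp only [b, dif_pos (show 𝒢.src p.1 = 𝒢.tgt p.2.proj from hp)]
      exact E.mk_tr _ _
  have hc : ∀ p ∈ s, (⟨𝒢.tgt p.1, S.Ω p.1 p.2.proj p.2.snd⟩ : C.Tot) =
      ⟨𝒢.tgt (𝒢.mul p.1 p.2.proj), c p⟩ :=
    fun p hp => by
      simp only [c, dif_pos (show 𝒢.src p.1 = 𝒢.tgt p.2.proj from hp)]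
      exact (C.mk_tr _ _).symm
  have hmul : ∀ p ∈ s, (⟨𝒢.mul p.1 p.2.proj, h (𝒢.mul p.1 p.2.proj) (a p) -
      S.act (𝒢.mul p.1 p.2.proj) (c p)⟩ : Γ.Tot) =
      V.mul ⟨p.1, h p.1 (b p)⟩ ⟨p.2.proj, h p.2.proj p.2.snd⟩ := fun p hp => by
    simp only [a, b, c, dif_pos (show 𝒢.src p.1 = 𝒢.tgt p.2.proj from hp)]
    exact (S.Ω_eq p.1 p.2.proj hp p.2.snd).symm
  have hΔE : ContMDiffWithinAt (IG.prod (E.pullback 𝒢.src).TotI) E.TotI ∞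
      (fun p : G × (E.pullback 𝒢.src).Tot =>
        (⟨𝒢.tgt p.2.proj, S.ΔE p.2.proj p.2.snd⟩ : E.Tot)) s p :=
    (S.smooth_ΔE hV hh).contMDiffAt.comp_contMDiffWithinAt p contMDiffWithinAt_snd
  have hprod := (hV.isLie.contMDiffWithinAt_mul hp (fun q hq =>
    (hh.src_lift q.1 (b q)).trans ((hb q hq).trans (S.ΔE_eq _ _).symm))
    (hh.contMDiffWithinAt_lift h1 (hΔE.congr hb (hb p hp)))
    (hh.contMDiffWithinAt_lift h2 he)).congr hmul (hmul p hp)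
  -- Solving the defining relation for `act (Ω e)`: lift of the product minus product of the lifts,
  -- both smooth on composable pairs.
  have hact := ContMDiffWithinAt.fiber_sub Γ
    (hh.contMDiffWithinAt_lift hm (he.congr ha (ha p hp))) hprod
  simp only [sub_sub_cancel] at hact
  exact (S.contMDiffWithinAt_of_act hV hk hp hm hact).congr hc (hc p hp)

/-- The representation up to homotopy of a VB-groupoid with horizontal lift. -/
def toRuth : Ruth 𝒢 E C where
  ΔC := S.ΔC
  ΔE := S.ΔE
  bd := S.bd
  Ω := S.Ω
  Ω_off := S.Ω_off
  smooth_ΔC := S.smooth_ΔC hV hh hk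
  smooth_ΔE := S.smooth_ΔE hV hh
  smooth_bd := S.smooth_bd hV hk
  smooth_Ω := S.smooth_Ω hV hh hk
  -- Over a unit arrow the lift is a unit of `Γ`, so the defining product `h(∂ c) · c` is just `c`.
  unital_ΔC x c := by
    obtain ⟨c, rfl⟩ := (C.tr (𝒢.src_one x).symm).surjective c
    have h1 := S.ΔC_eq (𝒢.one x) (C.tr (𝒢.src_one x).symm c)
    have h2 := hh.lift_one x (S.bd _ (C.tr (𝒢.src_one x).symm c))
    have h3 := S.bd_eq (𝒢.src (𝒢.one x)) (C.tr (𝒢.src_one x).symm c)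
    rw [h2, ← h3, hV.isLie.one_mul, core_mk_tr,
      S.act_one hV hk, Γ.mk_inj] at h1
    have h4 := hk.injective _ h1
    rw [eq_comm, SmoothVectorBundle.tr_eq_iff] at h4
    rw [h4]; simp
  unital_ΔE x e := by
    have h1 := S.ΔE_eq (𝒢.one x) e
    rw [hh.lift_one, hV.isLie.tgt_one, E.mk_eq_mk_iff] at h1
    exact h1.choose_spec
  normalized_left g := by
    ext e
    have h1 := S.Ω_eq _ g (𝒢.src_one (𝒢.tgt g)) e
    have h2 := hh.lift_one (𝒢.tgt g) (E.tr (𝒢.src_one (𝒢.tgt g)).symm (S.ΔE g e))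
    rw [E.mk_tr, ← S.ΔE_eq] at h2
    rw [h2, hV.isLie.one_mul] at h1
    -- Adding `act g 0` puts both sides in split form; comparing core components gives `Ω = 0`.
    have h3 : (⟨g, S.act g 0 + h g e⟩ : Γ.Tot) = ⟨𝒢.mul (𝒢.one (𝒢.tgt g)) g,
      S.act _ (-(C.tr (𝒢.tgt_mul (𝒢.src_one (𝒢.tgt g))).symm (S.Ω (𝒢.one (𝒢.tgt g)) g e))) +
        h (𝒢.mul (𝒢.one (𝒢.tgt g)) g) (E.tr (𝒢.src_mul (𝒢.src_one (𝒢.tgt g))).symm e)⟩ := by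
      rw [map_zero, zero_add, map_neg, neg_add_eq_sub]; exact h1
    obtain ⟨_, h4, -⟩ := S.split_inj hV hh hk h3
    rw [map_zero, neg_eq_zero] at h4
    exact (map_eq_zero_iff _ (C.tr _).injective).1 h4
  normalized_right g := by
    ext e
    have H := (𝒢.tgt_one (𝒢.src g)).symm
    have h1 := S.Ω_eq g _ H e
    have h2 := S.ΔE_eq (𝒢.one (𝒢.src g)) e
    rw [hh.lift_one, hV.isLie.tgt_one, E.mk_eq_mk_iff] at h2
    have h5 : V.mul ⟨g, h g (E.tr H.symm (S.ΔE (𝒢.one (𝒢.src g)) e))⟩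
        ⟨𝒢.one (𝒢.src g), h (𝒢.one (𝒢.src g)) e⟩ =
        ⟨g, h g (E.tr H.symm (S.ΔE (𝒢.one (𝒢.src g)) e))⟩ := by
      have h6 : V.src ⟨g, h g (E.tr H.symm (S.ΔE (𝒢.one (𝒢.src g)) e))⟩ =
          ⟨𝒢.src (𝒢.one (𝒢.src g)), e⟩ := by
        rw [hh.src_lift, h2.choose_spec, E.tr_tr, E.mk_tr]
      rw [hh.lift_one, ← h6, hV.isLie.mul_one]
    rw [h5] at h1
    have h3 : (⟨g, S.act g 0 + h g (E.tr H.symm (S.ΔE (𝒢.one (𝒢.src g)) e))⟩ : Γ.Tot) =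
      ⟨𝒢.mul g (𝒢.one (𝒢.src g)),
      S.act _ (-(C.tr (𝒢.tgt_mul H).symm (S.Ω g (𝒢.one (𝒢.src g)) e))) +
        h _ (E.tr (𝒢.src_mul H).symm e)⟩ := by
      rw [map_zero, zero_add, map_neg, neg_add_eq_sub]; exact h1
    obtain ⟨_, h4, -⟩ := S.split_inj hV hh hk h3
    rw [map_zero, neg_eq_zero] at h4
    exact (map_eq_zero_iff _ (C.tr _).injective).1 h4
  eq_one g c := by
    have h1 : V.src ⟨g, h g (S.bd (𝒢.src g) c)⟩ =
        V.tgt ⟨𝒢.one (𝒢.src g), k (𝒢.src g) c⟩ := by rw [hh.src_lift, S.bd_eq]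
    -- The target of `h_g(∂ c) · c`, computed as the target of its first factor and as that of `act
    -- (Δ^C c)`.
    have h2 := hV.isLie.tgt_mul h1
    rw [S.ΔC_eq, S.tgt_act hV hk, S.ΔE_eq, E.mk_inj] at h2
    rw [h2, sub_self]
  eq_two g₁ g₂ H c := by
    -- The third arrow is taken to be the unit at `s(g₂)`, so that `c` may be any core element over
    -- `s(g₂)`.
    have K : 𝒢.src g₂ = 𝒢.tgt (𝒢.one (𝒢.src g₂)) := (𝒢.tgt_one _).symm
    have h1 := S.assoc_formula hV hh hk H K (C.tr K c) 0
    simp only [map_zero, add_zero, sub_zero, SmoothVectorBundle.tr_tr, S.bd_tr,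
      SmoothVectorBundle.tr_rfl] at h1
    rw [← h1]; abel
  eq_three g₁ g₂ H e := by
    have h1 : V.src ⟨g₁, h g₁ (E.tr H.symm (S.ΔE g₂ e))⟩ = V.tgt ⟨g₂, h g₂ e⟩ := by
      rw [hh.src_lift, S.ΔE_eq, E.mk_tr]
    have h2 := hV.isLie.tgt_mul h1
    have h3 := S.ΔE_eq (𝒢.mul g₁ g₂) (E.tr (𝒢.src_mul H).symm e)
    have h4 := S.tgt_act hV hk (𝒢.mul g₁ g₂) (C.tr (𝒢.tgt_mul H).symm (S.Ω g₁ g₂ e))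
    rw [hV.tgt_mk, E.mk_inj] at h3 h4
    rw [S.Ω_eq g₁ g₂ H e, S.ΔE_eq, hV.tgt_mk, map_sub, h3, h4, S.bd_tr, E.mk_eq_mk_iff] at h2
    obtain ⟨_, h5⟩ := h2
    rw [h5]
    simp
  eq_four g₁ g₂ g₃ H K e := by
    have h1 := S.assoc_formula hV hh hk H K 0 e
    simp only [map_zero, zero_add, zero_sub, add_zero] at h1
    rw [← sub_eq_zero] at h1
    rw [← h1]
    abel

theorem isComponents_toRuth : IsComponents 𝒢 V h k (S.toRuth hV hh hk) where
  bd_eq x c := (S.bd_eq x c).symm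
  ΔE_eq g e := (S.ΔE_eq g e).symm
  ΔC_eq g c := by
    change _ = V.mul (V.mul ⟨g, h g (S.bd (𝒢.src g) c)⟩ _) _
    rw [S.ΔC_eq, S.mul_act_inv]
    rfl
  Ω_eq g₁ g₂ H e w hw := by
    have h1 := (S.Ω_eq g₁ g₂ H e).symm.trans hw
    rw [Γ.mk_inj] at h1
    rw [← h1, sub_sub_cancel, S.mul_act_inv, core_mk_tr]
    rfl

/-- The formulas for `∂` and `Δ^E` are explicit; once these agree, the formulas for `Δ^C` and `Ω`
have the same right-hand sides and `k` is injective. Off composable pairs uniqueness rests on the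
convention `Ω_off`. -/
theorem eq_toRuth {D : Ruth 𝒢 E C} (hD : IsComponents 𝒢 V h k D) : D = S.toRuth hV hh hk := by
  have hS := S.isComponents_toRuth hV hh hk
  have hbd : D.bd = S.bd := by
    funext x; ext c
    exact E.mk_inj.1 ((hD.bd_eq x c).trans (hS.bd_eq x c).symm)
  have hΔE : D.ΔE = S.ΔE := by
    funext g; ext e
    exact E.mk_inj.1 ((hD.ΔE_eq g e).trans (hS.ΔE_eq g e).symm)
  refine Ruth.ext_of ?_ hΔE hbd ?_
  · funext g; ext c
    have h1 := hD.ΔC_eq g c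
    rw [hbd] at h1
    exact hk.injective _ (Γ.mk_inj.1 (h1.trans (hS.ΔC_eq g c).symm))
  · funext g₁ g₂
    by_cases H : 𝒢.src g₁ = 𝒢.tgt g₂
    · ext e
      have h1 := hD.Ω_eq g₁ g₂ H e _ (by rw [hΔE]; exact S.Ω_eq g₁ g₂ H e)
      have h2 := hS.Ω_eq g₁ g₂ H e _ (S.Ω_eq g₁ g₂ H e)
      exact hk.injective _ (Γ.mk_inj.1 (h1.trans h2.symm))
    · rw [D.Ω_off _ _ H]
      exact (S.Ω_off _ _ H).symm

end

end SplitData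

end SplittingRuth

/-! ### Isomorphisms preserving the horizontal lift -/

section Isomorphisms

variable {EM : Type*} [NormedAddCommGroup EM] [NormedSpace ℝ EM] {HM : Type*} [TopologicalSpace HM]
  {IM : ModelWithCorners ℝ EM HM} {M : Type*} [TopologicalSpace M] [ChartedSpace HM M]
  {EG : Type*} [NormedAddCommGroup EG] [NormedSpace ℝ EG] {HG : Type*} [TopologicalSpace HG]
  {IG : ModelWithCorners ℝ EG HG} {G : Type*} [TopologicalSpace G] [ChartedSpace HG G]
  [IsManifold IG ∞ G]
  {𝒢 : LieGroupoid IM M IG G} {E C C' : SmoothVectorBundle IM M} {Γ : SmoothVectorBundle IG G}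
  {V : GroupoidData E.Tot Γ.Tot}
  {h : ∀ g : G, E.Fiber (𝒢.src g) →ₗ[ℝ] Γ.Fiber g}
  {k : ∀ x : M, C.Fiber x →ₗ[ℝ] Γ.Fiber (𝒢.one x)}

namespace SplitData

variable (S : SplitData 𝒢 V h k)
  (hV : IsVBGroupoid 𝒢 E Γ V) (hh : IsHorizontalLift 𝒢 V h) (hk : IsCore 𝒢 V C k)
include hV hh hk

/-- The isomorphism of VB-groupoids `(c, g, e) ↦ c · 0_g + h_g(e)`. -/
theorem exists_liftedIso : ∃ Φ : ∀ g : G, (𝒢.split C E).Fiber g ≃ₗ[ℝ] Γ.Fiber g,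
    IsLiftedIso 𝒢 (S.toRuth hV hh hk).groupoid (𝒢.splitLift C E) V h Φ ∧
    ∀ g (c : C.Fiber (𝒢.tgt g)) (e : E.Fiber (𝒢.src g)), Φ g (c, e) = S.act g c + h g e := by
  have src_split : ∀ g c e, V.src ⟨g, S.act g c + h g e⟩ = ⟨𝒢.src g, e⟩ := fun g c e => by
    have h1 := S.src_act hV hk g c
    have h2 := hh.src_lift g e
    rw [hV.src_mk, E.mk_inj] at h1 h2 ⊢
    rw [map_add, h1, h2, zero_add]
  have tgt_split : ∀ g c e, V.tgt ⟨g, S.act g c + h g e⟩ =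
      ⟨𝒢.tgt g, S.bd (𝒢.tgt g) c + S.ΔE g e⟩ := fun g c e => by
    have h1 := S.tgt_act hV hk g c
    have h2 := S.ΔE_eq g e
    rw [hV.tgt_mk, E.mk_inj] at h1 h2 ⊢
    rw [map_add, h1, h2]
  let L : ∀ g : G, (C.Fiber (𝒢.tgt g) × E.Fiber (𝒢.src g)) →ₗ[ℝ] Γ.Fiber g :=
    fun g => (S.act g).coprod (h g)
  have hL : ∀ g, Function.Bijective (L g) := by
    refine fun g => ⟨?_, fun v => ?_⟩
    · rintro ⟨c, e⟩ ⟨c', e'⟩ H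
      have H' : (⟨g, S.act g c + h g e⟩ : Γ.Tot) = ⟨g, S.act g c' + h g e'⟩ := Γ.mk_inj.2 H
      obtain ⟨_, rfl, rfl⟩ := S.split_inj hV hh hk H'
      rfl
    · have h1 : V.src ⟨g, v - h g (hV.srcL g v)⟩ = ⟨𝒢.src g, 0⟩ := by
        have h2 := hh.src_lift g (hV.srcL g v)
        rw [hV.src_mk, E.mk_inj] at h2 ⊢
        rw [map_sub, h2, sub_self]
      obtain ⟨c, hc⟩ := S.act_surj g _ h1
      refine ⟨(c, hV.srcL g v), ?_⟩
      exact (congrArg (· + h g (hV.srcL g v)) hc).trans (sub_add_cancel _ _)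
  let Φ : ∀ g : G, (𝒢.split C E).Fiber g ≃ₗ[ℝ] Γ.Fiber g := fun g =>
    LinearEquiv.ofBijective (L g) (hL g)
  have hΦ : ∀ g (c : C.Fiber (𝒢.tgt g)) (e : E.Fiber (𝒢.src g)),
      Φ g (c, e) = S.act g c + h g e := fun g c e => rfl
  have hsrcΦ : ∀ g v, hV.srcL g v = ((Φ g).symm v).2 := fun g v => by
    obtain ⟨p, rfl⟩ := (Φ g).surjective v
    rw [LinearEquiv.symm_apply_apply]
    exact E.mk_inj.1 ((hV.src_mk g _).symm.trans (src_split g p.1 p.2))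
  refine ⟨Φ, ?_, hΦ⟩
  refine { smooth := ?_, smooth_symm := ?_, map_src := ?_, map_tgt := ?_, map_mul := ?_,
           map_lift := ?_ }
  · intro γ
    rw [← contMDiffWithinAt_univ]
    exact ContMDiffWithinAt.fiber_add Γ
      (S.contMDiffWithinAt_act hV hk (Set.mem_univ γ) 𝒢.contMDiff_split_proj.contMDiffAt
        𝒢.contMDiff_coreC.contMDiffAt)
      (hh.contMDiffWithinAt_lift 𝒢.contMDiff_split_proj.contMDiffAt
        𝒢.contMDiff_sideE.contMDiffAt)
  · intro γ
    rw [← contMDiffWithinAt_univ]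
    have hp : ContMDiffWithinAt Γ.TotI IG ∞ (fun γ : Γ.Tot => γ.proj) Set.univ γ :=
      (contMDiff_proj Γ.Fiber).contMDiffAt
    have hs : ContMDiffWithinAt Γ.TotI E.TotI ∞
        (fun γ : Γ.Tot => (⟨𝒢.src γ.proj, ((Φ γ.proj).symm γ.snd).2⟩ : E.Tot)) Set.univ γ := by
      refine ContMDiffWithinAt.congr (f := V.src) hV.isLie.contMDiff_src.contMDiffAt
        (fun γ _ => ?_) ?_
      · rw [hV.src_mk, hsrcΦ]
      · rw [hV.src_mk, hsrcΦ]
    refine 𝒢.contMDiffWithinAt_elt (C := C) (E := E) (g := fun γ : Γ.Tot => γ.proj)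
      (c := fun γ => ((Φ γ.proj).symm γ.snd).1) (e := fun γ => ((Φ γ.proj).symm γ.snd).2) hp ?_ hs
    refine S.contMDiffWithinAt_of_act hV hk (Set.mem_univ γ) hp
      (c := fun γ : Γ.Tot => ((Φ γ.proj).symm γ.snd).1) ?_
    -- The core part of the inverse is seen through `act`, where it is the smooth expression `v -
    -- h(s̃ v)`.
    have h1 := ContMDiffWithinAt.fiber_sub Γ (v := fun γ : Γ.Tot => γ.snd)
      (w := fun γ : Γ.Tot => h γ.proj ((Φ γ.proj).symm γ.snd).2)
      (contMDiff_id.contMDiffAt.contMDiffWithinAt) (hh.contMDiffWithinAt_lift hp hs)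
    have h2 : ∀ γ : Γ.Tot, γ.snd - h γ.proj ((Φ γ.proj).symm γ.snd).2 =
        S.act γ.proj ((Φ γ.proj).symm γ.snd).1 := fun γ => by
      rw [sub_eq_iff_eq_add]
      exact ((Φ γ.proj).apply_symm_apply γ.snd).symm
    simp only [h2] at h1
    exact h1
  · intro γ
    obtain ⟨g, c, e, rfl⟩ := Ruth.exists_elt γ
    exact src_split g c e
  · intro γ
    obtain ⟨g, c, e, rfl⟩ := Ruth.exists_elt γ
    exact tgt_split g c e
  · intro γ₁ γ₂ hγ
    obtain ⟨g₁, c₁, e₁, rfl⟩ := Ruth.exists_elt γ₁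
    obtain ⟨g₂, c₂, e₂, rfl⟩ := Ruth.exists_elt γ₂
    obtain ⟨H, rfl⟩ := (Ruth.composable_iff _).1 hγ
    rw [Ruth.groupoid_mul _ H]
    exact S.mul_formula hV hh hk H c₁ c₂ e₂
  · intro g e
    refine (hΦ g 0 e).trans ?_
    rw [map_zero, zero_add]

end SplitData

namespace Ruth

/-- An isomorphism of representations up to homotopy gives an isomorphism of VB-groupoids. -/
theorem isLiftedIso_of_isRuthIso {D : Ruth 𝒢 E C} {D' : Ruth 𝒢 E C'}
    {φ : ∀ x : M, C.Fiber x ≃ₗ[ℝ] C'.Fiber x} (hφ : IsRuthIso D D' φ)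
    {Φ : ∀ g : G, (𝒢.split C E).Fiber g ≃ₗ[ℝ] (𝒢.split C' E).Fiber g}
    (hΦ : ∀ g (c : C.Fiber (𝒢.tgt g)) (e : E.Fiber (𝒢.src g)), Φ g (c, e) = (φ (𝒢.tgt g) c, e)) :
    IsLiftedIso 𝒢 D.groupoid (𝒢.splitLift C E) D'.groupoid (𝒢.splitLift C' E) Φ := by
  have hΦ' : ∀ g (c : C.Fiber (𝒢.tgt g)) (e : E.Fiber (𝒢.src g)),
      (⟨g, Φ g (c, e)⟩ : (𝒢.split C' E).Tot) = 𝒢.elt C' E g (φ (𝒢.tgt g) c) e := fun g c e =>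
    congrArg (TotalSpace.mk g) (hΦ g c e)
  have hΦs : ∀ g (c : C'.Fiber (𝒢.tgt g)) (e : E.Fiber (𝒢.src g)),
      (Φ g).symm (c, e) = ((φ (𝒢.tgt g)).symm c, e) := fun g c e => by
    have h1 := hΦ g ((φ (𝒢.tgt g)).symm c) e
    have h2 : ((φ (𝒢.tgt g) ((φ (𝒢.tgt g)).symm c), e) : C'.Fiber (𝒢.tgt g) × E.Fiber (𝒢.src g)) =
        (c, e) := by rw [LinearEquiv.apply_symm_apply]
    exact (Φ g).symm_apply_eq.2 (h1.trans h2).symm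
  have φ_tr : ∀ {x y : M} (H : x = y) (c : C.Fiber x), φ y (C.tr H c) = C'.tr H (φ x c) := by
    intro x y H c; subst H; rfl
  refine { smooth := ?_, smooth_symm := ?_, map_src := ?_, map_tgt := ?_, map_mul := ?_,
           map_lift := ?_ }
  · intro γ
    rw [← contMDiffWithinAt_univ]
    refine ContMDiffWithinAt.congr (f := fun γ : (𝒢.split C E).Tot =>
      𝒢.elt C' E γ.proj (φ (𝒢.tgt γ.proj) (𝒢.coreC γ)) (𝒢.sideE γ)) ?_
      (fun γ _ => hΦ' γ.proj (𝒢.coreC γ) (𝒢.sideE γ)) (hΦ' γ.proj (𝒢.coreC γ) (𝒢.sideE γ))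
    exact 𝒢.contMDiffWithinAt_elt 𝒢.contMDiff_split_proj.contMDiffAt
      (hφ.smooth.comp_within 𝒢.contMDiff_coreC.contMDiffAt) 𝒢.contMDiff_sideE.contMDiffAt
  · intro γ
    rw [← contMDiffWithinAt_univ]
    refine ContMDiffWithinAt.congr (f := fun γ : (𝒢.split C' E).Tot =>
      𝒢.elt C E γ.proj ((φ (𝒢.tgt γ.proj)).symm (𝒢.coreC γ)) (𝒢.sideE γ)) ?_
      (fun γ _ => congrArg (TotalSpace.mk γ.proj) (hΦs γ.proj (𝒢.coreC γ) (𝒢.sideE γ)))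
      (congrArg (TotalSpace.mk γ.proj) (hΦs γ.proj (𝒢.coreC γ) (𝒢.sideE γ)))
    exact 𝒢.contMDiffWithinAt_elt 𝒢.contMDiff_split_proj.contMDiffAt
      (hφ.smooth_symm.comp_within 𝒢.contMDiff_coreC.contMDiffAt) 𝒢.contMDiff_sideE.contMDiffAt
  · intro γ
    obtain ⟨g, c, e, rfl⟩ := exists_elt γ
    exact congrArg D'.groupoid.src (hΦ' g c e)
  · intro γ
    obtain ⟨g, c, e, rfl⟩ := exists_elt γ
    refine (congrArg D'.groupoid.tgt (hΦ' g c e)).trans ?_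
    rw [groupoid_tgt, groupoid_tgt, hφ.map_bd, hφ.map_ΔE]
  · intro γ₁ γ₂ hγ
    obtain ⟨g₁, c₁, e₁, rfl⟩ := exists_elt γ₁
    obtain ⟨g₂, c₂, e₂, rfl⟩ := exists_elt γ₂
    obtain ⟨H, -⟩ := D.composable_iff.1 hγ
    refine (congrArg₂ D'.groupoid.mul (hΦ' g₁ c₁ e₁) (hΦ' g₂ c₂ e₂)).trans ?_
    rw [D.groupoid_mul H, D'.groupoid_mul H]
    refine Eq.trans ?_ (hΦ' (𝒢.mul g₁ g₂) _ _).symm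
    have h1 : φ (𝒢.tgt (𝒢.mul g₁ g₂)) (C.tr (𝒢.tgt_mul H).symm
        (c₁ + D.ΔC g₁ (C.tr H.symm c₂) - D.Ω g₁ g₂ e₂)) = C'.tr (𝒢.tgt_mul H).symm
        (φ (𝒢.tgt g₁) c₁ + D'.ΔC g₁ (C'.tr H.symm (φ (𝒢.tgt g₂) c₂)) - D'.Ω g₁ g₂ e₂) := by
      simp only [φ_tr, map_sub, map_add, hφ.map_ΔC, hφ.map_Ω _ _ _ H]
    rw [h1]
  · intro g e
    refine (hΦ g 0 e).trans ?_
    rw [map_zero]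
    rfl

/-- Every isomorphism of VB-groupoids that preserves the horizontal lifts is induced by an
isomorphism of representations up to homotopy. -/
theorem exists_isRuthIso_of_isLiftedIso {D : Ruth 𝒢 E C} {D' : Ruth 𝒢 E C'}
    {Φ : ∀ g : G, (𝒢.split C E).Fiber g ≃ₗ[ℝ] (𝒢.split C' E).Fiber g}
    (hΦ : IsLiftedIso 𝒢 D.groupoid (𝒢.splitLift C E) D'.groupoid (𝒢.splitLift C' E) Φ) :
    ∃ φ : ∀ x : M, C.Fiber x ≃ₗ[ℝ] C'.Fiber x, IsRuthIso D D' φ ∧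
      ∀ g (c : C.Fiber (𝒢.tgt g)) (e : E.Fiber (𝒢.src g)), Φ g (c, e) = (φ (𝒢.tgt g) c, e) := by
  -- `ψ g` and `ψ' g` are the core-to-core blocks of `Φ` and its inverse; a priori they depend on
  -- the whole arrow `g`.
  let ψ : ∀ g : G, C.Fiber (𝒢.tgt g) →ₗ[ℝ] C'.Fiber (𝒢.tgt g) := fun g =>
    LinearMap.fst ℝ (C'.Fiber (𝒢.tgt g)) (E.Fiber (𝒢.src g)) ∘ₗ (Φ g).toLinearMap ∘ₗ
      LinearMap.inl ℝ (C.Fiber (𝒢.tgt g)) (E.Fiber (𝒢.src g))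
  let ψ' : ∀ g : G, C'.Fiber (𝒢.tgt g) →ₗ[ℝ] C.Fiber (𝒢.tgt g) := fun g =>
    LinearMap.fst ℝ (C.Fiber (𝒢.tgt g)) (E.Fiber (𝒢.src g)) ∘ₗ (Φ g).symm.toLinearMap ∘ₗ
      LinearMap.inl ℝ (C'.Fiber (𝒢.tgt g)) (E.Fiber (𝒢.src g))
  have hsnd : ∀ g (v : (𝒢.split C E).Fiber g), (Φ g v).2 = v.2 := fun g v =>
    E.mk_inj.1 (hΦ.map_src ⟨g, v⟩)
  let pr : ∀ g, C.Fiber (𝒢.tgt g) → E.Fiber (𝒢.src g) → (𝒢.split C E).Fiber g :=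
    fun g c e => (c, e)
  let pr' : ∀ g, C'.Fiber (𝒢.tgt g) → E.Fiber (𝒢.src g) → (𝒢.split C' E).Fiber g :=
    fun g c e => (c, e)
  have hcore : ∀ g c, Φ g (pr g c 0) = pr' g (ψ g c) 0 := fun g c => Prod.ext rfl (hsnd g _)
  -- Preservation of sources fixes the `E` component, and preservation of lifts kills the block from
  -- `E` to `C'`.
  have hΦψ : ∀ g c e, Φ g (pr g c e) = pr' g (ψ g c) e := fun g c e => by
    have h1 : pr g c e = pr g c 0 + 𝒢.splitLift C E g e :=
      Prod.ext (add_zero c).symm (zero_add e).symm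
    rw [h1, map_add, hΦ.map_lift, hcore]
    exact Prod.ext (add_zero (ψ g c)) (zero_add e)
  have hcore' : ∀ g c, (Φ g).symm (pr' g c 0) = pr g (ψ' g c) 0 := fun g c => by
    refine Prod.ext rfl ?_
    have h1 := hsnd g ((Φ g).symm (pr' g c 0))
    rw [LinearEquiv.apply_symm_apply] at h1
    exact h1.symm
  have hψψ' : ∀ g c, ψ g (ψ' g c) = c := fun g c => by
    have h1 := hcore g (ψ' g c)
    rw [← hcore', LinearEquiv.apply_symm_apply] at h1
    exact (congrArg Prod.fst h1).symm
  have hψ'ψ : ∀ g c, ψ' g (ψ g c) = c := fun g c => by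
    have h1 := hcore' g (ψ g c)
    rw [← hcore, LinearEquiv.symm_apply_apply] at h1
    exact (congrArg Prod.fst h1).symm
  have hΦ' : ∀ g (c : C.Fiber (𝒢.tgt g)) (e : E.Fiber (𝒢.src g)),
      (⟨g, Φ g (c, e)⟩ : (𝒢.split C' E).Tot) = 𝒢.elt C' E g (ψ g c) e := fun g c e =>
    congrArg (TotalSpace.mk g) (hΦψ g c e)
  -- The core component of multiplicativity; its specializations give the dependence on `t(g)` alone
  -- and compatibility with `Δ^C` and `Ω`.
  have hmul : ∀ {g₁ g₂ : G} (H : 𝒢.src g₁ = 𝒢.tgt g₂) (c₁ : C.Fiber (𝒢.tgt g₁))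
      (c₂ : C.Fiber (𝒢.tgt g₂)) (e₂ : E.Fiber (𝒢.src g₂)),
      ψ (𝒢.mul g₁ g₂) (C.tr (𝒢.tgt_mul H).symm
        (c₁ + D.ΔC g₁ (C.tr H.symm c₂) - D.Ω g₁ g₂ e₂)) =
      C'.tr (𝒢.tgt_mul H).symm
        (ψ g₁ c₁ + D'.ΔC g₁ (C'.tr H.symm (ψ g₂ c₂)) - D'.Ω g₁ g₂ e₂) := by
    intro g₁ g₂ H c₁ c₂ e₂
    have h1 := hΦ.map_mul (𝒢.elt C E g₁ c₁ (E.tr H.symm (D.bd (𝒢.tgt g₂) c₂ + D.ΔE g₂ e₂)))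
      (𝒢.elt C E g₂ c₂ e₂) (D.composable_iff.2 ⟨H, rfl⟩)
    rw [D.groupoid_mul H] at h1
    have h2 := (congrArg₂ D'.groupoid.mul (hΦ' g₁ c₁ _) (hΦ' g₂ c₂ e₂)).symm.trans
      (h1.trans (hΦ' (𝒢.mul g₁ g₂) _ _))
    rw [D'.groupoid_mul H, 𝒢.elt_eq_elt_iff] at h2
    exact h2.choose_spec.1
  let φ : ∀ x : M, C.Fiber x ≃ₗ[ℝ] C'.Fiber x := fun x =>
    LinearEquiv.ofLinearMap
      ((C'.tr (𝒢.tgt_one x)).toLinearMap ∘ₗ ψ (𝒢.one x) ∘ₗ (C.tr (𝒢.tgt_one x).symm).toLinearMap)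
      ((C.tr (𝒢.tgt_one x)).toLinearMap ∘ₗ ψ' (𝒢.one x) ∘ₗ (C'.tr (𝒢.tgt_one x).symm).toLinearMap)
      (by ext c; simp [hψψ']) (by ext c; simp [hψ'ψ])
  have hφdef : ∀ x c, φ x c = C'.tr (𝒢.tgt_one x) (ψ (𝒢.one x) (C.tr (𝒢.tgt_one x).symm c)) :=
    fun _ _ => rfl
  have ψ_congr : ∀ {g g' : G} (H : g = g') (c : C.Fiber (𝒢.tgt g)),
      ψ g' (C.tr (congrArg 𝒢.tgt H) c) = C'.tr (congrArg 𝒢.tgt H) (ψ g c) := by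
    intro g g' H c; subst H; rfl
  have φ_tr : ∀ {x y : M} (H : x = y) (c : C.Fiber x), φ y (C.tr H c) = C'.tr H (φ x c) := by
    intro x y H c; subst H; rfl
  -- Take the product of `(c, 1_{t(g)}, 0)` with the zero over `g`: the block over `g` equals the
  -- one over the unit at `t(g)`.
  have hψφ : ∀ g c, ψ g c = φ (𝒢.tgt g) c := fun g c => by
    have H := 𝒢.src_one (𝒢.tgt g)
    have h1 := hmul H (C.tr (𝒢.tgt_one (𝒢.tgt g)).symm c) 0 0
    simp only [map_zero, add_zero, sub_zero, SmoothVectorBundle.tr_tr] at h1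
    have h2 := ψ_congr (𝒢.one_mul g).symm c
    rw [h2, SmoothVectorBundle.tr_eq_iff, SmoothVectorBundle.tr_tr] at h1
    rw [h1, hφdef]
  refine ⟨φ, ?_, fun g c e => (hΦψ g c e).trans (by rw [hψφ]; rfl)⟩
  have hone : ∀ p : C.Tot,
      ContMDiffWithinAt C.TotI IG ∞ (fun p : C.Tot => 𝒢.one p.proj) Set.univ p := fun p =>
    (𝒢.isLie.contMDiff_one.comp (contMDiff_proj _)).contMDiffAt
  have hone' : ∀ p : C'.Tot,
      ContMDiffWithinAt C'.TotI IG ∞ (fun p : C'.Tot => 𝒢.one p.proj) Set.univ p := fun p =>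
    (𝒢.isLie.contMDiff_one.comp (contMDiff_proj _)).contMDiffAt
  refine { smooth := ?_, smooth_symm := ?_, map_ΔC := ?_, map_ΔE := ?_, map_bd := ?_,
           map_Ω := ?_ }
  · intro p
    rw [← contMDiffWithinAt_univ]
    have h1 : ContMDiffWithinAt C.TotI (𝒢.split C E).TotI ∞ (fun p : C.Tot =>
        𝒢.elt C E (𝒢.one p.proj) (C.tr (𝒢.tgt_one p.proj).symm p.snd) 0) Set.univ p := by
      refine 𝒢.contMDiffWithinAt_elt (hone p) ?_ (ContMDiffWithinAt.fiber_zero E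
        (𝒢.src.contMDiff.contMDiffAt.comp_contMDiffWithinAt p (hone p)))
      simp only [C.mk_tr]
      exact contMDiffAt_id
    have h2 := 𝒢.contMDiff_coreC.contMDiffAt.comp_contMDiffWithinAt p
      (hΦ.smooth.contMDiffAt.comp_contMDiffWithinAt p h1)
    refine h2.congr (fun p _ => ?_) ?_
    all_goals exact C'.mk_tr _ _
  · intro p
    rw [← contMDiffWithinAt_univ]
    have h1 : ContMDiffWithinAt C'.TotI (𝒢.split C' E).TotI ∞ (fun p : C'.Tot =>
        𝒢.elt C' E (𝒢.one p.proj) (C'.tr (𝒢.tgt_one p.proj).symm p.snd) 0) Set.univ p := by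
      refine 𝒢.contMDiffWithinAt_elt (hone' p) ?_ (ContMDiffWithinAt.fiber_zero E
        (𝒢.src.contMDiff.contMDiffAt.comp_contMDiffWithinAt p (hone' p)))
      simp only [C'.mk_tr]
      exact contMDiffAt_id
    have h2 := 𝒢.contMDiff_coreC.contMDiffAt.comp_contMDiffWithinAt p
      (hΦ.smooth_symm.contMDiffAt.comp_contMDiffWithinAt p h1)
    refine h2.congr (fun p _ => ?_) ?_
    all_goals exact C.mk_tr _ _
  · intro g c
    have H := (𝒢.tgt_one (𝒢.src g)).symm
    have h1 := hmul H 0 (C.tr H c) 0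
    simp only [map_zero, zero_add, sub_zero, SmoothVectorBundle.tr_tr, hψφ, φ_tr,
      SmoothVectorBundle.tr_rfl] at h1
    exact (C'.tr _).injective h1
  · intro g e
    have h1 := hΦ.map_tgt (𝒢.elt C E g 0 e)
    have h2 := ((congrArg D'.groupoid.tgt (hΦ' g 0 e)).symm.trans h1).symm
    rw [groupoid_tgt, groupoid_tgt, E.mk_inj] at h2
    simpa using h2
  · intro x c
    have h1 := hΦ.map_tgt (𝒢.elt C E (𝒢.one x) (C.tr (𝒢.tgt_one x).symm c) 0)
    have h2 := ((congrArg D'.groupoid.tgt (hΦ' _ (C.tr (𝒢.tgt_one x).symm c) 0)).symm.trans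
      h1).symm
    rw [groupoid_tgt, groupoid_tgt, E.mk_inj, hψφ, φ_tr, D.bd_tr, D'.bd_tr] at h2
    simp only [map_zero, add_zero] at h2
    exact (E.tr _).injective h2
  · intro g₁ g₂ e H
    have h1 := hmul H 0 0 e
    simp only [map_zero, zero_add, zero_sub, map_neg, hψφ, φ_tr, neg_inj] at h1
    exact (C'.tr _).injective h1

end Ruth

end Isomorphisms

/-! ## The image of a smooth projection of constant rank -/

namespace SmoothVectorBundle

section Projection

open Filter Topology

variable {EB : Type*} [NormedAddCommGroup EB] [NormedSpace ℝ EB] {HB : Type*} [TopologicalSpace HB]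
  {IB : ModelWithCorners ℝ EB HB} {B : Type*} [TopologicalSpace B] [ChartedSpace HB B]
  {EN : Type*} [NormedAddCommGroup EN] [NormedSpace ℝ EN] {HN : Type*} [TopologicalSpace HN]
  {J : ModelWithCorners ℝ EN HN} {N : Type*} [TopologicalSpace N] [ChartedSpace HN N]

theorem contMDiffWithinAt_symm (W : SmoothVectorBundle IB B) (x₀ : B) {b : N → B}
    {w : N → W.Model} {s : Set N} {x : N} (hb : ContMDiffWithinAt J IB ∞ b s x)
    (hw : ContMDiffWithinAt J 𝓘(ℝ, W.Model) ∞ w s x)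
    (hx : b x ∈ (trivializationAt W.Model W.Fiber x₀).baseSet) :
    ContMDiffWithinAt J W.TotI ∞ (fun n => (⟨b n,
      (trivializationAt W.Model W.Fiber x₀).symmₗ ℝ (b n) (w n)⟩ : W.Tot)) s x := by
  set e := trivializationAt W.Model W.Fiber x₀
  refine (e.contMDiffWithinAt_iff (by simpa [e.mem_source] using hx)).2 ⟨hb, ?_⟩
  have key : ∀ n, b n ∈ e.baseSet → (e ⟨b n, e.symmₗ ℝ (b n) (w n)⟩).2 = w n := fun n hn => by
    rw [e.symmₗ_apply hn, e.apply_mk_symm hn]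
  exact hw.congr_of_eventuallyEq
    (Filter.mem_of_superset (hb.continuousWithinAt (e.open_baseSet.mem_nhds hx)) key) (key x hx)

theorem contMDiffWithinAt_linearMapAt (W : SmoothVectorBundle IB B) (x₀ : B) {b : N → B}
    {v : ∀ n, W.Fiber (b n)} {s : Set N} {x : N}
    (hv : ContMDiffWithinAt J W.TotI ∞ (fun n => (⟨b n, v n⟩ : W.Tot)) s x)
    (hx : b x ∈ (trivializationAt W.Model W.Fiber x₀).baseSet) :
    ContMDiffWithinAt J 𝓘(ℝ, W.Model) ∞
      (fun n => (trivializationAt W.Model W.Fiber x₀).linearMapAt ℝ (b n) (v n)) s x := by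
  set e := trivializationAt W.Model W.Fiber x₀
  have h := (e.contMDiffWithinAt_iff (by simpa [e.mem_source] using hx)).1 hv
  have key : ∀ n, b n ∈ e.baseSet → e.linearMapAt ℝ (b n) (v n) = (e ⟨b n, v n⟩).2 :=
    fun n hn => by rw [e.coe_linearMapAt_of_mem hn]
  exact h.2.congr_of_eventuallyEq
    (Filter.mem_of_superset (h.1.continuousWithinAt (e.open_baseSet.mem_nhds hx)) key) (key x hx)

variable {W : SmoothVectorBundle.{u, v} IB B} (P : ∀ x, W.Fiber x →ₗ[ℝ] W.Fiber x)

/-- The image of the projection `P` in the fibre over `x`. -/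
def ProjFiber (x : B) : Type v := LinearMap.range (P x)

instance (x : B) : AddCommGroup (ProjFiber P x) :=
  inferInstanceAs (AddCommGroup (LinearMap.range (P x)))

instance (x : B) : Module ℝ (ProjFiber P x) :=
  inferInstanceAs (Module ℝ (LinearMap.range (P x)))

/-- The inclusion of the image of a projection. -/
def projIncl (x : B) : ProjFiber P x →ₗ[ℝ] W.Fiber x := (LinearMap.range (P x)).subtype

/-- The projection onto its image. -/
def projTo (x : B) : W.Fiber x →ₗ[ℝ] ProjFiber P x := (P x).rangeRestrict

theorem projIncl_injective (x : B) : Function.Injective (projIncl P x) :=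
  Subtype.val_injective

theorem exists_projIncl_eq_iff (x : B) (v : W.Fiber x) :
    (∃ c, projIncl P x c = v) ↔ ∃ w, P x w = v :=
  ⟨fun ⟨c, hc⟩ => c.2.imp fun _ hw => hw.trans hc, fun ⟨w, hw⟩ => ⟨projTo P x w, hw⟩⟩

variable {F : Type u} [NormedAddCommGroup F] [NormedSpace ℝ F] [FiniteDimensional ℝ F]
  (x₀ : B) (j : F →ₗ[ℝ] W.Model) (q : W.Model →ₗ[ℝ] F)

/-- The local frame of the image of `P` obtained by projecting constant sections. -/
noncomputable def projFrame (x : B) : F →ₗ[ℝ] ProjFiber P x :=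
  projTo P x ∘ₗ (trivializationAt W.Model W.Fiber x₀).symmₗ ℝ x ∘ₗ j

/-- Local coordinates on the image of `P`. -/
noncomputable def projCoord (x : B) : ProjFiber P x →ₗ[ℝ] F :=
  q ∘ₗ (trivializationAt W.Model W.Fiber x₀).linearMapAt ℝ x ∘ₗ projIncl P x

/-- The coordinates of the local frame. -/
noncomputable def projGram (x : B) : F →L[ℝ] F :=
  LinearMap.toContinuousLinearMap (projCoord P x₀ q x ∘ₗ projFrame P x₀ j x)

/-- The set of points where the coordinates and the frame are nondegenerate. -/
noncomputable def projBase : Set B :=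
  (trivializationAt W.Model W.Fiber x₀).baseSet ∩
    projGram P x₀ j q ⁻¹' {T | T.IsInvertible}

theorem projGram_apply (x : B) (w : F) :
    projGram P x₀ j q x w = projCoord P x₀ q x (projFrame P x₀ j x w) := rfl

variable {P}

theorem contMDiffWithinAt_projFrame (hP : W.IsBundleMap W id P) {b : N → B} {w : N → F} {s : Set N}
    {x : N} (hb : ContMDiffWithinAt J IB ∞ b s x) (hw : ContMDiffWithinAt J 𝓘(ℝ, F) ∞ w s x)
    (hx : b x ∈ (trivializationAt W.Model W.Fiber x₀).baseSet) :
    ContMDiffWithinAt J W.TotI ∞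
      (fun n => (⟨b n, projIncl P (b n) (projFrame P x₀ j (b n) (w n))⟩ : W.Tot)) s x :=
  hP.comp_within (W.contMDiffWithinAt_symm x₀ hb
    ((LinearMap.toContinuousLinearMap j).contMDiff.contMDiffAt.comp_contMDiffWithinAt x hw) hx)

omit [FiniteDimensional ℝ F] in
theorem contMDiffWithinAt_projCoord {b : N → B} {c : ∀ n, ProjFiber P (b n)} {s : Set N} {x : N}
    (hc : ContMDiffWithinAt J W.TotI ∞ (fun n => (⟨b n, projIncl P (b n) (c n)⟩ : W.Tot)) s x)
    (hx : b x ∈ (trivializationAt W.Model W.Fiber x₀).baseSet) :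
    ContMDiffWithinAt J 𝓘(ℝ, F) ∞ (fun n => projCoord P x₀ q (b n) (c n)) s x :=
  (LinearMap.toContinuousLinearMap q).contMDiff.contMDiffAt.comp_contMDiffWithinAt x
    (W.contMDiffWithinAt_linearMapAt x₀ hc hx)

theorem contMDiffOn_projGram (hP : W.IsBundleMap W id P) :
    ContMDiffOn IB 𝓘(ℝ, F →L[ℝ] F) ∞ (projGram P x₀ j q)
      (trivializationAt W.Model W.Fiber x₀).baseSet := fun _ hx =>
  ContMDiffWithinAt.clm_of_apply fun _ =>
    contMDiffWithinAt_projCoord x₀ q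
      (contMDiffWithinAt_projFrame x₀ j hP contMDiffWithinAt_id contMDiffWithinAt_const hx) hx

theorem isOpen_projBase (hP : W.IsBundleMap W id P) : IsOpen (projBase P x₀ j q) :=
  (contMDiffOn_projGram x₀ j q hP).continuousOn.isOpen_inter_preimage
    (trivializationAt W.Model W.Fiber x₀).open_baseSet ContinuousLinearEquiv.isOpen

theorem contMDiffOn_inverse_projGram (hP : W.IsBundleMap W id P) :
    ContMDiffOn IB 𝓘(ℝ, F →L[ℝ] F) ∞ (fun x => (projGram P x₀ j q x).inverse)
      (projBase P x₀ j q) := fun x hx => by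
  have h : ContDiffAt ℝ ∞ ContinuousLinearMap.inverse (projGram P x₀ j q x) :=
    ContinuousLinearMap.IsInvertible.contDiffAt_map_inverse hx.2
  exact h.contMDiffAt.comp_contMDiffWithinAt x
    ((contMDiffOn_projGram x₀ j q hP x hx.1).mono Set.inter_subset_left)

/-- Coordinates composed with frame are invertible on `projBase`, so the coordinates are surjective
onto `F`; the image of `P` has the same finite dimension as `F`, so they are injective too. -/
theorem projCoord_injective {x : B} (hr : Nonempty (F ≃ₗ[ℝ] LinearMap.range (P x)))
    (hx : x ∈ projBase P x₀ j q) : Function.Injective (projCoord P x₀ q x) := by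
  obtain ⟨θ⟩ := hr
  let θ' : F ≃ₗ[ℝ] ProjFiber P x := θ
  have hs : Function.Surjective (projCoord P x₀ q x ∘ₗ θ'.toLinearMap) := by
    obtain ⟨T, hT⟩ := hx.2
    intro w
    refine ⟨θ'.symm (projFrame P x₀ j x (T.symm w)), ?_⟩
    rw [LinearMap.comp_apply, LinearEquiv.coe_coe, LinearEquiv.apply_symm_apply, ← projGram_apply,
      ← hT]
    exact T.apply_symm_apply w
  have hi := LinearMap.injective_iff_surjective.2 hs
  intro c c' hc
  obtain ⟨w, rfl⟩ := θ'.surjective c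
  obtain ⟨w', rfl⟩ := θ'.surjective c'
  rw [hi hc]

/-- The parametrization of the image of `P` by the local frame that inverts the coordinates. -/
noncomputable def projParam (P : ∀ x, W.Fiber x →ₗ[ℝ] W.Fiber x) (x₀ : B) (j : F →ₗ[ℝ] W.Model)
    (q : W.Model →ₗ[ℝ] F) (x : B) (w : F) : ProjFiber P x :=
  projFrame P x₀ j x ((projGram P x₀ j q x).inverse w)

theorem projCoord_projParam {x : B} (hx : x ∈ projBase P x₀ j q) (w : F) :
    projCoord P x₀ q x (projParam P x₀ j q x w) = w :=
  DFunLike.congr_fun (ContinuousLinearMap.IsInvertible.self_comp_inverse hx.2) w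

theorem projParam_projCoord {x : B} (hr : Nonempty (F ≃ₗ[ℝ] LinearMap.range (P x)))
    (hx : x ∈ projBase P x₀ j q) (c : ProjFiber P x) :
    projParam P x₀ j q x (projCoord P x₀ q x c) = c :=
  projCoord_injective x₀ j q hr hx (projCoord_projParam x₀ j q hx _)

theorem contMDiffWithinAt_projParam (hP : W.IsBundleMap W id P) {b : N → B} {w : N → F} {s : Set N}
    {x : N} (hb : ContMDiffWithinAt J IB ∞ b s x) (hw : ContMDiffWithinAt J 𝓘(ℝ, F) ∞ w s x)
    (hx : b x ∈ projBase P x₀ j q) :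
    ContMDiffWithinAt J W.TotI ∞
      (fun n => (⟨b n, projIncl P (b n) (projParam P x₀ j q (b n) (w n))⟩ : W.Tot)) s x := by
  have h := ((contMDiffOn_inverse_projGram x₀ j q hP).contMDiffAt
    ((isOpen_projBase x₀ j q hP).mem_nhds hx)).comp_contMDiffWithinAt x hb
  exact contMDiffWithinAt_projFrame x₀ j hP hb (h.clm_apply hw) hx.1

/-- Let `j` be the image of `P x₀` seen in the model fibre and `q` a left inverse of `j`. As `P x₀`
is idempotent, projecting the frame at `x₀` changes nothing and the Gram map there is the identity.
-/
theorem exists_mem_projBase (hPP : ∀ x v, P x (P x v) = P x v)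
    (hr : Nonempty (F ≃ₗ[ℝ] LinearMap.range (P x₀))) :
    ∃ (j : F →ₗ[ℝ] W.Model) (q : W.Model →ₗ[ℝ] F), x₀ ∈ projBase P x₀ j q := by
  obtain ⟨θ⟩ := hr
  let θ' : F ≃ₗ[ℝ] ProjFiber P x₀ := θ
  set e := trivializationAt W.Model W.Fiber x₀
  have hx : x₀ ∈ e.baseSet := mem_baseSet_trivializationAt W.Model W.Fiber x₀
  let j : F →ₗ[ℝ] W.Model := e.linearMapAt ℝ x₀ ∘ₗ projIncl P x₀ ∘ₗ θ'.toLinearMap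
  have hej : ∀ w, e.symmₗ ℝ x₀ (j w) = projIncl P x₀ (θ' w) := fun w =>
    e.symmₗ_linearMapAt hx _
  have hj : LinearMap.ker j = ⊥ := by
    refine LinearMap.ker_eq_bot.2 fun w w' h => θ'.injective (projIncl_injective P x₀ ?_)
    rw [← hej, ← hej, h]
  obtain ⟨q, hq⟩ := j.exists_leftInverse_of_injective hj
  refine ⟨j, q, hx, ContinuousLinearEquiv.refl ℝ F, ?_⟩
  ext w
  refine (LinearMap.congr_fun hq w).symm.trans ?_
  have hPw : P x₀ (projIncl P x₀ (θ' w)) = projIncl P x₀ (θ' w) := by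
    obtain ⟨v, hv⟩ := (exists_projIncl_eq_iff P x₀ _).1 ⟨θ' w, rfl⟩
    rw [← hv, hPP]
  have h1 : projIncl P x₀ (projFrame P x₀ j x₀ w) = projIncl P x₀ (θ' w) :=
    (congrArg (P x₀) (hej w)).trans hPw
  exact congrArg (fun v => q (e.linearMapAt ℝ x₀ v)) h1.symm

/-- The local trivialization of the image of `P` given by the local coordinates. -/
noncomputable def projPretriv (hP : W.IsBundleMap W id P)
    (hr : ∀ x, Nonempty (F ≃ₗ[ℝ] LinearMap.range (P x))) :
    Pretrivialization F (π F (ProjFiber P)) where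
  toFun p := (p.proj, projCoord P x₀ q p.proj p.snd)
  invFun p := ⟨p.1, projParam P x₀ j q p.1 p.2⟩
  source := TotalSpace.proj ⁻¹' projBase P x₀ j q
  target := projBase P x₀ j q ×ˢ Set.univ
  map_source' _ hp := ⟨hp, Set.mem_univ _⟩
  map_target' _ hp := hp.1
  left_inv' p hp := congrArg (TotalSpace.mk p.proj) (projParam_projCoord x₀ j q (hr _) hp p.snd)
  right_inv' p hp := Prod.ext rfl (projCoord_projParam x₀ j q hp.1 p.2)
  open_target := (isOpen_projBase x₀ j q hP).prod isOpen_univ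
  baseSet := projBase P x₀ j q
  open_baseSet := isOpen_projBase x₀ j q hP
  source_eq := rfl
  target_eq := rfl
  proj_toFun _ _ := rfl

theorem projPretriv_symm (hP : W.IsBundleMap W id P)
    (hr : ∀ x, Nonempty (F ≃ₗ[ℝ] LinearMap.range (P x))) {x : B} (hx : x ∈ projBase P x₀ j q)
    (w : F) : (projPretriv x₀ j q hP hr).symm x w = projParam P x₀ j q x w := by
  refine projCoord_injective x₀ j q (hr x) hx ?_
  rw [projCoord_projParam x₀ j q hx]
  exact congrArg Prod.snd ((projPretriv x₀ j q hP hr).apply_mk_symm hx w)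

theorem contMDiffOn_projChange (hP : W.IsBundleMap W id P) (x₁ : B) (j' : F →ₗ[ℝ] W.Model)
    (q' : W.Model →ₗ[ℝ] F) :
    ContMDiffOn IB 𝓘(ℝ, F →L[ℝ] F) ∞
      (fun x => LinearMap.toContinuousLinearMap (projCoord P x₁ q' x ∘ₗ projFrame P x₀ j x ∘ₗ
        (projGram P x₀ j q x).inverse.toLinearMap))
      (projBase P x₀ j q ∩ projBase P x₁ j' q') := fun _ hx =>
  ContMDiffWithinAt.clm_of_apply fun _ =>
    contMDiffWithinAt_projCoord x₁ q'
      (contMDiffWithinAt_projParam x₀ j q hP contMDiffWithinAt_id contMDiffWithinAt_const hx.1)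
      hx.2.1

/-- The image of a smooth projection of constant rank is a smooth vector bundle. -/
theorem exists_bundle_of_projection (hP : W.IsBundleMap W id P)
    (hPP : ∀ x v, P x (P x v) = P x v)
    (hr : ∀ x, Nonempty (F ≃ₗ[ℝ] LinearMap.range (P x))) :
    ∃ (C : SmoothVectorBundle.{u, v} IB B) (k : ∀ x, C.Fiber x →ₗ[ℝ] W.Fiber x),
      C.IsBundleMap W id k ∧ (∀ x, Function.Injective (k x)) ∧
      ∀ x v, (∃ c, k x c = v) ↔ ∃ w, P x w = v := by
  choose j q hx₀ using fun x => exists_mem_projBase (F := F) x hPP (hr x)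
  let t : B → Pretrivialization F (π F (ProjFiber P)) := fun x => projPretriv x (j x) (q x) hP hr
  -- Each fibre gets the topology of its coordinates in the trivialization chosen at its own base
  -- point, which is what a prebundle requires.
  let topF : ∀ x, TopologicalSpace (ProjFiber P x) := fun x =>
    TopologicalSpace.induced (projCoord P x (q x) x) inferInstance
  have hch : ∀ x₀ x₁ b, b ∈ (t x₀).baseSet ∩ (t x₁).baseSet → ∀ w : F,
      LinearMap.toContinuousLinearMap (projCoord P x₁ (q x₁) b ∘ₗ projFrame P x₀ (j x₀) b ∘ₗ
        (projGram P x₀ (j x₀) (q x₀) b).inverse.toLinearMap) w = (t x₁ ⟨b, (t x₀).symm b w⟩).2 :=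
    fun x₀ x₁ b hb w => by
      have h1 := projPretriv_symm x₀ (j x₀) (q x₀) hP hr hb.1 w
      exact (congrArg (projCoord P x₁ (q x₁) b) h1).symm
  let a : VectorPrebundle ℝ F (ProjFiber P) :=
    { pretrivializationAtlas := Set.range t
      pretrivialization_linear' := by
        rintro _ ⟨x, rfl⟩
        exact ⟨fun b _ => (projCoord P x (q x) b).isLinear⟩
      pretrivializationAt := t
      mem_base_pretrivializationAt := hx₀
      pretrivialization_mem_atlas := Set.mem_range_self
      exists_coordChange := by
        rintro _ ⟨x₀, rfl⟩ _ ⟨x₁, rfl⟩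
        exact ⟨_, (contMDiffOn_projChange x₀ (j x₀) (q x₀) hP x₁ (j x₁) (q x₁)).continuousOn,
          hch x₀ x₁⟩
      totalSpaceMk_isInducing := fun b => isInducing_const_prod.2 ⟨rfl⟩ }
  have : a.IsContMDiff IB ∞ := ⟨by
    rintro _ ⟨x₀, rfl⟩ _ ⟨x₁, rfl⟩
    exact ⟨_, contMDiffOn_projChange x₀ (j x₀) (q x₀) hP x₁ (j x₁) (q x₁), hch x₀ x₁⟩⟩
  let := a.totalSpaceTopology
  let := a.toFiberBundle
  have := a.toVectorBundle
  have : ContMDiffVectorBundle ∞ F (ProjFiber P) IB := a.contMDiffVectorBundle IB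
  let C : SmoothVectorBundle.{u, v} IB B := { Model := F, Fiber := ProjFiber P }
  refine ⟨C, projIncl P, fun p₀ => ?_, projIncl_injective P, exists_projIncl_eq_iff P⟩
  set x₀ := p₀.proj
  have h1 := contMDiffAt_totalSpace.1 (contMDiffAt_id (I := C.TotI) (n := ∞) (x := p₀))
  have h2 : ContMDiffAt C.TotI 𝓘(ℝ, F) ∞
      (fun p : C.Tot => projCoord P x₀ (q x₀) p.proj p.snd) p₀ := h1.2
  have h3 := contMDiffWithinAt_projParam x₀ (j x₀) (q x₀) hP (contMDiffWithinAt_univ.2 h1.1)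
    (contMDiffWithinAt_univ.2 h2) (hx₀ x₀)
  have key : ∀ p : C.Tot, p.proj ∈ projBase P x₀ (j x₀) (q x₀) →
      (⟨p.proj, projIncl P p.proj p.snd⟩ : W.Tot) = ⟨p.proj, projIncl P p.proj
        (projParam P x₀ (j x₀) (q x₀) p.proj (projCoord P x₀ (q x₀) p.proj p.snd))⟩ :=
    fun p hp => by rw [projParam_projCoord x₀ (j x₀) (q x₀) (hr _) hp]
  exact (contMDiffWithinAt_univ.1 h3).congr_of_eventuallyEq
    (Filter.mem_of_superset
      (h1.1.continuousAt ((isOpen_projBase x₀ (j x₀) (q x₀) hP).mem_nhds (hx₀ x₀))) key)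

end Projection

end SmoothVectorBundle

/-! ### The core is a smooth vector bundle -/

section Core

variable {EM : Type*} [NormedAddCommGroup EM] [NormedSpace ℝ EM] {HM : Type*} [TopologicalSpace HM]
  {IM : ModelWithCorners ℝ EM HM} {M : Type*} [TopologicalSpace M] [ChartedSpace HM M]
  {EG : Type*} [NormedAddCommGroup EG] [NormedSpace ℝ EG] {HG : Type*} [TopologicalSpace HG]
  {IG : ModelWithCorners ℝ EG HG} {G : Type*} [TopologicalSpace G] [ChartedSpace HG G]
  {𝒢 : LieGroupoid IM M IG G}

theorem SmoothVectorBundle.finiteDimensional_fiber (E : SmoothVectorBundle IM M) (x : M) :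
    FiniteDimensional ℝ (E.Fiber x) :=
  ((trivializationAt E.Model E.Fiber x).continuousLinearEquivAt ℝ x
    (mem_baseSet_trivializationAt E.Model E.Fiber x)).symm.toLinearEquiv.finiteDimensional

theorem SmoothVectorBundle.finrank_fiber (E : SmoothVectorBundle IM M) (x : M) :
    Module.finrank ℝ (E.Fiber x) = Module.finrank ℝ E.Model :=
  ((trivializationAt E.Model E.Fiber x).continuousLinearEquivAt ℝ x
    (mem_baseSet_trivializationAt E.Model E.Fiber x)).toLinearEquiv.finrank_eq

/-- The core of a VB-groupoid with a horizontal lift is a smooth vector bundle: it is the image of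
the projection `v ↦ v - h(s̃(v))` on the restriction of `Γ` to the units. -/
theorem IsVBGroupoid.exists_isCore {E : SmoothVectorBundle IM M}
    {Γ : SmoothVectorBundle.{u, v} IG G} {V : GroupoidData E.Tot Γ.Tot}
    {h : ∀ g : G, E.Fiber (𝒢.src g) →ₗ[ℝ] Γ.Fiber g}
    (hV : IsVBGroupoid 𝒢 E Γ V) (hh : IsHorizontalLift 𝒢 V h) :
    ∃ (C : SmoothVectorBundle.{u, v} IM M)
      (k : ∀ x : M, C.Fiber x →ₗ[ℝ] Γ.Fiber (𝒢.one x)), IsCore 𝒢 V C k := by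
  let one : C^∞⟮IM, M; IG, G⟯ := ⟨𝒢.one, 𝒢.isLie.contMDiff_one⟩
  let W := Γ.pullback one
  let P : ∀ x, W.Fiber x →ₗ[ℝ] W.Fiber x := fun x =>
    (LinearMap.id - h (𝒢.one x) ∘ₗ hV.srcL (𝒢.one x) :
      Γ.Fiber (𝒢.one x) →ₗ[ℝ] Γ.Fiber (𝒢.one x))
  have hsh : ∀ g e, hV.srcL g (h g e) = e := fun g e => by
    have h1 := hh.src_lift g e
    rwa [hV.src_mk, E.mk_inj] at h1
  have hsP : ∀ x v, hV.srcL (𝒢.one x) (P x v) = 0 := fun x v => by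
    refine (map_sub _ _ _).trans ?_
    rw [sub_eq_zero]
    exact (hsh _ _).symm
  have hPv : ∀ x v, hV.srcL (𝒢.one x) v = 0 → P x v = v := fun x v hv => by
    change v - h (𝒢.one x) (hV.srcL (𝒢.one x) v) = v
    rw [hv, map_zero, sub_zero]
  have hrange : ∀ x v, (∃ w, P x w = v) ↔ hV.srcL (𝒢.one x) v = 0 := fun x v =>
    ⟨fun ⟨w, hw⟩ => hw ▸ hsP x w, fun hv => ⟨v, hPv x v hv⟩⟩
  have hP : W.IsBundleMap W id P := fun p => by
    rw [← contMDiffWithinAt_univ]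
    have hp : ContMDiffWithinAt W.TotI Γ.TotI ∞ (Γ.lift one) Set.univ p :=
      (Γ.contMDiff_lift one).contMDiffAt
    refine (Γ.contMDiffWithinAt_pullback_iff one).2 ⟨(contMDiff_proj W.Fiber).contMDiffAt, ?_⟩
    refine ContMDiffWithinAt.fiber_sub Γ hp (hh.contMDiffWithinAt_lift
      ((contMDiff_proj Γ.Fiber).contMDiffAt.comp_contMDiffWithinAt p hp) ?_)
    refine (hV.isLie.contMDiff_src.contMDiffAt.comp_contMDiffWithinAt p hp).congr
      (fun q _ => ?_) ?_
    all_goals exact (hV.src_mk _ _).symm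
  -- Since `h` is a section of `s̃`, the source map is surjective on fibres, so `ker s̃` has
  -- dimension `d` everywhere, and the natural-number subtraction loses nothing.
  let d := Module.finrank ℝ Γ.Model - Module.finrank ℝ E.Model
  -- The `ULift` places the model fibre of the core in the same universe as that of `Γ`.
  have hr : ∀ x, Nonempty (EuclideanSpace ℝ (ULift.{u} (Fin d)) ≃ₗ[ℝ] LinearMap.range (P x)) :=
    fun x => by
      have := Γ.finiteDimensional_fiber (𝒢.one x)
      have := E.finiteDimensional_fiber (𝒢.src (𝒢.one x))
      have hker : LinearMap.range (P x) = LinearMap.ker (hV.srcL (𝒢.one x)) := by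
        ext v
        exact hrange x v
      have h1 := (hV.srcL (𝒢.one x)).finrank_range_add_finrank_ker
      rw [LinearMap.range_eq_top.2 fun e => ⟨_, hsh (𝒢.one x) e⟩, finrank_top, E.finrank_fiber,
        Γ.finrank_fiber] at h1
      rw [hker]
      have hd : Module.finrank ℝ (EuclideanSpace ℝ (ULift.{u} (Fin d))) =
          Module.finrank ℝ (LinearMap.ker (hV.srcL (𝒢.one x))) := by
        rw [finrank_euclideanSpace, Fintype.card_ulift, Fintype.card_fin]
        omega
      let θ : EuclideanSpace ℝ (ULift.{u} (Fin d)) ≃ₗ[ℝ] LinearMap.ker (hV.srcL (𝒢.one x)) :=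
        LinearEquiv.ofFinrankEq _ _ hd
      exact ⟨θ⟩
  obtain ⟨C, k, hk, hinj, hkr⟩ := SmoothVectorBundle.exists_bundle_of_projection hP
    (fun x v => hPv x _ (hsP x v)) hr
  refine ⟨C, k, { smooth := ?_, injective := hinj, range_eq := fun x v => ?_ }⟩
  · exact (Γ.contMDiff_lift one).comp hk
  · refine (hkr x v).trans ((hrange x v).trans ?_)
    rw [hV.src_mk, E.mk_eq_mk_iff]
    exact ⟨fun hv => ⟨𝒢.src_one x, by rw [hv, map_zero]⟩,
      fun ⟨_, hv⟩ => (E.tr _).map_eq_zero_iff.1 hv.symm⟩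

end Core

/-! ### Bijection between isomorphism classes -/

section Bijection

variable {EM : Type*} [NormedAddCommGroup EM] [NormedSpace ℝ EM] {HM : Type*} [TopologicalSpace HM]
  {IM : ModelWithCorners ℝ EM HM} {M : Type*} [TopologicalSpace M] [ChartedSpace HM M]
  {EG : Type*} [NormedAddCommGroup EG] [NormedSpace ℝ EG] {HG : Type*} [TopologicalSpace HG]
  {IG : ModelWithCorners ℝ EG HG} {G : Type*} [TopologicalSpace G] [ChartedSpace HG G]
  {𝒢 : LieGroupoid IM M IG G}

namespace LiftedVBGroupoid

variable {E : SmoothVectorBundle.{u, v} IM M}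

theorem Iso.refl (X : LiftedVBGroupoid 𝒢 E) : X.Iso X :=
  ⟨fun _ => LinearEquiv.refl ℝ _, {
    smooth := contMDiff_id
    smooth_symm := contMDiff_id
    map_src := fun _ => rfl
    map_tgt := fun _ => rfl
    map_mul := fun _ _ _ => rfl
    map_lift := fun _ _ => rfl }⟩

theorem Iso.symm {X Y : LiftedVBGroupoid 𝒢 E} : X.Iso Y → Y.Iso X := by
  rintro ⟨Φ, hΦ⟩
  have hs : ∀ γ : Y.Γ.Tot, (⟨γ.proj, Φ γ.proj ((Φ γ.proj).symm γ.snd)⟩ : Y.Γ.Tot) = γ := fun γ =>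
    congrArg (TotalSpace.mk γ.proj) ((Φ γ.proj).apply_symm_apply γ.snd)
  have hsrc : ∀ γ : Y.Γ.Tot, X.str.src ⟨γ.proj, (Φ γ.proj).symm γ.snd⟩ = Y.str.src γ := fun γ => by
    rw [← hΦ.map_src]
    exact congrArg Y.str.src (hs γ)
  have htgt : ∀ γ : Y.Γ.Tot, X.str.tgt ⟨γ.proj, (Φ γ.proj).symm γ.snd⟩ = Y.str.tgt γ := fun γ => by
    rw [← hΦ.map_tgt]
    exact congrArg Y.str.tgt (hs γ)
  refine ⟨fun g => (Φ g).symm, {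
    smooth := hΦ.smooth_symm
    smooth_symm := hΦ.smooth
    map_src := hsrc
    map_tgt := htgt
    map_mul := fun γ₁ γ₂ H => ?_
    map_lift := fun g e => (Φ g).symm_apply_eq.2 (hΦ.map_lift g e).symm }⟩
  have h1 := hΦ.map_mul _ _ ((hsrc γ₁).trans (H.trans (htgt γ₂).symm))
  have h2 := (congrArg₂ Y.str.mul (hs γ₁) (hs γ₂)).symm.trans h1
  rw [h2]
  exact congrArg (TotalSpace.mk _) ((Φ _).symm_apply_apply _).symm

theorem Iso.trans {X Y Z : LiftedVBGroupoid 𝒢 E} : X.Iso Y → Y.Iso Z → X.Iso Z := by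
  rintro ⟨Φ, hΦ⟩ ⟨Ψ, hΨ⟩
  refine ⟨fun g => (Φ g).trans (Ψ g), {
    smooth := hΨ.smooth.comp hΦ.smooth
    smooth_symm := hΦ.smooth_symm.comp hΨ.smooth_symm
    map_src := fun γ => (hΨ.map_src _).trans (hΦ.map_src γ)
    map_tgt := fun γ => (hΨ.map_tgt _).trans (hΦ.map_tgt γ)
    map_mul := fun γ₁ γ₂ H => ?_
    map_lift := fun g e => (congrArg (Ψ g) (hΦ.map_lift g e)).trans (hΨ.map_lift g e) }⟩
  have h1 := hΨ.map_mul ⟨γ₁.proj, Φ γ₁.proj γ₁.snd⟩ ⟨γ₂.proj, Φ γ₂.proj γ₂.snd⟩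
    ((hΦ.map_src γ₁).trans (H.trans (hΦ.map_tgt γ₂).symm))
  refine h1.trans ?_
  rw [hΦ.map_mul γ₁ γ₂ H]
  rfl

/-- `Quot` identifies along the generated equivalence relation; since `Iso` is already one, equality
of classes yields an actual isomorphism, as injectivity requires. -/
theorem quot_mk_eq_iff {X Y : LiftedVBGroupoid 𝒢 E} :
    Quot.mk Iso X = Quot.mk Iso Y ↔ X.Iso Y := by
  refine ⟨fun h => ?_, Quot.sound⟩
  have h1 := Quot.eqvGen_exact h
  rwa [Equivalence.eqvGen_iff ⟨Iso.refl, Iso.symm, Iso.trans⟩] at h1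

end LiftedVBGroupoid

variable [IsManifold IG ∞ G] {E : SmoothVectorBundle.{u, v} IM M}

namespace TwoTermRep

/-- The VB-groupoid with horizontal lift of a representation up to homotopy. -/
noncomputable def toLifted (R : TwoTermRep 𝒢 E) : LiftedVBGroupoid 𝒢 E :=
  ⟨𝒢.split R.C E, R.ruth.groupoid, R.ruth.isVBGroupoid_groupoid, 𝒢.splitLift R.C E,
    R.ruth.isHorizontalLift_splitLift⟩

theorem toLifted_iso_iff {R R' : TwoTermRep 𝒢 E} : R.toLifted.Iso R'.toLifted ↔ R.Iso R' := by
  constructor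
  · rintro ⟨Φ, hΦ⟩
    obtain ⟨φ, hφ, -⟩ := Ruth.exists_isRuthIso_of_isLiftedIso hΦ
    exact ⟨φ, hφ⟩
  · rintro ⟨φ, hφ⟩
    let Φ : ∀ g : G, (𝒢.split R.C E).Fiber g ≃ₗ[ℝ] (𝒢.split R'.C E).Fiber g := fun g =>
      LinearEquiv.prodCongr (φ (𝒢.tgt g)) (LinearEquiv.refl ℝ (E.Fiber (𝒢.src g)))
    exact ⟨Φ, Ruth.isLiftedIso_of_isRuthIso hφ fun _ _ _ => rfl⟩

theorem exists_toLifted_iso (X : LiftedVBGroupoid 𝒢 E) :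
    ∃ R : TwoTermRep 𝒢 E, R.toLifted.Iso X := by
  obtain ⟨C, k, hk⟩ := X.isVB.exists_isCore X.isLift
  obtain ⟨S⟩ := exists_splitData X.isVB X.isLift hk
  obtain ⟨Φ, hΦ, -⟩ := S.exists_liftedIso X.isVB X.isLift hk
  exact ⟨⟨C, S.toRuth X.isVB X.isLift hk⟩, Φ, hΦ⟩

end TwoTermRep

end Bijection

theorem theorem5p2
    {EM : Type w₁} [NormedAddCommGroup EM] [NormedSpace ℝ EM] [FiniteDimensional ℝ EM]
    {M : Type w₂} [TopologicalSpace M] [ChartedSpace EM M] [IsManifold 𝓘(ℝ, EM) ∞ M]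
    {EG : Type w₃} [NormedAddCommGroup EG] [NormedSpace ℝ EG] [FiniteDimensional ℝ EG]
    {G : Type w₄} [TopologicalSpace G] [ChartedSpace EG G] [IsManifold 𝓘(ℝ, EG) ∞ G]
    (𝒢 : LieGroupoid 𝓘(ℝ, EM) M 𝓘(ℝ, EG) G)
    (E : SmoothVectorBundle.{u, v} 𝓘(ℝ, EM) M) :
    -- from representations up to homotopy to VB-groupoids with horizontal lift, and back
    (∀ (C : SmoothVectorBundle.{u, v} 𝓘(ℝ, EM) M) (D : Ruth 𝒢 E C),
      IsVBGroupoid 𝒢 E (𝒢.split C E) D.groupoid ∧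
      IsHorizontalLift 𝒢 D.groupoid (𝒢.splitLift C E) ∧
      IsCore 𝒢 D.groupoid C (𝒢.splitCore C E) ∧
      IsComponents 𝒢 D.groupoid (𝒢.splitLift C E) (𝒢.splitCore C E) D) ∧
    -- from VB-groupoids with horizontal lift to representations up to homotopy, and back
    (∀ (Γ : SmoothVectorBundle.{u, v} 𝓘(ℝ, EG) G) (V : GroupoidData E.Tot Γ.Tot)
      (h : ∀ g : G, E.Fiber (𝒢.src g) →ₗ[ℝ] Γ.Fiber g),
      IsVBGroupoid 𝒢 E Γ V → IsHorizontalLift 𝒢 V h →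
      (∃ (C : SmoothVectorBundle.{u, v} 𝓘(ℝ, EM) M)
        (k : ∀ x : M, C.Fiber x →ₗ[ℝ] Γ.Fiber (𝒢.one x)), IsCore 𝒢 V C k) ∧
      ∀ (C : SmoothVectorBundle.{u, v} 𝓘(ℝ, EM) M)
        (k : ∀ x : M, C.Fiber x →ₗ[ℝ] Γ.Fiber (𝒢.one x)), IsCore 𝒢 V C k →
        (∃! D : Ruth 𝒢 E C, IsComponents 𝒢 V h k D) ∧
        ∀ D : Ruth 𝒢 E C, IsComponents 𝒢 V h k D →
          ∃ Φ : ∀ g : G, (𝒢.split C E).Fiber g ≃ₗ[ℝ] Γ.Fiber g,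
            IsLiftedIso 𝒢 D.groupoid (𝒢.splitLift C E) V h Φ ∧
            ∀ g (c : C.Fiber (𝒢.tgt g)) (e : E.Fiber (𝒢.src g)) (w : Γ.Fiber g),
              V.mul ⟨𝒢.one (𝒢.tgt g), k (𝒢.tgt g) c⟩ ⟨g, 0⟩ = ⟨g, w⟩ →
              Φ g (c, e) = w + h g e) ∧
    -- the isomorphisms on the two sides correspond
    (∀ (C C' : SmoothVectorBundle.{u, v} 𝓘(ℝ, EM) M) (D : Ruth 𝒢 E C) (D' : Ruth 𝒢 E C')
      (Φ : ∀ g : G, (𝒢.split C E).Fiber g ≃ₗ[ℝ] (𝒢.split C' E).Fiber g),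
      IsLiftedIso 𝒢 D.groupoid (𝒢.splitLift C E) D'.groupoid (𝒢.splitLift C' E) Φ ↔
      ∃ φ : ∀ x : M, C.Fiber x ≃ₗ[ℝ] C'.Fiber x, IsRuthIso D D' φ ∧
        ∀ g (c : C.Fiber (𝒢.tgt g)) (e : E.Fiber (𝒢.src g)),
          Φ g (c, e) = (φ (𝒢.tgt g) c, e)) ∧
    -- the resulting bijection
    (∃ Θ : Quot (TwoTermRep.Iso (𝒢 := 𝒢) (E := E)) →
        Quot (LiftedVBGroupoid.Iso (𝒢 := 𝒢) (E := E)),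
      Function.Bijective Θ ∧
      ∀ (C : SmoothVectorBundle.{u, v} 𝓘(ℝ, EM) M) (D : Ruth 𝒢 E C)
        (hV : IsVBGroupoid 𝒢 E (𝒢.split C E) D.groupoid)
        (hL : IsHorizontalLift 𝒢 D.groupoid (𝒢.splitLift C E)),
        Θ (Quot.mk _ ⟨C, D⟩) =
          Quot.mk _ ⟨𝒢.split C E, D.groupoid, hV, 𝒢.splitLift C E, hL⟩) := by
  refine ⟨fun C D => ⟨D.isVBGroupoid_groupoid, D.isHorizontalLift_splitLift, D.isCore_splitCore,
    D.isComponents_groupoid⟩, fun Γ V h hV hh => ⟨hV.exists_isCore hh, fun C k hk => ?_⟩,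
    fun C C' D D' Φ => ⟨Ruth.exists_isRuthIso_of_isLiftedIso,
      fun ⟨φ, hφ, hΦ⟩ => Ruth.isLiftedIso_of_isRuthIso hφ hΦ⟩, ?_⟩
  · obtain ⟨S⟩ := exists_splitData hV hh hk
    refine ⟨⟨S.toRuth hV hh hk, S.isComponents_toRuth hV hh hk,
      fun D hD => S.eq_toRuth hV hh hk hD⟩, fun D hD => ?_⟩
    obtain ⟨Φ, hΦ, hΦe⟩ := S.exists_liftedIso hV hh hk
    rw [S.eq_toRuth hV hh hk hD]
    refine ⟨Φ, hΦ, fun g c e w hw => ?_⟩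
    -- The product `k(c) · 0_g` is `act g c` by construction, so `w` is the core part of the
    -- isomorphism.
    rw [S.act_eq, Γ.mk_inj] at hw
    rw [← hw]
    exact hΦe g c e
  · refine ⟨Quot.map TwoTermRep.toLifted fun _ _ => TwoTermRep.toLifted_iso_iff.2, ⟨?_, ?_⟩,
      fun C D hV hL => rfl⟩
    · rintro ⟨R⟩ ⟨R'⟩ H
      exact Quot.sound (TwoTermRep.toLifted_iso_iff.1 (LiftedVBGroupoid.quot_mk_eq_iff.1 H))
    · rintro ⟨X⟩
      obtain ⟨R, hR⟩ := TwoTermRep.exists_toLifted_iso X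
      exact ⟨Quot.mk _ R, LiftedVBGroupoid.quot_mk_eq_iff.2 hR⟩
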